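/- There is a deterministic data structure for decremental $(1+\varepsilon)$-approximate all-pairs shortest paths in unweighted undirected graphs with the following guarantee. Let $\varepsilon>0$ be real and let $G=(V,E)$ be an unweighted undirected graph with $n=|V|\ge 2$ vertices and $m=|E|$ edges that is initially connected and then undergoes an arbitrary (adaptive) sequence of edge deletions, interleaved with distance queries. Each query for a pair $u,v\in V$ returns an estimate $\widetilde{\mathbf{dist}}(u,v)\in\mathbb N\cup\{\infty\}$ such that, in the current version of the graph, $$\mathbf{dist}(u,v)\;\le\;\widetilde{\mathbf{dist}}(u,v)\;\le\;(1+\varepsilon)\,\mathbf{dist}(u,v),$$ where $\mathbf{dist}(u,v)=\infty$ if $u$ and $v$ are not connected. The total update time, that is, the time for the initialization and all edge deletions together, is $O(mn\log n/\min(\varepsilon,1))$, so $O(mn\log n/\varepsilon)$ for $0<\varepsilon<1$, and each query takes worst-case time $O(1+\log\log n)$. The constants in the $O$-bounds are absolute. The model is the unit-cost word RAM with a word size of at least $K\log(n+p+q)$ bits, for an absolute constant $K$, where the program is the same for all inputs and is given $\varepsilon$ through positive integers $p,q$ with $p/q\le\varepsilon\le 2p/q$. -/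

import Mathlib

/-!
## The word RAM

A unit-cost word RAM with word size `w`, presented as a structured language. A program has finitely
many registers (the variables that occur in it) and one random-access memory of words. All values
that a program computes have to fit into one word: a computation of a value `≥ 2 ^ w` gets stuck.
Programs are finite texts that do not depend on the input or on `w`, and there are no random bits.
-/

namespace WordRAM

/-- Machine state: the registers and the memory. -/
structure State where
  reg : ℕ → ℕ
  mem : ℕ → ℕ

/-- Write the value `v` to the register `x`. -/
def State.setReg (σ : State) (x v : ℕ) : State :=
  { σ with reg := Function.update σ.reg x v }

/-- Write the value `v` to the memory cell with address `a`. -/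
def State.setMem (σ : State) (a v : ℕ) : State :=
  { σ with mem := Function.update σ.mem a v }

/-- The binary word operations. -/
inductive BinOp where
  | add | sub | mul | div | mod | lt | eq

/-- Meaning of the operations: subtraction is truncated at `0`, division by `0` gives `0`, and
comparisons give `1` (true) or `0` (false). -/
def BinOp.apply : BinOp → ℕ → ℕ → ℕ
  | .add, a, b => a + b
  | .sub, a, b => a - b
  | .mul, a, b => a * b
  | .div, a, b => a / b
  | .mod, a, b => a % b
  | .lt, a, b => if a < b then 1 else 0
  | .eq, a, b => if a = b then 1 else 0

/-- Expressions: constants, registers, memory reads and binary operations. -/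
inductive Expr where
  | const (k : ℕ)
  | reg (x : ℕ)
  | load (a : Expr)
  | bin (o : BinOp) (a b : Expr)

/-- Number of elementary operations needed to evaluate an expression. -/
def Expr.cost : Expr → ℕ
  | .const _ => 1
  | .reg _ => 1
  | .load a => a.cost + 1
  | .bin _ a b => a.cost + b.cost + 1

/-- The value `k` if it fits into a word of `w` bits; otherwise the computation is stuck. -/
def toWord (w k : ℕ) : Option ℕ :=
  if k < 2 ^ w then some k else none

/-- Value of an expression on a machine with word size `w`. -/
def Expr.eval (w : ℕ) (σ : State) : Expr → Option ℕ
  | .const k => toWord w k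
  | .reg x => some (σ.reg x)
  | .load a => (a.eval w σ).map σ.mem
  | .bin o a b => (a.eval w σ).bind fun x => (b.eval w σ).bind fun y => toWord w (o.apply x y)

/-- Programs. -/
inductive Cmd where
  | skip
  | assign (x : ℕ) (e : Expr)
  | store (a e : Expr)
  | seq (c₁ c₂ : Cmd)
  | ite (e : Expr) (c₁ c₂ : Cmd)
  | while (e : Expr) (c : Cmd)

/-- `Exec w c σ t σ'`: on a machine with word size `w`, the program `c` started in the state `σ`
halts in the state `σ'` after exactly `t` elementary steps. -/
inductive Exec (w : ℕ) : Cmd → State → ℕ → State → Prop where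
  | skip (σ : State) : Exec w .skip σ 1 σ
  | assign {x : ℕ} {e : Expr} {σ : State} {v : ℕ} (he : e.eval w σ = some v) :
      Exec w (.assign x e) σ (e.cost + 1) (σ.setReg x v)
  | store {a e : Expr} {σ : State} {i v : ℕ}
      (ha : a.eval w σ = some i) (he : e.eval w σ = some v) :
      Exec w (.store a e) σ (a.cost + e.cost + 1) (σ.setMem i v)
  | seq {c₁ c₂ : Cmd} {σ σ₁ σ₂ : State} {t₁ t₂ : ℕ}
      (h₁ : Exec w c₁ σ t₁ σ₁) (h₂ : Exec w c₂ σ₁ t₂ σ₂) :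
      Exec w (.seq c₁ c₂) σ (t₁ + t₂) σ₂
  | ite_true {e : Expr} {c₁ c₂ : Cmd} {σ σ' : State} {v t : ℕ}
      (he : e.eval w σ = some v) (hv : v ≠ 0) (h : Exec w c₁ σ t σ') :
      Exec w (.ite e c₁ c₂) σ (e.cost + 1 + t) σ'
  | ite_false {e : Expr} {c₁ c₂ : Cmd} {σ σ' : State} {t : ℕ}
      (he : e.eval w σ = some 0) (h : Exec w c₂ σ t σ') :
      Exec w (.ite e c₁ c₂) σ (e.cost + 1 + t) σ'
  | while_true {e : Expr} {c : Cmd} {σ σ₁ σ₂ : State} {v t₁ t₂ : ℕ}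
      (he : e.eval w σ = some v) (hv : v ≠ 0)
      (h₁ : Exec w c σ t₁ σ₁) (h₂ : Exec w (.while e c) σ₁ t₂ σ₂) :
      Exec w (.while e c) σ (e.cost + 1 + t₁ + t₂) σ₂
  | while_false {e : Expr} {c : Cmd} {σ : State} (he : e.eval w σ = some 0) :
      Exec w (.while e c) σ (e.cost + 1) σ

/-- The machine is deterministic: final state and running time are determined by the initial
state. -/
theorem Exec.deterministic {w : ℕ} {c : Cmd} {σ σ₁ σ₂ : State} {t₁ t₂ : ℕ}
    (h₁ : Exec w c σ t₁ σ₁) (h₂ : Exec w c σ t₂ σ₂) : t₁ = t₂ ∧ σ₁ = σ₂ := by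
  induction h₁ generalizing t₂ σ₂ with
  | skip σ => cases h₂; exact ⟨rfl, rfl⟩
  | assign he =>
    cases h₂ with
    | assign he' => rw [he] at he'; cases he'; exact ⟨rfl, rfl⟩
  | store ha he =>
    cases h₂ with
    | store ha' he' => rw [ha] at ha'; rw [he] at he'; cases ha'; cases he'; exact ⟨rfl, rfl⟩
  | seq _ _ ih₁ ih₂ =>
    cases h₂ with
    | seq h₁' h₂' =>
      obtain ⟨rfl, rfl⟩ := ih₁ h₁'
      obtain ⟨rfl, rfl⟩ := ih₂ h₂'
      exact ⟨rfl, rfl⟩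
  | ite_true he hv _ ih =>
    cases h₂ with
    | ite_true _ _ h' => obtain ⟨rfl, rfl⟩ := ih h'; exact ⟨rfl, rfl⟩
    | ite_false he' _ => rw [he] at he'; cases he'; exact absurd rfl hv
  | ite_false he _ ih =>
    cases h₂ with
    | ite_true he' hv' _ => rw [he] at he'; cases he'; exact absurd rfl hv'
    | ite_false _ h' => obtain ⟨rfl, rfl⟩ := ih h'; exact ⟨rfl, rfl⟩
  | while_true he hv _ _ ih₁ ih₂ =>
    cases h₂ with
    | while_true _ _ h₁' h₂' =>
      obtain ⟨rfl, rfl⟩ := ih₁ h₁'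
      obtain ⟨rfl, rfl⟩ := ih₂ h₂'
      exact ⟨rfl, rfl⟩
    | while_false he' => rw [he] at he'; cases he'; exact absurd rfl hv
  | while_false he =>
    cases h₂ with
    | while_true he' hv' _ _ => rw [he] at he'; cases he'; exact absurd rfl hv'
    | while_false _ => exact ⟨rfl, rfl⟩

end WordRAM

/-! ## Data structures for decremental distances -/

namespace DecrementalAPSP

open WordRAM

/-- A data structure: one program each for the initialization, the deletion of an edge, and a
distance query. State persists between the calls in the registers and the memory. -/
structure DataStructure where
  init : Cmd
  delete : Cmd
  query : Cmd

/-- The operations that a user may request on a graph with vertex set `Fin n`. -/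
inductive Op (n : ℕ) where
  | delete (u v : Fin n)
  | query (u v : Fin n)

/-- `L` lists the edges of `G`: every edge exactly once, in any order and orientation. -/
def IsEdgeList {n : ℕ} (L : List (Fin n × Fin n)) (G : SimpleGraph (Fin n)) : Prop :=
  (L.map fun e => s(e.1, e.2)).Nodup ∧
    ∀ e : Sym2 (Fin n), e ∈ L.map (fun e => s(e.1, e.2)) ↔ e ∈ G.edgeSet

/-- The state in which the initialization starts. Registers `0, 1, 2, 3` hold the number of
vertices, the number of edges, and the numerator and denominator of the precision parameter; the
memory holds the endpoints of the listed edges one after the other. All the rest is `0`. -/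
def inputState {n : ℕ} (L : List (Fin n × Fin n)) (p q : ℕ) : State where
  reg := fun i => [n, L.length, p, q].getD i 0
  mem := fun i => (L.flatMap fun e => [(e.1 : ℕ), (e.2 : ℕ)]).getD i 0

/-- The arguments of a deletion or query are passed in the registers `0` and `1`. -/
def withArgs {n : ℕ} (σ : State) (u v : Fin n) : State :=
  (σ.setReg 0 u).setReg 1 v

/-- The answer to a query: `∞` if the register `0` holds `0`, and the content of the register `1`
otherwise. -/
def answer (σ : State) : ℕ∞ :=
  if σ.reg 0 = 0 then ⊤ else (σ.reg 1 : ℕ∞)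

/-- `d` is a `(1 + ε)`-approximation of the distance from `u` to `v` in `G`
(which is `∞` if `u` and `v` are not connected). -/
def IsApproxDist {n : ℕ} (G : SimpleGraph (Fin n)) (ε : ℝ) (u v : Fin n) (d : ℕ∞) : Prop :=
  G.edist u v ≤ d ∧
    (d : ENNReal) ≤ ENNReal.ofReal (1 + ε) * (G.edist u v : ENNReal)

/-- Starting in the state `σ` when the current graph is `G` and `T` time steps were spent so far on
initialization and deletions, the data structure `D` processes the operations in the list correctly
and in time: every call halts, each query is answered by a `(1 + ε)`-approximate distance in the
current graph within `Q` steps, and the total time of the initialization and all deletions is at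
most `U`. Only deletions of edges of the current graph have to be processed. -/
def Serves (D : DataStructure) (w : ℕ) {n : ℕ} (ε U Q : ℝ) :
    List (Op n) → SimpleGraph (Fin n) → State → ℕ → Prop
  | [], _, _, T => (T : ℝ) ≤ U
  | .delete u v :: ops, G, σ, T =>
      G.Adj u v → ∃ (t : ℕ) (σ' : State),
        Exec w D.delete (withArgs σ u v) t σ' ∧
        Serves D w ε U Q ops (G.deleteEdges {s(u, v)}) σ' (T + t)
  | .query u v :: ops, G, σ, T =>
      ∃ (t : ℕ) (σ' : State),
        Exec w D.query (withArgs σ u v) t σ' ∧ (t : ℝ) ≤ Q ∧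
        IsApproxDist G ε u v (answer σ') ∧
        Serves D w ε U Q ops G σ' T

end DecrementalAPSP

/-!
For every scale `i < ⌈log₂ n⌉` the data structure maintains a set of centres with distance trees of
depth `4 * 2 ^ i`. Let `h` be about `ε * 2 ^ i / 4`, and call a component small if it has at most `h`
vertices. A label is an offset of at most `h`, which is the label of the root, plus the distance from
the root. Every vertex `u` in a large component is covered by a centre, which means that its label
`lab u` is at most `2 * h`. If `lab v` is the label of `v` in the tree of that centre, then
`dist u v ≤ lab u + lab v ≤ 2 * lab u + dist u v ≤ dist u v + 4 * h`, which is the desired estimate if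
`dist u v` is between `2 ^ i` and `2 ^ (i + 1)`; the component of `u` is large in this case. A binary
search over the scales finds a suitable scale (`Good.found`), so a query takes time `O(log log n)`.

There are never more than `n / (h + 1)` centres at a scale, counted with those that were closed
(`ScaleData.Inv.num_mul_le`). A vertex that is not covered is far from all centres, so a new centre
can be opened there, and the sets of the vertices with a label of at most `h` stay disjoint, as labels
never decrease. When the deletion of an edge makes the component of a root small, the centre moves to
the other end of the edge and keeps all labels, so that its offset becomes the label of that end. The
offset increases by at most the number of vertices that come to lie in a small component and whose
label is between the old and the new offset (`ScaleData.Inv.weight_le`). If the other side is small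
as well, or the offset would exceed `h`, then the centre is closed, and `h + 1` vertices pay for it.

In a tree, every vertex has a pointer into its adjacency list, which moves to a neighbour with a
smaller label, and the label increases by one when the list is exhausted. A label increases at most
`4 * 2 ^ i + 1` times, so a tree takes time `O(m * 2 ^ i)`, and a scale takes time
`O(m * 2 ^ i * n / (h + 1)) = O(m * n / ε)`. This is measured by the potentials `treePot` and
`ScaleData.pot`. Which components are large at a scale is read off from the trees of the scale before:
the number of vertices in the tree of a covering centre tells whether the component has more than `h'`
vertices, where `h'` is the radius of the next scale (`ScaleData.Inv.lt_csize_iff`). At the first scale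
the radius is `0`, and every component is large.

The programs are verified with the predicate `Run`, which combines the weakest precondition of a
program with the running time. The machine works with the image of the current graph in `ℕ`, and its
numbers stay below a fixed power of `n + p + q`, so no operation overflows.
-/

set_option linter.unusedSimpArgs false

namespace WordRAM

/-! ### Symbolic execution of word RAM programs -/

/-- The value of an expression on a machine with unbounded words. -/
def Expr.val (σ : State) : Expr → ℕ
  | .const k => k
  | .reg x => σ.reg x
  | .load a => σ.mem (a.val σ)
  | .bin o a b => o.apply (a.val σ) (b.val σ)

/-- All values that occur in the evaluation of the expression fit into a word. -/
def Expr.Fits (w : ℕ) (σ : State) : Expr → Prop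
  | .const k => k < 2 ^ w
  | .reg _ => True
  | .load a => a.Fits w σ
  | .bin o a b => a.Fits w σ ∧ b.Fits w σ ∧ o.apply (a.val σ) (b.val σ) < 2 ^ w

/-- Evaluation succeeds exactly if nothing overflows, and then the word size does not matter. -/
theorem Expr.eval_eq_some_iff {w : ℕ} {σ : State} {e : Expr} {v : ℕ} :
    e.eval w σ = some v ↔ e.Fits w σ ∧ e.val σ = v := by
  induction e generalizing v with
  | const k => simp [Expr.eval, Expr.Fits, Expr.val, toWord]
  | reg x => simp [Expr.eval, Expr.Fits, Expr.val]
  | load a ih => simp [Expr.eval, Expr.Fits, Expr.val, ih]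
  | bin o a b iha ihb =>
    simp only [Expr.eval, Expr.Fits, Expr.val, Option.bind_eq_some_iff, iha, ihb, toWord]
    constructor
    · rintro ⟨x, ⟨h1, rfl⟩, y, ⟨h2, rfl⟩, h3⟩
      split_ifs at h3 with h
      exact ⟨⟨h1, h2, h⟩, by simpa using h3⟩
    · rintro ⟨⟨h1, h2, h3⟩, rfl⟩
      exact ⟨_, ⟨h1, rfl⟩, _, ⟨h2, rfl⟩, by simp [h3]⟩

instance : Add Expr := ⟨.bin .add⟩
instance : Sub Expr := ⟨.bin .sub⟩
instance : Mul Expr := ⟨.bin .mul⟩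
instance : Div Expr := ⟨.bin .div⟩

/-- The expression for the comparison `a < b`. -/
def Expr.lt (a b : Expr) : Expr := .bin .lt a b

/-- The expression for the test `a = b`. -/
def Expr.eq (a b : Expr) : Expr := .bin .eq a b

/-- The memory above the address in register `31` is divided into `16` interleaved arrays;
this is the entry of the array `k` with index `x`. -/
def State.A (σ : State) (k x : ℕ) : ℕ := σ.mem (σ.reg 31 + (16 * x + k))

/-- Write `v` to the entry of the array `k` with index `x`. -/
def State.setA (σ : State) (k x v : ℕ) : State := σ.setMem (σ.reg 31 + (16 * x + k)) v

/-- The address of an array entry. -/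
def Expr.addr (k : ℕ) (e : Expr) : Expr := .reg 31 + (.const 16 * e + .const k)

/-- The expression that reads an array entry. -/
def Expr.arr (k : ℕ) (e : Expr) : Expr := .load (.addr k e)

/-- The program that writes the value of `e` to the array `k` at the index `a`. -/
def Cmd.setArr (k : ℕ) (a e : Expr) : Cmd := .store (.addr k a) e

infixr:60 " ;; " => Cmd.seq
infix:62 " ::= " => Cmd.assign

namespace Expr
variable {w : ℕ} {σ : State} {a b : Expr}

@[simp] theorem val_const (k : ℕ) : (Expr.const k).val σ = k := rfl
@[simp] theorem val_reg (k : ℕ) : (Expr.reg k).val σ = σ.reg k := rfl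
@[simp] theorem val_load : (Expr.load a).val σ = σ.mem (a.val σ) := rfl
@[simp] theorem val_add : (a + b).val σ = a.val σ + b.val σ := rfl
@[simp] theorem val_sub : (a - b).val σ = a.val σ - b.val σ := rfl
@[simp] theorem val_mul : (a * b).val σ = a.val σ * b.val σ := rfl
@[simp] theorem val_div : (a / b).val σ = a.val σ / b.val σ := rfl
@[simp] theorem val_lt : (a.lt b).val σ = if a.val σ < b.val σ then 1 else 0 := rfl
@[simp] theorem val_eq : (a.eq b).val σ = if a.val σ = b.val σ then 1 else 0 := rfl
@[simp] theorem val_arr (k : ℕ) : (arr k a).val σ = σ.A k (a.val σ) := rfl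

@[simp] theorem cost_const (k : ℕ) : (Expr.const k).cost = 1 := rfl
@[simp] theorem cost_reg (k : ℕ) : (Expr.reg k).cost = 1 := rfl
@[simp] theorem cost_load : (Expr.load a).cost = a.cost + 1 := rfl
@[simp] theorem cost_add : (a + b).cost = a.cost + b.cost + 1 := rfl
@[simp] theorem cost_sub : (a - b).cost = a.cost + b.cost + 1 := rfl
@[simp] theorem cost_mul : (a * b).cost = a.cost + b.cost + 1 := rfl
@[simp] theorem cost_div : (a / b).cost = a.cost + b.cost + 1 := rfl
@[simp] theorem cost_lt : (a.lt b).cost = a.cost + b.cost + 1 := rfl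
@[simp] theorem cost_eq : (a.eq b).cost = a.cost + b.cost + 1 := rfl
@[simp] theorem cost_addr (k : ℕ) : (addr k a).cost = a.cost + 6 := by
  simp [addr]; omega
@[simp] theorem cost_arr (k : ℕ) : (arr k a).cost = a.cost + 7 := by simp [arr]

theorem fits_const' (k : ℕ) : (Expr.const k).Fits w σ ↔ k < 2 ^ w := Iff.rfl
@[simp] theorem fits_const [hw : Fact (16 < 2 ^ w)] (k : ℕ) (hk : k ≤ 16) :
    (Expr.const k).Fits w σ ↔ True := iff_true_intro (hk.trans_lt hw.out)
@[simp] theorem fits_reg (k : ℕ) : (Expr.reg k).Fits w σ ↔ True := Iff.rfl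
@[simp] theorem fits_load : (Expr.load a).Fits w σ ↔ a.Fits w σ := Iff.rfl
@[simp] theorem fits_add :
    (a + b).Fits w σ ↔ a.Fits w σ ∧ b.Fits w σ ∧ a.val σ + b.val σ < 2 ^ w := Iff.rfl
@[simp] theorem fits_mul :
    (a * b).Fits w σ ↔ a.Fits w σ ∧ b.Fits w σ ∧ a.val σ * b.val σ < 2 ^ w := Iff.rfl
@[simp] theorem fits_sub :
    (a - b).Fits w σ ↔ a.Fits w σ ∧ b.Fits w σ ∧ a.val σ - b.val σ < 2 ^ w := Iff.rfl
@[simp] theorem fits_div :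
    (a / b).Fits w σ ↔ a.Fits w σ ∧ b.Fits w σ ∧ a.val σ / b.val σ < 2 ^ w := Iff.rfl

@[simp] theorem fits_lt [hw : Fact (16 < 2 ^ w)] :
    (a.lt b).Fits w σ ↔ a.Fits w σ ∧ b.Fits w σ := by
  have := hw.out
  have h : (if a.val σ < b.val σ then 1 else 0) < 2 ^ w := by split_ifs <;> omega
  change (_ ∧ _ ∧ (if a.val σ < b.val σ then 1 else 0) < 2 ^ w) ↔ _
  tauto
@[simp] theorem fits_eq [hw : Fact (16 < 2 ^ w)] :
    (a.eq b).Fits w σ ↔ a.Fits w σ ∧ b.Fits w σ := by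
  have := hw.out
  have h : (if a.val σ = b.val σ then 1 else 0) < 2 ^ w := by split_ifs <;> omega
  change (_ ∧ _ ∧ (if a.val σ = b.val σ then 1 else 0) < 2 ^ w) ↔ _
  tauto

theorem fits_addr [hw : Fact (16 < 2 ^ w)] (k : ℕ) (hk : k < 16) :
    (addr k a).Fits w σ ↔ a.Fits w σ ∧ σ.reg 31 + (16 * a.val σ + k) < 2 ^ w := by
  have := hw.out
  simp only [addr, fits_add, fits_mul, fits_reg, fits_const', val_reg, val_add, val_mul, val_const]
  constructor
  · tauto
  · rintro ⟨h1, h2⟩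
    refine ⟨trivial, ⟨⟨hw.out, h1, ?_⟩, ?_, ?_⟩, h2⟩ <;> omega

@[simp] theorem fits_arr [hw : Fact (16 < 2 ^ w)] (k : ℕ) (hk : k < 16) :
    (arr k a).Fits w σ ↔ a.Fits w σ ∧ σ.reg 31 + (16 * a.val σ + k) < 2 ^ w :=
  fits_addr k hk
end Expr

namespace State
variable (σ : State)

@[simp] theorem reg_setReg_same (x v : ℕ) : (σ.setReg x v).reg x = v := by simp [setReg]
@[simp] theorem reg_setReg_ne {x y : ℕ} (v : ℕ) (h : y ≠ x) :
    (σ.setReg x v).reg y = σ.reg y := by simp [setReg, h]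
@[simp] theorem mem_setReg (x v : ℕ) : (σ.setReg x v).mem = σ.mem := rfl
@[simp] theorem reg_setA (k x v : ℕ) : (σ.setA k x v).reg = σ.reg := rfl
@[simp] theorem A_setReg {r : ℕ} (v k : ℕ) (h : 31 ≠ r) : (σ.setReg r v).A k = σ.A k := by
  funext x
  simp [A, h]
theorem A_setA_same (k x v y : ℕ) :
    (σ.setA k x v).A k y = if y = x then v else σ.A k y := by
  simp only [A, setA, setMem, Function.update_apply]
  congr 1
  simp
@[simp] theorem A_setA_eq (k x v : ℕ) : (σ.setA k x v).A k x = v := by simp [A_setA_same]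
@[simp] theorem A_setA_ne {k k' : ℕ} (x v : ℕ) (hne : k' ≠ k) (hk : k < 16) (hk' : k' < 16) :
    (σ.setA k x v).A k' = σ.A k' := by
  funext y
  simp only [A, setA, setMem, Function.update_apply]
  rw [if_neg (by omega)]
@[simp] theorem setReg_setReg (x v v' : ℕ) :
    (σ.setReg x v).setReg x v' = σ.setReg x v' := by
  simp [setReg]

theorem mem_setA {k x v y : ℕ} (hy : y < σ.reg 31) :
    (σ.setA k x v).mem y = σ.mem y := by
  simp only [setA, setMem]
  rw [Function.update_of_ne (by omega)]

end State

/-- The program `c`, started in the state `σ` when `T` steps were done before, halts in a state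
and after a total number of steps for which `Q` holds. -/
def Run (w : ℕ) (c : Cmd) (σ : State) (T : ℕ) (Q : State → ℕ → Prop) : Prop :=
  ∃ t σ', Exec w c σ t σ' ∧ Q σ' (T + t)

section Run
variable {w : ℕ} {σ : State} {T : ℕ} {Q : State → ℕ → Prop} {c c₁ c₂ : Cmd} {e a : Expr}

theorem Run.mono {Q' : State → ℕ → Prop} (h : Run w c σ T Q)
    (hQ : ∀ σ' T', Q σ' T' → Q' σ' T') : Run w c σ T Q' := by
  obtain ⟨t, σ', h1, h2⟩ := h
  exact ⟨t, σ', h1, hQ _ _ h2⟩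

@[simp] theorem run_skip : Run w .skip σ T Q ↔ Q σ (T + 1) := by
  constructor
  · rintro ⟨t, σ', h, hq⟩
    cases h; exact hq
  · intro h; exact ⟨_, _, .skip σ, h⟩

@[simp] theorem run_assign (x : ℕ) :
    Run w (.assign x e) σ T Q ↔ e.Fits w σ ∧ Q (σ.setReg x (e.val σ)) (T + (e.cost + 1)) := by
  constructor
  · rintro ⟨t, σ', h, hq⟩
    cases h with
    | assign he =>
      obtain ⟨h1, rfl⟩ := Expr.eval_eq_some_iff.1 he
      exact ⟨h1, hq⟩
  · rintro ⟨h1, h2⟩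
    exact ⟨_, _, .assign (Expr.eval_eq_some_iff.2 ⟨h1, rfl⟩), h2⟩

theorem run_store :
    Run w (.store a e) σ T Q ↔ a.Fits w σ ∧ e.Fits w σ ∧
      Q (σ.setMem (a.val σ) (e.val σ)) (T + (a.cost + e.cost + 1)) := by
  constructor
  · rintro ⟨t, σ', h, hq⟩
    cases h with
    | store ha he =>
      obtain ⟨h1, rfl⟩ := Expr.eval_eq_some_iff.1 ha
      obtain ⟨h2, rfl⟩ := Expr.eval_eq_some_iff.1 he
      exact ⟨h1, h2, hq⟩
  · rintro ⟨h1, h2, h3⟩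
    exact ⟨_, _, .store (Expr.eval_eq_some_iff.2 ⟨h1, rfl⟩) (Expr.eval_eq_some_iff.2 ⟨h2, rfl⟩), h3⟩

@[simp] theorem run_setArr [hw : Fact (16 < 2 ^ w)] (k : ℕ) (hk : k < 16) :
    Run w (.setArr k a e) σ T Q ↔ a.Fits w σ ∧ σ.reg 31 + (16 * a.val σ + k) < 2 ^ w ∧
      e.Fits w σ ∧ Q (σ.setA k (a.val σ) (e.val σ)) (T + (a.cost + e.cost + 7)) := by
  rw [Cmd.setArr, run_store, Expr.fits_addr k hk, Expr.cost_addr, and_assoc]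
  have : a.cost + 6 + e.cost + 1 = a.cost + e.cost + 7 := by omega
  rw [this]
  rfl

@[simp] theorem run_seq :
    Run w (c₁ ;; c₂) σ T Q ↔ Run w c₁ σ T fun σ' T' => Run w c₂ σ' T' Q := by
  constructor
  · rintro ⟨t, σ', h, hq⟩
    cases h with
    | seq h1 h2 => exact ⟨_, _, h1, _, _, h2, by rwa [Nat.add_assoc]⟩
  · rintro ⟨t, σ', h1, t', σ'', h2, h3⟩
    exact ⟨_, _, .seq h1 h2, by rwa [← Nat.add_assoc]⟩

@[simp] theorem run_ite :
    Run w (.ite e c₁ c₂) σ T Q ↔ e.Fits w σ ∧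
      (e.val σ ≠ 0 → Run w c₁ σ (T + (e.cost + 1)) Q) ∧
      (e.val σ = 0 → Run w c₂ σ (T + (e.cost + 1)) Q) := by
  constructor
  · rintro ⟨t, σ', h, hq⟩
    cases h with
    | ite_true he hv h =>
      obtain ⟨h1, rfl⟩ := Expr.eval_eq_some_iff.1 he
      exact ⟨h1, fun _ => ⟨_, _, h, by rwa [Nat.add_assoc]⟩, fun h => absurd h hv⟩
    | ite_false he h =>
      obtain ⟨h1, h2⟩ := Expr.eval_eq_some_iff.1 he
      exact ⟨h1, fun h => absurd h2 h, fun _ => ⟨_, _, h, by rwa [Nat.add_assoc]⟩⟩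
  · rintro ⟨h1, h2, h3⟩
    by_cases hv : e.val σ = 0
    · obtain ⟨t, σ', h, hq⟩ := h3 hv
      exact ⟨_, _, .ite_false (Expr.eval_eq_some_iff.2 ⟨h1, hv⟩) h, by rwa [← Nat.add_assoc]⟩
    · obtain ⟨t, σ', h, hq⟩ := h2 hv
      exact ⟨_, _, .ite_true (Expr.eval_eq_some_iff.2 ⟨h1, rfl⟩) hv h, by rwa [← Nat.add_assoc]⟩

/-- The rule for loops. The invariant `I` speaks about the state and the total time. Since every
iteration takes time, a bound for the time in the invariant also shows termination. -/
theorem run_while (I : State → ℕ → Prop) (Tmax : ℕ) (hle : ∀ σ T, I σ T → T ≤ Tmax)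
    (hfit : ∀ σ T, I σ T → e.Fits w σ)
    (hbody : ∀ σ T, I σ T → e.val σ ≠ 0 → Run w c σ (T + (e.cost + 1)) I)
    (hpost : ∀ σ T, I σ T → e.val σ = 0 → Q σ (T + (e.cost + 1))) (hI : I σ T) :
    Run w (.while e c) σ T Q := by
  induction hk : Tmax - T using Nat.strong_induction_on generalizing σ T with
  | _ k ih =>
    by_cases hv : e.val σ = 0
    · exact ⟨_, _, .while_false (Expr.eval_eq_some_iff.2 ⟨hfit _ _ hI, hv⟩), hpost _ _ hI hv⟩
    · obtain ⟨t, σ', h1, h2⟩ := hbody _ _ hI hv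
      have h3 := hle _ _ h2
      obtain ⟨t', σ'', h4, h5⟩ := ih _ (by omega) h2 rfl
      refine ⟨_, _, .while_true (Expr.eval_eq_some_iff.2 ⟨hfit _ _ hI, rfl⟩) hv h1 h4, ?_⟩
      convert h5 using 1
      omega

end Run

end WordRAM

namespace DecrementalAPSP
open WordRAM Finset

/-! ### Monotone distance labels -/

/-- Adjacency lists for the graph `Γ` on the vertices below `n`. The lists are fixed in advance, so
they may also contain former neighbours. -/
structure Net (n : ℕ) (deg : ℕ → ℕ) (adj : ℕ → ℕ → ℕ) (Γ : SimpleGraph ℕ) : Prop where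
  deg_le : ∀ x < n, deg x ≤ n
  adj_lt : ∀ x < n, ∀ k < deg x, adj x k < n
  mem_adj : ∀ x y, Γ.Adj x y → x < n ∧ ∃ k < deg x, adj x k = y

/-- The invariant of a tree of depth `cap` with root `r`. The label `lab x` is an offset, the label
of the root, plus the distance from the root to `x`, as far as it is at most `cap`; all larger
labels are replaced by `cap + 1`. The pointer `ptr x` moves through the adjacency list of `x` in
search of a neighbour with a smaller label. Vertices for which `st` holds wait for a check that
such a neighbour still exists. A tree without a root is encoded by `r = n`. -/
structure TreeInv (n : ℕ) (deg : ℕ → ℕ) (adj : ℕ → ℕ → ℕ) (Γ : SimpleGraph ℕ) (cap r : ℕ)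
    (lab ptr : ℕ → ℕ) (st : ℕ → Prop) : Prop where
  lip : ∀ x y, Γ.Adj x y → lab x ≤ lab y + 1
  scanned : ∀ x < n, ∀ k < ptr x, Γ.Adj x (adj x k) → lab x ≤ lab (adj x k)
  ptr_le : ∀ x < n, ptr x ≤ deg x
  lab_le : ∀ x < n, lab x ≤ cap + 1
  settled : ∀ x < n, x ≠ r → lab x ≤ cap → ¬ st x →
    ptr x < deg x ∧ Γ.Adj x (adj x (ptr x)) ∧ lab (adj x (ptr x)) < lab x

namespace TreeInv
variable {n : ℕ} {deg : ℕ → ℕ} {adj : ℕ → ℕ → ℕ} {Γ Γ' : SimpleGraph ℕ} {cap r r' : ℕ}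
  {lab ptr : ℕ → ℕ} {st st' : ℕ → Prop}

/-- A vertex leaves the set of the waiting vertices after a successful check. -/
theorem weaken (h : TreeInv n deg adj Γ cap r lab ptr st) (hst : ∀ x, st x → ¬ st' x →
      x ≠ r → lab x ≤ cap → ptr x < deg x ∧ Γ.Adj x (adj x (ptr x)) ∧
        lab (adj x (ptr x)) < lab x) :
    TreeInv n deg adj Γ cap r lab ptr st' where
  lip := h.lip
  scanned := h.scanned
  ptr_le := h.ptr_le
  lab_le := h.lab_le
  settled x hx hr hl hs := by
    by_cases h1 : st x
    · exact hst x h1 hs hr hl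
    · exact h.settled x hx hr hl h1

theorem congr {lab' ptr' : ℕ → ℕ} (hnet : Net n deg adj Γ)
    (h : TreeInv n deg adj Γ cap r lab ptr st)
    (hl : ∀ x < n, lab' x = lab x) (hp : ∀ x < n, ptr' x = ptr x) :
    TreeInv n deg adj Γ cap r lab' ptr' st where
  lip x y hxy := by
    rw [hl _ (hnet.mem_adj _ _ hxy).1, hl _ (hnet.mem_adj _ _ hxy.symm).1]; exact h.lip x y hxy
  scanned x hx k hk hxy := by
    rw [hl _ hx, hl _ (hnet.mem_adj _ _ hxy.symm).1]; exact h.scanned x hx k (hp x hx ▸ hk) hxy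
  ptr_le x hx := by rw [hp x hx]; exact h.ptr_le x hx
  lab_le x hx := by rw [hl x hx]; exact h.lab_le x hx
  settled x hx hr hc hs := by
    rw [hl x hx] at hc
    obtain ⟨h1, h2, h3⟩ := h.settled x hx hr hc hs
    rw [hp x hx, hl x hx, hl _ (hnet.mem_adj _ _ h2.symm).1]
    exact ⟨h1, h2, h3⟩

/-- The pointer skips an entry that is not a neighbour with a smaller label. -/
theorem advance (h : TreeInv n deg adj Γ cap r lab ptr st) {x : ℕ} (hx : x < n)
    (hk : ptr x < deg x) (hno : ¬ (Γ.Adj x (adj x (ptr x)) ∧ lab (adj x (ptr x)) < lab x))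
    (hst : ∀ y, st y → st' y) (hs : st' x) :
    TreeInv n deg adj Γ cap r lab (Function.update ptr x (ptr x + 1)) st' where
  lip := h.lip
  scanned y hy k hky hyk := by
    by_cases hyx : y = x
    · subst hyx
      rw [Function.update_self] at hky
      rcases Nat.lt_succ_iff_lt_or_eq.1 hky with h1 | rfl
      · exact h.scanned y hy k h1 hyk
      · by_contra! h2
        exact hno ⟨hyk, h2⟩
    · rw [Function.update_of_ne hyx] at hky
      exact h.scanned y hy k hky hyk
  ptr_le y hy := by
    by_cases hyx : y = x
    · subst hyx; rw [Function.update_self]; omega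
    · rw [Function.update_of_ne hyx]; exact h.ptr_le y hy
  lab_le := h.lab_le
  settled y hy hr hl hsy := by
    have hyx : y ≠ x := by rintro rfl; exact hsy hs
    rw [Function.update_of_ne hyx]
    exact h.settled y hy hr hl fun h1 => hsy (hst y h1)

/-- When the whole adjacency list was searched in vain, the label increases. -/
theorem raise (hnet : Net n deg adj Γ) (h : TreeInv n deg adj Γ cap r lab ptr st) {x : ℕ}
    (hl : lab x ≤ cap) (hk : deg x ≤ ptr x)
    (hst : ∀ y, st y → st' y) (hs : st' x) (hadj : ∀ k < deg x, st' (adj x k)) :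
    TreeInv n deg adj Γ cap r (Function.update lab x (lab x + 1)) (Function.update ptr x 0) st' where
  lip y z hyz := by
    have h0 := h.lip y z hyz
    have hne := hyz.ne
    by_cases hyx : y = x
    · subst hyx
      rw [Function.update_self, Function.update_of_ne hne.symm]
      obtain ⟨hy, k, h1, rfl⟩ := hnet.mem_adj y z hyz
      have := h.scanned y hy k (by omega) hyz
      omega
    · rw [Function.update_of_ne hyx]
      by_cases hzx : z = x
      · subst hzx; rw [Function.update_self]; omega
      · rwa [Function.update_of_ne hzx]
  scanned y hy k hky hyk := by
    by_cases hyx : y = x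
    · subst hyx; rw [Function.update_self] at hky; omega
    · rw [Function.update_of_ne hyx] at hky ⊢
      have := h.scanned y hy k hky hyk
      by_cases hzx : adj y k = x
      · rw [hzx, Function.update_self]; rw [hzx] at this; omega
      · rwa [Function.update_of_ne hzx]
  ptr_le y hy := by
    by_cases hyx : y = x
    · subst hyx; rw [Function.update_self]; omega
    · rw [Function.update_of_ne hyx]; exact h.ptr_le y hy
  lab_le y hy := by
    by_cases hyx : y = x
    · subst hyx; rw [Function.update_self]; omega
    · rw [Function.update_of_ne hyx]; exact h.lab_le y hy
  settled y hy hr hly hsy := by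
    have hyx : y ≠ x := by rintro rfl; exact hsy hs
    rw [Function.update_of_ne hyx] at hly ⊢
    rw [Function.update_of_ne hyx]
    obtain ⟨h1, h2, h3⟩ := h.settled y hy hr hly fun h1 => hsy (hst y h1)
    have hne : adj y (ptr y) ≠ x := by
      intro h4
      rw [h4] at h2
      obtain ⟨_, k, hk1, hk2⟩ := hnet.mem_adj x y h2.symm
      exact hsy (hk2 ▸ hadj k hk1)
    rw [Function.update_of_ne hne]
    exact ⟨h1, h2, h3⟩

/-- After the deletion of the edge `uv` and a change of the root, it is enough to check `u`, `v`
and the old root. -/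
theorem delete {u v : ℕ} (h : TreeInv n deg adj Γ cap r lab ptr fun _ => False)
    (hst : ∀ x, x = u ∨ x = v → st x) (hr : r ≠ r' → st r) :
    TreeInv n deg adj (Γ.deleteEdges {s(u, v)}) cap r' lab ptr st where
  lip x y hxy := h.lip x y (SimpleGraph.deleteEdges_le _ hxy)
  scanned x hx k hk hxy := h.scanned x hx k hk (SimpleGraph.deleteEdges_le _ hxy)
  ptr_le := h.ptr_le
  lab_le := h.lab_le
  settled x hx hxr hl hs := by
    have hxr' : x ≠ r := by
      rintro rfl; exact hs (hr hxr)
    obtain ⟨h1, h2, h3⟩ := h.settled x hx hxr' hl not_false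
    refine ⟨h1, ?_, h3⟩
    rw [SimpleGraph.deleteEdges_adj]
    refine ⟨h2, ?_⟩
    simp only [Set.mem_singleton_iff, Sym2.eq_iff]
    rintro (⟨h4, -⟩ | ⟨h4, -⟩)
    · exact hs (hst x (.inl h4))
    · exact hs (hst x (.inr h4))

/-- A vertex with a small label is connected to the root. -/
theorem reachable (hnet : Net n deg adj Γ) (h : TreeInv n deg adj Γ cap r lab ptr fun _ => False)
    {x : ℕ} (hx : x < n) (hl : lab x ≤ cap) : r < n ∧ lab r ≤ lab x ∧ Γ.Reachable r x := by
  induction hk : lab x using Nat.strong_induction_on generalizing x with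
  | _ k ih =>
    subst hk
    by_cases hxr : x = r
    · subst hxr; exact ⟨hx, le_rfl, .refl _⟩
    · obtain ⟨h1, h2, h3⟩ := h.settled x hx hxr hl not_false
      obtain ⟨h4, h5, h6⟩ := ih _ h3 (hnet.adj_lt x hx _ h1) (by omega) rfl
      exact ⟨h4, by omega, h6.trans h2.symm.reachable⟩

end TreeInv

/-- A bound for the number of future insertions into the stack: whenever the label of `x` increases,
`x` and its neighbours are inserted. -/
def labelPot (n : ℕ) (deg : ℕ → ℕ) (cap : ℕ) (lab : ℕ → ℕ) : ℕ :=
  ∑ x ∈ range n, (cap + 1 - lab x) * (deg x + 1)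

/-- The number of entries that the scan pointers have not passed yet. -/
def ptrPot (n : ℕ) (deg ptr : ℕ → ℕ) : ℕ := ∑ x ∈ range n, (deg x - ptr x)

/-- The potential that pays for the future work on a tree. An increase of the label of `x` releases
`600 * (deg x + 1)`, of which at most `250 * deg x` are used up because the scan pointer of `x` is
reset, and the rest pays for the insertions and removals of stack entries. -/
def treePot (n : ℕ) (deg : ℕ → ℕ) (cap : ℕ) (lab ptr : ℕ → ℕ) : ℕ :=
  600 * labelPot n deg cap lab + 250 * ptrPot n deg ptr

section Potential
variable {n : ℕ} {deg : ℕ → ℕ} {cap : ℕ} {lab ptr : ℕ → ℕ} {x : ℕ}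

theorem labelPot_congr {lab' : ℕ → ℕ} (h : ∀ x < n, lab' x = lab x) :
    labelPot n deg cap lab' = labelPot n deg cap lab :=
  sum_congr rfl fun x hx => by rw [h x (mem_range.1 hx)]

theorem ptrPot_congr {ptr' : ℕ → ℕ} (h : ∀ x < n, ptr' x = ptr x) :
    ptrPot n deg ptr' = ptrPot n deg ptr :=
  sum_congr rfl fun x hx => by rw [h x (mem_range.1 hx)]

theorem treePot_congr {lab' ptr' : ℕ → ℕ} (h : ∀ x < n, lab' x = lab x)
    (h' : ∀ x < n, ptr' x = ptr x) :
    treePot n deg cap lab' ptr' = treePot n deg cap lab ptr := by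
  rw [treePot, treePot, labelPot_congr h, ptrPot_congr h']

theorem sum_update_add {f : ℕ → ℕ → ℕ} {g : ℕ → ℕ} {v : ℕ} (hx : x < n) :
    ∑ y ∈ range n, f y (Function.update g x v y) + f x (g x) =
      ∑ y ∈ range n, f y (g y) + f x v := by
  rw [← add_sum_erase _ _ (mem_range.2 hx), ← add_sum_erase _ (fun y => f y (g y)) (mem_range.2 hx)]
  have : ∑ y ∈ (range n).erase x, f y (Function.update g x v y) =
      ∑ y ∈ (range n).erase x, f y (g y) :=
    sum_congr rfl fun y hy => by rw [Function.update_of_ne (ne_of_mem_erase hy)]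
  rw [this, Function.update_self]
  omega

theorem labelPot_raise (hx : x < n) (hl : lab x ≤ cap) :
    labelPot n deg cap (Function.update lab x (lab x + 1)) + (deg x + 1) =
      labelPot n deg cap lab := by
  have h := sum_update_add (f := fun y l => (cap + 1 - l) * (deg y + 1)) (g := lab)
    (v := lab x + 1) hx
  have h2 : (cap + 1 - lab x) * (deg x + 1) =
      (cap + 1 - (lab x + 1)) * (deg x + 1) + (deg x + 1) := by
    obtain ⟨d, rfl⟩ := Nat.exists_eq_add_of_le hl
    rw [show lab x + d + 1 - lab x = d + 1 by omega,
      show lab x + d + 1 - (lab x + 1) = d by omega]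
    ring
  simp only [labelPot]
  omega

theorem ptrPot_reset (hx : x < n) :
    ptrPot n deg (Function.update ptr x 0) ≤ ptrPot n deg ptr + deg x := by
  have h := sum_update_add (f := fun y l => deg y - l) (g := ptr) (v := 0) hx
  simp only [ptrPot]
  omega

theorem ptrPot_advance (hx : x < n) (hk : ptr x < deg x) :
    ptrPot n deg (Function.update ptr x (ptr x + 1)) + 1 = ptrPot n deg ptr := by
  have h := sum_update_add (f := fun y l => deg y - l) (g := ptr) (v := ptr x + 1) hx
  simp only [ptrPot]
  omega

/-- The number of vertices with a label of at most `cap`. -/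
def inCount (n cap : ℕ) (lab : ℕ → ℕ) : ℕ := #{x ∈ range n | lab x ≤ cap}

theorem inCount_congr {lab' : ℕ → ℕ} (h : ∀ x < n, lab' x = lab x) :
    inCount n cap lab' = inCount n cap lab := by
  rw [inCount, inCount]
  congr 1
  exact filter_congr fun x hx => by rw [h x (mem_range.1 hx)]

theorem inCount_raise (hx : x < n) (hl : lab x ≤ cap) :
    inCount n cap (Function.update lab x (lab x + 1)) =
      if cap < lab x + 1 then inCount n cap lab - 1 else inCount n cap lab := by
  split_ifs with h
  · have : (range n).filter (fun y => Function.update lab x (lab x + 1) y ≤ cap) =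
        ((range n).filter (fun y => lab y ≤ cap)).erase x := by
      ext y
      by_cases hyx : y = x
      · subst hyx; simp; omega
      · simp [hyx]
    rw [inCount, this, card_erase_of_mem (by simp [hx, hl]), inCount]
  · rw [inCount, inCount]
    congr 1
    refine filter_congr fun y _ => ?_
    by_cases hyx : y = x
    · subst hyx; simp; omega
    · simp [hyx]

end Potential

end DecrementalAPSP

namespace DecrementalAPSP
open WordRAM Finset

/-! ### The layout of registers and memory -/

/-! The registers up to `14` hold arguments, results and intermediate values. The number of vertices
and the number of scales stay in `rN` and `rNum`. During an update, `rU` and `rV` hold the ends of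
the deleted edge, `rI` the scale, `rH`, `rCap` and `rHn` its radius, its depth and the radius of the
next scale, and `rTb` and `rCb` the first index of its data about trees and about vertices. The tree
that is currently updated has the index `rTau`, its labels begin at the index `rT`, its root is in
`rRoot`, and `rSp` is the number of entries on the stack of the vertices that wait for a check. -/

notation "rJ" => 5
notation "rT" => 6
notation "rRoot" => 7
notation "rSp" => 8
notation "rX" => 9
notation "rK" => 10
notation "rY" => 11
notation "rTau" => 12
notation "rZ" => 13
notation "rC" => 14
notation "rN" => 20
notation "rNum" => 22
notation "rU" => 23
notation "rV" => 24
notation "rI" => 25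
notation "rH" => 26
notation "rCap" => 27
notation "rTb" => 28
notation "rCb" => 29
notation "rHn" => 30

/-! The arrays `aAdj`, `aDeg` and `aAlive` hold the initial adjacency lists, their lengths, and the
current adjacency matrix. For every tree, `aRoot` and `aCnt` hold the root and the number of vertices
that the tree contains, and `aLab` and `aPtr` the labels and the scan pointers. For every vertex at
every scale, `aCov` holds the number of the covering centre, and for every scale, `aNum`, `aH` and
`aCap` hold the number of centres, the radius and the depth. The flags in `aBig` tell which vertices
lie in a component larger than the radius of the scale at work. -/

notation "aAdj" => 0
notation "aDeg" => 1
notation "aAlive" => 2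
notation "aLab" => 3
notation "aPtr" => 4
notation "aRoot" => 5
notation "aCnt" => 6
notation "aCov" => 7
notation "aNum" => 8
notation "aH" => 9
notation "aCap" => 10
notation "aStack" => 11
notation "aBig" => 12

open Expr Cmd

/-! ### Repairing a tree on the machine -/

/-- Push all entries of the adjacency list of the vertex `rX` on the stack. -/
def pushNbrs : Cmd :=
  rK ::= const 0 ;;
  .while (lt (reg rK) (arr aDeg (reg rX))) (
    setArr aStack (reg rSp) (arr aAdj (reg rX * reg rN + reg rK)) ;;
    rSp ::= reg rSp + const 1 ;;
    rK ::= reg rK + const 1)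

/-- Increase the label of the vertex `rX`. The vertex leaves the tree if the label exceeds the depth.
The vertex, which is still in the stack entry above the top, and its neighbours have to be checked. -/
def raiseLabel : Cmd :=
  setArr aLab (reg rT + reg rX) (arr aLab (reg rT + reg rX) + const 1) ;;
  setArr aPtr (reg rT + reg rX) (const 0) ;;
  setArr aCnt (reg rTau)
    (arr aCnt (reg rTau) - lt (reg rCap) (arr aLab (reg rT + reg rX))) ;;
  rSp ::= reg rSp + const 1 ;;
  pushNbrs

/-- Check the vertex on top of the stack. It is removed if it is the root, if it is not in the tree,
or if its scan pointer points to a neighbour with a smaller label. Otherwise the pointer advances or,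
at the end of the list, the label increases. An edge is alive if its entry in the adjacency matrix is
not `0`; the product of the two tests is their conjunction. -/
def checkTop : Cmd :=
  rSp ::= reg rSp - const 1 ;;
  rX ::= arr aStack (reg rSp) ;;
  .ite (eq (reg rX) (reg rRoot)) .skip (
  .ite (lt (reg rCap) (arr aLab (reg rT + reg rX))) .skip (
    rK ::= arr aPtr (reg rT + reg rX) ;;
    .ite (lt (reg rK) (arr aDeg (reg rX)))
      (rY ::= arr aAdj (reg rX * reg rN + reg rK) ;;
       .ite (arr aAlive (reg rX * reg rN + reg rY) *
            lt (arr aLab (reg rT + reg rY)) (arr aLab (reg rT + reg rX))) .skip (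
         setArr aPtr (reg rT + reg rX) (reg rK + const 1) ;;
         rSp ::= reg rSp + const 1))
      raiseLabel))

/-- Check vertices until none is left on the stack. The order of the checks does not matter. -/
def repair : Cmd := .while (reg rSp) checkTop

theorem mul_add_lt {n x k : ℕ} (hx : x < n) (hk : k < n) : x * n + k < n * n := by
  nlinarith

theorem run_pushNbrs {w : ℕ} [hw : Fact (16 < 2 ^ w)] {n X : ℕ} {σ : State} {T : ℕ}
    (hX : σ.reg 31 + 16 * X + 16 ≤ 2 ^ w) (hnn : n * n ≤ X)
    (hN : σ.reg rN = n) (hx : σ.reg rX < n) (hdeg : σ.A aDeg (σ.reg rX) ≤ n)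
    (hadj : ∀ k < σ.A aDeg (σ.reg rX), σ.A aAdj (σ.reg rX * n + k) < n)
    (hsp : σ.reg rSp + σ.A aDeg (σ.reg rX) ≤ X) :
    Run w pushNbrs σ T fun σ' T' =>
      (∀ r, r ≠ rSp → r ≠ rK → σ'.reg r = σ.reg r) ∧
      (∀ k < 16, k ≠ aStack → σ'.A k = σ.A k) ∧
      σ'.reg rSp = σ.reg rSp + σ.A aDeg (σ.reg rX) ∧
      (∀ s < σ.reg rSp, σ'.A aStack s = σ.A aStack s) ∧
      (∀ k < σ.A aDeg (σ.reg rX),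
        σ'.A aStack (σ.reg rSp + k) = σ.A aAdj (σ.reg rX * n + k)) ∧
      T' ≤ T + 50 * (σ.A aDeg (σ.reg rX) + 1) := by
  have h16 := hw.out
  have hnX : n ≤ X := (Nat.le_mul_self n).trans hnn
  simp only [pushNbrs, run_seq, run_assign, fits_const, val_const, cost_const, Nat.zero_le, true_and]
  generalize hd : σ.A aDeg (σ.reg rX) = d at *
  refine run_while (fun σ' T' =>
      (∀ r, r ≠ rSp → r ≠ rK → σ'.reg r = σ.reg r) ∧
      (∀ k < 16, k ≠ aStack → σ'.A k = σ.A k) ∧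
      σ'.reg rK ≤ d ∧
      σ'.reg rSp = σ.reg rSp + σ'.reg rK ∧
      (∀ s < σ.reg rSp, σ'.A aStack s = σ.A aStack s) ∧
      (∀ k < σ'.reg rK,
        σ'.A aStack (σ.reg rSp + k) = σ.A aAdj (σ.reg rX * n + k)) ∧
      T' + 40 * (d - σ'.reg rK) ≤ T + 10 + 40 * d)
    (T + 10 + 40 * d) (fun σ' T' h => by omega) ?_ ?_ ?_ ?_
  · rintro σ' T' ⟨h1, h2, -⟩
    simp [h1, h2]
    omega
  · rintro σ' T' ⟨h1, h2, h3, h4, h5, h6, h7⟩ hc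
    have e1 := h1 rN (by decide) (by decide)
    have e2 := h1 rX (by decide) (by decide)
    have e3 := h1 31 (by decide) (by decide)
    have a0 := h2 aAdj (by decide) (by decide)
    have a1 := h2 aDeg (by decide) (by decide)
    simp [e2, a1, hd] at hc
    have b1 := mul_add_lt hx (hc.trans_le hdeg)
    have b2 := hadj _ hc
    simp [pushNbrs, e1, e2, e3, a0, a1, hN, hd, and_assoc]
    repeat refine And.intro (by omega) ?_
    refine ⟨?_, ?_, by omega, by omega, ?_, ?_, by omega⟩
    · intro r hr1 hr2
      simp [hr1, hr2, h1]
    · intro k hk hk2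
      funext x
      simp [hk, hk2, h2]
    · intro s hs
      rw [State.A_setA_same, if_neg (by omega), h5 s hs]
    · intro k hk
      rw [State.A_setA_same]
      split_ifs with h8
      · congr; omega
      · exact h6 k (by omega)
  · rintro σ' T' ⟨h1, h2, h3, h4, h5, h6, h7⟩ hc
    have e2 := h1 rX (by decide) (by decide)
    have a1 := h2 aDeg (by decide) (by decide)
    simp [e2, a1, hd] at hc
    have h8 : σ'.reg rK = d := by omega
    rw [h8] at h4 h6
    refine ⟨h1, h2, h4, h5, h6, ?_⟩
    simp
    omega
  · refine ⟨?_, ?_, by simp, by simp, by simp, by simp, by simp⟩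
    · intro r hr1 hr2; simp [hr2]
    · intro k hk hk2; funext x; simp

/-- The adjacency matrix of `Γ` is stored in the memory. -/
def AliveRep (n : ℕ) (Γ : SimpleGraph ℕ) (σ : State) : Prop :=
  ∀ x < n, ∀ y < n, (Γ.Adj x y ∧ σ.A aAlive (x * n + y) = 1) ∨
    (¬ Γ.Adj x y ∧ σ.A aAlive (x * n + y) = 0)

/-- The state `σ` arose from `σ₀` by work on the tree with the number `τ`, whose labels are stored
from the index `T` on. -/
structure Repairing (n T cap r τ : ℕ) (Γ : SimpleGraph ℕ) (σ₀ σ : State) : Prop where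
  regs : ∀ q, q ≠ rSp → q ≠ rX → q ≠ rK → q ≠ rY → σ.reg q = σ₀.reg q
  arrs : ∀ k < 16, k ≠ aLab → k ≠ aPtr → k ≠ aCnt → k ≠ aStack → σ.A k = σ₀.A k
  block : ∀ z, z < T ∨ T + n ≤ z → σ.A aLab z = σ₀.A aLab z ∧ σ.A aPtr z = σ₀.A aPtr z
  cnt_ne : ∀ z, z ≠ τ → σ.A aCnt z = σ₀.A aCnt z
  inv : TreeInv n (σ₀.A aDeg) (fun x k => σ₀.A aAdj (x * n + k)) Γ cap r
    (fun x => σ.A aLab (T + x)) (fun x => σ.A aPtr (T + x))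
    (fun x => ∃ s < σ.reg rSp, σ.A aStack s = x)
  stack_lt : ∀ s < σ.reg rSp, σ.A aStack s < n
  cnt : σ.A aCnt τ = inCount n cap fun x => σ.A aLab (T + x)
  mono : ∀ x < n, σ₀.A aLab (T + x) ≤ σ.A aLab (T + x)
  root : r < n → σ.A aLab (T + r) = σ₀.A aLab (T + r)

/-- A write into the block of a tree, seen as the update of a function of the vertex. -/
theorem setA_block (σ : State) (k T x v : ℕ) :
    (fun y => (σ.setA k (T + x) v).A k (T + y)) =
      Function.update (fun y => σ.A k (T + y)) x v := by
  funext y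
  simp [State.A_setA_same, Function.update_apply]

/-- One check preserves the invariant `Repairing`, the sum of the time and the potential, where an entry
of the stack is worth `150` steps, and the bound for the stack. -/
theorem run_checkTop {w : ℕ} [hw : Fact (16 < 2 ^ w)] {n X T cap r τ B : ℕ} {Γ : SimpleGraph ℕ}
    {σ₀ σ : State} {Tm : ℕ}
    (hX : σ₀.reg 31 + 16 * X + 16 ≤ 2 ^ w) (hnn : n * n ≤ X) (hTX : T + n ≤ X) (hτ : τ < X)
    (hcap : cap + 1 ≤ X)
    (hN : σ₀.reg rN = n) (hT : σ₀.reg rT = T) (hC : σ₀.reg rCap = cap) (hr : σ₀.reg rRoot = r)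
    (hTau : σ₀.reg rTau = τ) (halive : AliveRep n Γ σ₀)
    (hnet : Net n (σ₀.A aDeg) (fun x k => σ₀.A aAdj (x * n + k)) Γ)
    (hσ : Repairing n T cap r τ Γ σ₀ σ)
    (hsp : σ.reg rSp + labelPot n (σ₀.A aDeg) cap (fun x => σ.A aLab (T + x)) ≤ X)
    (htime : Tm + 150 * σ.reg rSp + treePot n (σ₀.A aDeg) cap (fun x => σ.A aLab (T + x))
      (fun x => σ.A aPtr (T + x)) ≤ B)
    (hne : σ.reg rSp ≠ 0) :
    Run w checkTop σ (Tm + 2) fun σ' Tm' => Repairing n T cap r τ Γ σ₀ σ' ∧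
      σ'.reg rSp + labelPot n (σ₀.A aDeg) cap (fun x => σ'.A aLab (T + x)) ≤ X ∧
      Tm' + 150 * σ'.reg rSp + treePot n (σ₀.A aDeg) cap (fun x => σ'.A aLab (T + x))
        (fun x => σ'.A aPtr (T + x)) ≤ B := by
  have h16 := hw.out
  have hnX : n ≤ X := (Nat.le_mul_self n).trans hnn
  have e1 := hσ.regs rN (by decide) (by decide) (by decide) (by decide)
  have e2 := hσ.regs rT (by decide) (by decide) (by decide) (by decide)
  have e3 := hσ.regs rCap (by decide) (by decide) (by decide) (by decide)
  have e4 := hσ.regs rRoot (by decide) (by decide) (by decide) (by decide)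
  have e5 := hσ.regs rTau (by decide) (by decide) (by decide) (by decide)
  have e6 := hσ.regs 31 (by decide) (by decide) (by decide) (by decide)
  have a0 := hσ.arrs aAdj (by decide) (by decide) (by decide) (by decide) (by decide)
  have a1 := hσ.arrs aDeg (by decide) (by decide) (by decide) (by decide) (by decide)
  have a2 := hσ.arrs aAlive (by decide) (by decide) (by decide) (by decide) (by decide)
  rw [hN] at e1
  rw [hT] at e2
  rw [hC] at e3
  rw [hr] at e4
  rw [hTau] at e5
  obtain ⟨S, hS⟩ : ∃ S, σ.reg rSp = S + 1 := ⟨σ.reg rSp - 1, by omega⟩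
  have hxn := hσ.stack_lt S (by omega)
  obtain ⟨x, hx⟩ : ∃ x, σ.A aStack S = x := ⟨_, rfl⟩
  rw [hx] at hxn
  have hlabx := hσ.inv.lab_le x hxn
  have hptrx := hσ.inv.ptr_le x hxn
  have hdegx := hnet.deg_le x hxn
  -- the popped vertex need not be checked again
  have hpop : (x ≠ r → σ.A aLab (T + x) ≤ cap →
      σ.A aPtr (T + x) < σ₀.A aDeg x ∧ Γ.Adj x (σ₀.A aAdj (x * n + σ.A aPtr (T + x))) ∧
      σ.A aLab (T + σ₀.A aAdj (x * n + σ.A aPtr (T + x))) < σ.A aLab (T + x)) →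
      ∀ σ' : State, σ'.A = σ.A → σ'.reg rSp = S →
      (∀ q, q ≠ rSp → q ≠ rX → q ≠ rK → q ≠ rY → σ'.reg q = σ.reg q) →
      Repairing n T cap r τ Γ σ₀ σ' := by
    intro h σ' hA hSp hreg
    refine ⟨fun q h1 h2 h3 h4 => (hreg q h1 h2 h3 h4).trans (hσ.regs q h1 h2 h3 h4),
      hA ▸ hσ.arrs, hA ▸ hσ.block, hA ▸ hσ.cnt_ne, ?_, ?_, hA ▸ hσ.cnt, hA ▸ hσ.mono, hA ▸ hσ.root⟩
    · rw [hA]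
      refine hσ.inv.weaken ?_
      rintro y ⟨s, hs, rfl⟩ hns
      have : s = S := by
        by_contra h1
        exact hns ⟨s, by omega, rfl⟩
      subst this
      rw [hx]
      exact h
    · intro s hs
      rw [hA]
      exact hσ.stack_lt s (by omega)
  have hAreg : ∀ (σ₁ : State) (q v : ℕ), 31 ≠ q → (σ₁.setReg q v).A = σ₁.A := by
    intro σ₁ q v hq; funext k; exact State.A_setReg _ _ _ hq
  -- the root needs no neighbour with a smaller label
  by_cases c1 : x = r
  · have := hpop (fun h => absurd c1 h)
    simp [checkTop, hS, hx, e1, e2, e3, e4, e6, c1, and_assoc]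
    repeat refine And.intro (by omega) ?_
    refine ⟨this _ (by simp [hAreg]) (by simp) ?_, by omega, by omega⟩
    intro q h1 h2 h3 h4; simp [h1, h2]
  -- a vertex outside the tree needs none either
  by_cases c2 : cap < σ.A aLab (T + x)
  · have := hpop (fun _ h => absurd c2 (by omega))
    simp [checkTop, hS, hx, e1, e2, e3, e4, e6, c1, c2, and_assoc]
    repeat refine And.intro (by omega) ?_
    refine ⟨this _ (by simp [hAreg]) (by simp) ?_, by omega, by omega⟩
    intro q h1 h2 h3 h4; simp [h1, h2]
  have c2' := Nat.le_of_not_lt c2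
  have hw0 : w ≠ 0 := by rintro rfl; simp at h16
  -- otherwise the entry under the scan pointer is tested, or the list is exhausted
  by_cases c3 : σ.A aPtr (T + x) < σ₀.A aDeg x
  · have b1 := mul_add_lt hxn (c3.trans_le hdegx)
    obtain ⟨y, hy⟩ : ∃ y, σ₀.A aAdj (x * n + σ.A aPtr (T + x)) = y := ⟨_, rfl⟩
    have hyn := hnet.adj_lt x hxn _ c3
    simp only [hy] at hyn
    have b2 := mul_add_lt hxn hyn
    have hal := halive x hxn y hyn
    by_cases c4 : Γ.Adj x y ∧ σ.A aLab (T + y) < σ.A aLab (T + x)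
    · have h5 : σ₀.A aAlive (x * n + y) = 1 := by tauto
      have := hpop (fun _ _ => by rw [hy]; exact ⟨c3, c4⟩)
      simp [checkTop, hS, hx, e1, e2, e3, e4, e6, a0, a1, a2, c1, c2', c3, hy, h5, c4.2, hw0, and_assoc]
      repeat refine And.intro (by omega) ?_
      refine ⟨this _ (by simp [hAreg]) (by simp) ?_, by omega, by omega⟩
      intro q h1 h2 h3 h4; simp [h1, h2, h3, h4]
    · have h5 : σ₀.A aAlive (x * n + y) = 0 ∨
          σ₀.A aAlive (x * n + y) = 1 ∧ ¬ σ.A aLab (T + y) < σ.A aLab (T + x) := by tauto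
      have h6 : σ₀.A aAlive (x * n + y) *
          (if σ.A aLab (T + y) < σ.A aLab (T + x) then 1 else 0) = 0 := by
        rcases h5 with h5 | h5 <;> simp [h5]
      have hadv := hσ.inv.advance (st' := fun x => ∃ s < σ.reg rSp, σ.A aStack s = x) hxn c3
        (by simpa only [hy] using c4) (fun _ => id) ⟨S, by omega, hx⟩
      have hpot := ptrPot_advance (deg := σ₀.A aDeg) (ptr := fun x => σ.A aPtr (T + x)) hxn c3
      simp only [checkTop, run_seq, run_assign, run_ite, run_setArr, Nat.reduceLT]
      simp [hS, hx, e1, e2, e3, e4, e6, a0, a1, a2, c1, c2', c3, hy, h6, hw0, and_assoc]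
      repeat refine And.intro (by omega) ?_
      simp only [setA_block, hAreg, State.reg_setA, ne_eq, Nat.reduceEqDiff, not_false_eq_true]
      simp only [treePot] at htime ⊢
      refine ⟨⟨?_, ?_, ?_, ?_, ?_, ?_, ?_, ?_, ?_⟩, by omega, by omega⟩
      · intro q h1 h2 h3 h4
        simp [h1, h2, h3, h4, hσ.regs]
      · intro k hk h1 h2 h3 h4
        funext z
        simp [hk, h1, h2, h3, h4, hσ.arrs]
      · intro z hz
        have := hσ.block z hz
        simp [State.A_setA_same, this]
        intro h; omega
      · intro z hz; simp [hσ.cnt_ne z hz]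
      · simpa [setA_block, hS] using hadv
      · intro s hs; simpa using hσ.stack_lt s (by simpa [hS] using hs)
      · simpa using hσ.cnt
      · simpa using hσ.mono
      · simpa using hσ.root
  · have hraise := fun st' => hσ.inv.raise hnet (st' := st') c2' (Nat.le_of_not_lt c3)
    have hpot1 := labelPot_raise (deg := σ₀.A aDeg) (lab := fun x => σ.A aLab (T + x)) hxn c2'
    have hpot2 := ptrPot_reset (deg := σ₀.A aDeg) (ptr := fun x => σ.A aPtr (T + x)) hxn
    have hcnt := inCount_raise (lab := fun x => σ.A aLab (T + x)) hxn c2'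
    have hcard : inCount n cap (fun x => σ.A aLab (T + x)) ≤ n := by
      simpa [inCount] using card_filter_le (range n) fun x => σ.A aLab (T + x) ≤ cap
    simp only [checkTop, raiseLabel, run_seq, run_assign, run_ite, run_setArr, Nat.reduceLT]
    simp [hS, hx, e1, e2, e3, e4, e5, e6, a0, a1, a2, c1, c2', c3, hw0, and_assoc]
    have h8 := hσ.cnt
    have h9 := Nat.sub_le (σ.A aCnt τ) (if cap ≤ σ.A aLab (T + x) then 1 else 0)
    repeat refine And.intro (by omega) ?_
    simp only [treePot] at htime ⊢
    refine (run_pushNbrs (w := w) (n := n) (X := X) ?_ hnn ?_ ?_ ?_ ?_ ?_).mono ?_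
    · simpa [e6] using hX
    · simp [e1]
    · simpa using hxn
    · simpa [a1] using hdegx
    · simpa [a1, a0] using hnet.adj_lt x hxn
    · simp [a1]; omega
    simp [a1, a0]
    intro σ' T' g1 g2 g3 g4 g5 g6
    have k1 := g2 aLab (by decide) (by decide)
    have k2 := g2 aPtr (by decide) (by decide)
    have k3 := g2 aCnt (by decide) (by decide)
    have hlab' : (fun y => σ'.A aLab (T + y)) =
        Function.update (fun y => σ.A aLab (T + y)) x (σ.A aLab (T + x) + 1) := by
      rw [k1]; funext y; simp [State.A_setA_same, Function.update_apply]
    have hptr' : (fun y => σ'.A aPtr (T + y)) =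
        Function.update (fun y => σ.A aPtr (T + y)) x 0 := by
      rw [k2]; funext y; simp [State.A_setA_same, Function.update_apply]
    rw [hlab', hptr']
    refine ⟨⟨?_, ?_, ?_, ?_, ?_, ?_, ?_, ?_, ?_⟩, by omega, by omega⟩
    · intro q h1 h2 h3 h4
      simp [g1 q h1 h3, h1, h2, h3, h4, hσ.regs]
    · intro k hk h1 h2 h3 h4
      funext z
      simp [g2 k hk h4, hk, h1, h2, h3, h4, hσ.arrs]
    · intro z hz
      have := hσ.block z hz
      simp [k1, k2, State.A_setA_same, this]
      constructor <;> intro h <;> omega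
    · intro z hz; simp [k3, State.A_setA_same, hσ.cnt_ne z hz, hz]
    · rw [hlab', hptr']
      refine hraise _ ?_ ?_ ?_
      · rintro y ⟨s, hs, rfl⟩
        exact ⟨s, by omega, by rw [g4 s (by omega)]⟩
      · exact ⟨S, by omega, by rw [g4 S (by omega)]; simpa using hx⟩
      · intro k hk
        exact ⟨S + 1 + k, by omega, g5 k hk⟩
    · intro s hs
      by_cases h9 : s < S + 1
      · rw [g4 s (by omega)]; simpa using hσ.stack_lt s (by omega)
      · obtain ⟨k, rfl⟩ := Nat.exists_eq_add_of_le (Nat.le_of_not_lt h9)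
        rw [g5 k (by omega)]
        exact hnet.adj_lt x hxn k (by omega)
    · rw [hlab', hcnt, k3]
      simp [h8]
      split_ifs <;> simp
    · intro y hy
      refine (hσ.mono y hy).trans ?_
      have := congrFun hlab' y; beta_reduce at this
      rw [this]
      by_cases hyx : y = x
      · subst hyx; simp
      · simp [hyx]
    · intro hr
      have := congrFun hlab' r
      rw [this, Function.update_of_ne (Ne.symm c1)]
      exact hσ.root hr

/-- The repair restores the invariant of the tree, with no vertex left to be checked, in a time that
is paid by the potential of the tree. -/
theorem run_repair {w : ℕ} [hw : Fact (16 < 2 ^ w)] {n X T cap r τ : ℕ} {Γ : SimpleGraph ℕ}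
    {σ : State} {Tm : ℕ}
    (hX : σ.reg 31 + 16 * X + 16 ≤ 2 ^ w) (hnn : n * n ≤ X) (hTX : T + n ≤ X) (hτ : τ < X)
    (hcap : cap + 1 ≤ X)
    (hN : σ.reg rN = n) (hT : σ.reg rT = T) (hC : σ.reg rCap = cap) (hr : σ.reg rRoot = r)
    (hTau : σ.reg rTau = τ) (halive : AliveRep n Γ σ)
    (hnet : Net n (σ.A aDeg) (fun x k => σ.A aAdj (x * n + k)) Γ)
    (hinv : TreeInv n (σ.A aDeg) (fun x k => σ.A aAdj (x * n + k)) Γ cap r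
      (fun x => σ.A aLab (T + x)) (fun x => σ.A aPtr (T + x))
      (fun x => ∃ s < σ.reg rSp, σ.A aStack s = x))
    (hst : ∀ s < σ.reg rSp, σ.A aStack s < n)
    (hcnt : σ.A aCnt τ = inCount n cap fun x => σ.A aLab (T + x))
    (hsp : σ.reg rSp + labelPot n (σ.A aDeg) cap (fun x => σ.A aLab (T + x)) ≤ X) :
    Run w repair σ Tm fun σ' Tm' => Repairing n T cap r τ Γ σ σ' ∧ σ'.reg rSp = 0 ∧
      Tm' + treePot n (σ.A aDeg) cap (fun x => σ'.A aLab (T + x)) (fun x => σ'.A aPtr (T + x)) ≤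
        Tm + 150 * σ.reg rSp + treePot n (σ.A aDeg) cap (fun x => σ.A aLab (T + x))
          (fun x => σ.A aPtr (T + x)) + 2 := by
  refine run_while (fun σ' Tm' => Repairing n T cap r τ Γ σ σ' ∧
      σ'.reg rSp + labelPot n (σ.A aDeg) cap (fun x => σ'.A aLab (T + x)) ≤ X ∧
      Tm' + 150 * σ'.reg rSp + treePot n (σ.A aDeg) cap (fun x => σ'.A aLab (T + x))
        (fun x => σ'.A aPtr (T + x)) ≤ Tm + 150 * σ.reg rSp + treePot n (σ.A aDeg) cap
          (fun x => σ.A aLab (T + x)) (fun x => σ.A aPtr (T + x)))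
    (Tm + 150 * σ.reg rSp + treePot n (σ.A aDeg) cap
      (fun x => σ.A aLab (T + x)) (fun x => σ.A aPtr (T + x)))
    (fun σ' Tm' h => by have := h.2.2; omega) (fun _ _ _ => trivial) ?_ ?_ ?_
  · rintro σ' Tm' ⟨h1, h2, h3⟩ hne
    exact run_checkTop hX hnn hTX hτ hcap hN hT hC hr hTau halive hnet h1 h2 h3 hne
  · rintro σ' Tm' ⟨h1, h2, h3⟩ h0
    simp at h0
    refine ⟨h1, h0, ?_⟩
    simp
    omega
  · refine ⟨⟨fun _ _ _ _ _ => rfl, fun _ _ _ _ _ _ => rfl, fun _ _ => ⟨rfl, rfl⟩, fun _ _ => rfl,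
      hinv, hst, hcnt, fun _ _ => le_rfl, fun _ => rfl⟩, hsp, le_rfl⟩

end DecrementalAPSP

namespace DecrementalAPSP
open WordRAM Finset

/-! ### Components and levels -/

section Components
open Classical in
/-- The size of the component of `x` in a graph on the vertices below `n`. -/
noncomputable def csize (n : ℕ) (Γ : SimpleGraph ℕ) (x : ℕ) : ℕ :=
  #{y ∈ range n | Γ.Reachable x y}

variable {n : ℕ} {Γ Γ' : SimpleGraph ℕ}

theorem csize_eq {x y : ℕ} (h : Γ.Reachable x y) : csize n Γ x = csize n Γ y := by
  classical
  rw [csize, csize]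
  congr 1
  exact filter_congr fun z _ => ⟨fun h1 => h.symm.trans h1, fun h1 => h.trans h1⟩

theorem csize_mono (hle : Γ' ≤ Γ) (x : ℕ) : csize n Γ' x ≤ csize n Γ x :=
  card_le_card fun _ => by
    simp only [mem_filter]
    exact fun h => ⟨h.1, h.2.mono hle⟩

theorem reachable_lt (hΓ : ∀ x y, Γ.Adj x y → x < n) {a b : ℕ} (ha : a < n)
    (h : Γ.Reachable a b) : b < n := by
  obtain ⟨p⟩ := h
  induction p with
  | nil => exact ha
  | cons h p ih => exact ih (hΓ _ _ h.symm)

/-- A label function that changes by at most one along edges takes all intermediate values. -/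
theorem exists_level {f : ℕ → ℕ} (hf : ∀ x y, Γ.Adj x y → f x ≤ f y + 1) {a b l : ℕ}
    (h : Γ.Reachable a b) (h1 : f a ≤ l) (h2 : l ≤ f b) : ∃ z, Γ.Reachable a z ∧ f z = l := by
  obtain ⟨p⟩ := h
  induction p with
  | @nil a => exact ⟨a, .refl _, by omega⟩
  | @cons a c b h p ih =>
    by_cases hl : f a = l
    · exact ⟨a, .refl _, hl⟩
    · have := hf c a h.symm
      obtain ⟨z, h3, h4⟩ := ih (by omega) h2
      exact ⟨z, h.reachable.trans h3, h4⟩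

theorem sub_le_card_of_levels {s : Finset ℕ} {f : ℕ → ℕ} {a b : ℕ}
    (h : ∀ l, a ≤ l → l < b → ∃ z ∈ s, f z = l) : b - a ≤ #s := by
  rw [← Nat.card_Ico]
  refine (card_le_card fun l hl => ?_).trans (card_image_le (f := f))
  rw [mem_Ico] at hl
  rw [mem_image]
  exact h l hl.1 hl.2

open Classical in
/-- If the component of `c` has more than `H` vertices, then all levels from `f c` to `H` occur in
it, or all of its vertices have at most the level `H`. -/
theorem min_le_card_level (hΓ : ∀ x y, Γ.Adj x y → x < n) {f : ℕ → ℕ}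
    (hf : ∀ x y, Γ.Adj x y → f x ≤ f y + 1) {c : ℕ} (hc : c < n) (H : ℕ) :
    min (csize n Γ c) (H + 1 - f c) ≤ #{x ∈ range n | Γ.Reachable c x ∧ f x ≤ H} := by
  by_cases h : ∃ y, Γ.Reachable c y ∧ H < f y
  · obtain ⟨y, h1, h2⟩ := h
    refine (min_le_right _ _).trans (sub_le_card_of_levels (f := f) fun l h3 h4 => ?_)
    obtain ⟨z, h5, h6⟩ := exists_level hf h1 h3 (by omega)
    exact ⟨z, by simp only [mem_filter, mem_range]; exact ⟨reachable_lt hΓ hc h5, h5, by omega⟩, h6⟩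
  · push Not at h
    refine (min_le_left _ _).trans (card_le_card fun y => ?_)
    simp only [mem_filter]
    exact fun h1 => ⟨h1.1, h1.2, h y h1.2⟩

/-- A vertex that `c` reached before the deletion of the edge `uv` is still reachable, or its path used
the edge and is cut into a path to one end and a path from the other one. -/
theorem reachable_deleteEdge {u v c y : ℕ} (h : Γ.Reachable c y) :
    (Γ.deleteEdges {s(u, v)}).Reachable c y ∨ ∃ a b, (a = u ∧ b = v ∨ a = v ∧ b = u) ∧ Γ.Adj a b ∧
      (Γ.deleteEdges {s(u, v)}).Reachable c a ∧ (Γ.deleteEdges {s(u, v)}).Reachable b y := by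
  obtain ⟨p⟩ := h
  induction p with
  | nil => exact .inl (.refl _)
  | @cons c d y h p ih =>
    by_cases he : s(c, d) = s(u, v)
    · rw [Sym2.eq_iff] at he
      rcases ih with ih | ⟨a, b, hab, -, h1, h2⟩
      · exact .inr ⟨c, d, he, h, .refl _, ih⟩
      · by_cases hb : b = d
        · subst hb; exact .inr ⟨c, b, he, h, .refl _, h2⟩
        · have hbc : b = c := by
            rcases he with ⟨rfl, rfl⟩ | ⟨rfl, rfl⟩ <;> rcases hab with ⟨rfl, rfl⟩ | ⟨rfl, rfl⟩ <;>
              first | rfl | exact absurd rfl hb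
          exact .inl (hbc ▸ h2)
    · have h1 : (Γ.deleteEdges {s(u, v)}).Reachable c d :=
        SimpleGraph.Adj.reachable (by rw [SimpleGraph.deleteEdges_adj]; exact ⟨h, he⟩)
      rcases ih with ih | ⟨a, b, h2, h3, h4, h5⟩
      · exact .inl (h1.trans ih)
      · exact .inr ⟨a, b, h2, h3, h1.trans h4, h5⟩

end Components

namespace TreeInv
variable {n : ℕ} {deg : ℕ → ℕ} {adj : ℕ → ℕ → ℕ} {Γ : SimpleGraph ℕ} {cap r : ℕ} {lab ptr : ℕ → ℕ}

/-- Along a path to the root, a function that changes by at most one along edges changes by at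
most the difference of the labels. -/
theorem root_lip (hnet : Net n deg adj Γ) (h : TreeInv n deg adj Γ cap r lab ptr fun _ => False)
    {f : ℕ → ℕ} (hf : ∀ x y, Γ.Adj x y → f x ≤ f y + 1) {x : ℕ} (hx : x < n) (hl : lab x ≤ cap) :
    f r + lab r ≤ f x + lab x := by
  induction hk : lab x using Nat.strong_induction_on generalizing x with
  | _ k ih =>
    subst hk
    by_cases hxr : x = r
    · subst hxr; exact le_rfl
    · obtain ⟨h1, h2, h3⟩ := h.settled x hx hxr hl not_false
      have h4 := ih _ h3 (hnet.adj_lt x hx _ h1) (by omega) rfl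
      have := hf _ _ h2.symm
      omega

/-- The number of vertices in the tree tells whether the component of the root is large. -/
theorem lt_inCount_iff (hnet : Net n deg adj Γ)
    (h : TreeInv n deg adj Γ cap r lab ptr fun _ => False) (hr : r < n) {H : ℕ}
    (hH : lab r + H ≤ cap) : H < inCount n cap lab ↔ H < csize n Γ r := by
  classical
  have hΓ : ∀ x y, Γ.Adj x y → x < n := fun x y hxy => (hnet.mem_adj x y hxy).1
  constructor
  · refine fun h1 => h1.trans_le (card_le_card fun y => ?_)
    simp only [mem_filter, mem_range]
    exact fun h2 => ⟨h2.1, (h.reachable hnet h2.1 h2.2).2.2⟩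
  · intro h1
    have h2 := min_le_card_level hΓ h.lip hr cap
    have h3 : #{x ∈ range n | Γ.Reachable r x ∧ lab x ≤ cap} ≤ inCount n cap lab :=
      card_le_card fun y => by simp only [mem_filter]; exact fun h => ⟨h.1, h.2.2⟩
    omega

end TreeInv

/-! ### The centres of one scale -/

/-- The data of one scale: the number of centres opened so far, for every centre its root, the
number of vertices in its tree, the labels and the scan pointers, and for every vertex the number of
the centre that covers it. -/
structure ScaleData where
  num : ℕ
  root : ℕ → ℕ
  cnt : ℕ → ℕ
  lab : ℕ → ℕ → ℕ
  ptr : ℕ → ℕ → ℕ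
  cov : ℕ → ℕ

namespace ScaleData

/-- The amount by which the radius of the centre `j` was reduced: the offset of its labels, or
`h + 1` if the centre was closed. -/
def weight (d : ScaleData) (n h j : ℕ) : ℕ := if d.root j = n then h + 1 else d.lab j (d.root j)

/-- The invariant of a scale with the radius `h` and the depth `cap`. Components with at most `h`
vertices are called small. The sets of the vertices with a label of at most `h` in the tree of the
centre `j` are pairwise disjoint, and the reductions of their radii are paid by vertices in small
components. -/
structure Inv (n : ℕ) (deg : ℕ → ℕ) (adj : ℕ → ℕ → ℕ) (Γ : SimpleGraph ℕ) (h cap : ℕ)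
    (d : ScaleData) : Prop where
  tree : ∀ j < d.num, TreeInv n deg adj Γ cap (d.root j) (d.lab j) (d.ptr j) fun _ => False
  cnt : ∀ j < d.num, d.cnt j = inCount n cap (d.lab j)
  root : ∀ j < d.num, d.root j = n ∨
    d.root j < n ∧ h < csize n Γ (d.root j) ∧ d.lab j (d.root j) ≤ h
  disj : ∀ j < d.num, ∀ j' < d.num, j ≠ j' → ∀ x < n, d.lab j x ≤ h → h < d.lab j' x
  count : ∑ j ∈ range d.num, d.weight n h j ≤ #{x ∈ range n | csize n Γ x ≤ h}
  cov : ∀ x < n, d.cov x ≤ d.num ∧ ∀ j < d.cov x, 2 * h < d.lab j x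
  fresh : ∀ j, d.num ≤ j → j ≤ n → ∀ x < n, d.lab j x = 0 ∧ d.ptr j x = 0

variable {n : ℕ} {deg : ℕ → ℕ} {adj : ℕ → ℕ → ℕ} {Γ : SimpleGraph ℕ} {h cap : ℕ} {d d' : ScaleData}

/-- The number of centres that are ever opened is at most `n / (h + 1)`. A centre accounts for
`h + 1` vertices: for its reduction, vertices in small components, and for the remaining radius,
vertices in large components with a label of at most `h`, one for every value of the label. -/
theorem Inv.num_mul_le (hnet : Net n deg adj Γ) (H : d.Inv n deg adj Γ h cap) :
    d.num * (h + 1) ≤ n := by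
  classical
  have hΓ : ∀ x y, Γ.Adj x y → x < n := fun x y hxy => (hnet.mem_adj x y hxy).1
  let S : ℕ → Finset ℕ := fun j => {x ∈ range n | h < csize n Γ x ∧ d.lab j x ≤ h}
  have h1 : ∀ j ∈ range d.num, h + 1 ≤ d.weight n h j + #(S j) := by
    intro j hj
    rw [mem_range] at hj
    rcases H.root j hj with h1 | ⟨h1, h2, h3⟩
    · simp [weight, h1]
    · have h4 := min_le_card_level hΓ (H.tree j hj).lip h1 h
      have h5 : #{x ∈ range n | Γ.Reachable (d.root j) x ∧ d.lab j x ≤ h} ≤ #(S j) := by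
        refine card_le_card fun y => ?_
        simp only [mem_filter, S]
        exact fun h6 => ⟨h6.1, csize_eq h6.2.1 ▸ h2, h6.2.2⟩
      rw [weight, if_neg h1.ne]
      omega
  have h2 : ∑ j ∈ range d.num, #(S j) ≤ #{x ∈ range n | h < csize n Γ x} := by
    rw [← card_biUnion]
    · refine card_le_card (biUnion_subset.2 fun j _ x => ?_)
      simp only [mem_filter, S]
      exact fun h6 => ⟨h6.1, h6.2.1⟩
    · intro j hj j' hj' hne
      refine disjoint_left.2 fun x hx hx' => ?_
      simp only [mem_filter, S, mem_range] at hx hx' hj hj'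
      have := H.disj j (by simpa using hj) j' (by simpa using hj') hne x hx.1 hx.2.2
      omega
  have h3 := sum_le_sum h1
  rw [sum_const, card_range, smul_eq_mul, sum_add_distrib] at h3
  have h4 := H.count
  have h5 := card_filter_add_card_filter_not (s := range n) (fun x => csize n Γ x ≤ h)
  simp only [not_le, card_range] at h5
  omega

theorem Inv.num_le (hnet : Net n deg adj Γ) (H : d.Inv n deg adj Γ h cap) : d.num ≤ n :=
  (Nat.le_mul_of_pos_right _ h.succ_pos).trans (H.num_mul_le hnet)

open Classical in
/-- An end of the deleted edge `uv` with a large component, if there is one. -/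
noncomputable def largeEnd (n : ℕ) (Γ' : SimpleGraph ℕ) (h u v : ℕ) : ℕ :=
  if h < csize n Γ' u then u else v

open Classical in
/-- The root of a tree after the deletion of the edge `uv`. If the component of the old root `r`
became small, the centre moves to the end of `uv` on the other side, as long as its radius remains
non-negative and the other side is large, and otherwise it is closed. -/
noncomputable def newRoot (n : ℕ) (Γ' : SimpleGraph ℕ) (h u v r : ℕ) (lab : ℕ → ℕ) : ℕ :=
  if r = n ∨ h < csize n Γ' r then r
  else if h < csize n Γ' (largeEnd n Γ' h u v) ∧ lab (largeEnd n Γ' h u v) ≤ h then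
    largeEnd n Γ' h u v
  else n

/-- The centre `j` was updated after the deletion of the edge `uv`, which led to the graph `Γ'`. -/
structure TreeStep (n : ℕ) (deg : ℕ → ℕ) (adj : ℕ → ℕ → ℕ) (Γ' : SimpleGraph ℕ) (h cap u v : ℕ)
    (d d' : ScaleData) (j : ℕ) : Prop where
  tree : TreeInv n deg adj Γ' cap (d'.root j) (d'.lab j) (d'.ptr j) fun _ => False
  cnt : d'.cnt j = inCount n cap (d'.lab j)
  mono : ∀ x < n, d.lab j x ≤ d'.lab j x
  root : d'.root j = newRoot n Γ' h u v (d.root j) (d.lab j)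
  lab_root : d'.root j < n → d'.lab j (d'.root j) = d.lab j (d'.root j)

/-- The reduction of the radius is at most the number of vertices near the centre whose components
became small. Indeed, the labels in the old component of the root take all values between the labels
of the old and the new root, on the side of the deleted edge that became small. -/
theorem Inv.weight_le (hnet : Net n deg adj Γ) (H : d.Inv n deg adj Γ h cap) {u v j : ℕ}
    (hj : j < d.num)
    (hs : TreeStep n deg adj (Γ.deleteEdges {s(u, v)}) h cap u v d d' j) :
    d'.weight n h j ≤ d.weight n h j + #{x ∈ range n | d.lab j x ≤ h ∧ h < csize n Γ x ∧
      csize n (Γ.deleteEdges {s(u, v)}) x ≤ h} := by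
  classical
  have hΓ : ∀ x y, Γ.Adj x y → x < n := fun x y hxy => (hnet.mem_adj x y hxy).1
  have hlip := (H.tree j hj).lip
  have hr := hs.root
  rw [newRoot] at hr
  split_ifs at hr with h1 h2
  · refine le_trans (le_of_eq ?_) (Nat.le_add_right _ _)
    rw [weight, weight, hr]
    split_ifs with h2
    · rfl
    · rw [← hr]
      refine hs.lab_root ?_
      rw [hr]
      rcases H.root j hj with h3 | h3
      · exact absurd h3 h2
      · exact h3.1
  all_goals
    push Not at h1
    obtain ⟨hc, hbig, hlc⟩ := (H.root j hj).resolve_left h1.1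
    -- the deleted edge separates the root from `b`
    obtain ⟨y, hy1, hy2⟩ : ∃ y, Γ.Reachable (d.root j) y ∧
        ¬ (Γ.deleteEdges {s(u, v)}).Reachable (d.root j) y := by
      by_contra! hall
      refine absurd (hbig.trans_le (card_le_card fun y => ?_)) (not_lt.2 h1.2)
      simp only [mem_filter]
      exact fun h3 => ⟨h3.1, hall y h3.2⟩
    obtain ⟨a, b, hab, hadj, hca, hby⟩ := (reachable_deleteEdge hy1).resolve_left hy2
    have hcb : ¬ (Γ.deleteEdges {s(u, v)}).Reachable (d.root j) b := fun h3 => hy2 (h3.trans hby)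
    have hasmall : csize n (Γ.deleteEdges {s(u, v)}) a ≤ h := csize_eq (n := n) hca ▸ h1.2
    have hlev : ∀ t, t ≤ d.lab j b → t ≤ h + 1 → t - d.lab j (d.root j) ≤
        #{x ∈ range n | d.lab j x ≤ h ∧ h < csize n Γ x ∧
          csize n (Γ.deleteEdges {s(u, v)}) x ≤ h} := by
      intro t ht1 ht2
      refine sub_le_card_of_levels (f := d.lab j) fun l hl1 hl2 => ?_
      have := hlip b a hadj.symm
      obtain ⟨z, hz1, hz2⟩ := exists_level
        (fun x y hxy => hlip x y (SimpleGraph.deleteEdges_le _ hxy)) hca hl1 (by omega)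
      have hz3 := hz1.mono (SimpleGraph.deleteEdges_le (G := Γ) _)
      refine ⟨z, ?_, hz2⟩
      simp only [mem_filter, mem_range]
      exact ⟨reachable_lt hΓ hc hz3, by omega, csize_eq hz3 ▸ hbig, csize_eq (n := n) hz1 ▸ h1.2⟩
    have hw : d.weight n h j = d.lab j (d.root j) := by rw [weight, if_neg h1.1]
    rw [hw]
  · -- the centre moves to `b`
    have hb : largeEnd n (Γ.deleteEdges {s(u, v)}) h u v = b := by
      rw [largeEnd] at h2 ⊢
      rcases hab with ⟨rfl, rfl⟩ | ⟨rfl, rfl⟩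
      · rw [if_neg (by omega)]
      · split_ifs at h2 ⊢ with h3
        · rfl
        · omega
    rw [hb] at hr h2
    have hbn : b < n := hΓ b a hadj.symm
    have hw' : d'.weight n h j = d.lab j b := by
      rw [weight, if_neg (by omega), hs.lab_root (by omega), hr]
    have := hlev (d.lab j b) le_rfl (by omega)
    omega
  · have hw' : d'.weight n h j = h + 1 := by rw [weight, if_pos hr]
    by_cases hb : h < csize n (Γ.deleteEdges {s(u, v)}) b
    · -- the radius is used up
      have hb' : largeEnd n (Γ.deleteEdges {s(u, v)}) h u v = b := by
        rw [largeEnd]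
        rcases hab with ⟨rfl, rfl⟩ | ⟨rfl, rfl⟩
        · rw [if_neg (by omega)]
        · rw [if_pos hb]
      rw [hb'] at h2
      have := hlev (h + 1) (by by_contra h3; exact h2 ⟨hb, by omega⟩) le_rfl
      omega
    · -- both sides are small
      have h3 := min_le_card_level hΓ hlip hc h
      have h4 : #{x ∈ range n | Γ.Reachable (d.root j) x ∧ d.lab j x ≤ h} ≤
          #{x ∈ range n | d.lab j x ≤ h ∧ h < csize n Γ x ∧
            csize n (Γ.deleteEdges {s(u, v)}) x ≤ h} := by
        refine card_le_card fun x => ?_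
        simp only [mem_filter]
        rintro ⟨hx, hx1, hx2⟩
        refine ⟨hx, hx2, csize_eq hx1 ▸ hbig, ?_⟩
        rcases reachable_deleteEdge (u := u) (v := v) hx1 with h5 | ⟨a', b', hab', -, h5, h6⟩
        · exact csize_eq (n := n) h5 ▸ h1.2
        · have : b' = b := by
            have hne : b' ≠ a ∨ a = b := by
              by_contra! hh
              obtain ⟨rfl, hh2⟩ := hh
              have : a' = b := by
                rcases hab with ⟨rfl, rfl⟩ | ⟨rfl, rfl⟩ <;>
                  rcases hab' with ⟨h7, h8⟩ | ⟨h7, h8⟩ <;> simp_all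
              exact hcb (this ▸ h5)
            rcases hab with ⟨rfl, rfl⟩ | ⟨rfl, rfl⟩ <;>
              rcases hab' with ⟨rfl, rfl⟩ | ⟨rfl, rfl⟩ <;> simp_all
          subst this
          rw [← csize_eq (n := n) h6]
          omega
      omega

/-- The invariant is preserved by the update of all centres. The vertices that pay for the reductions
in `Inv.weight_le` are different for different centres, as the sets in `Inv.disj` are disjoint. -/
theorem Inv.delete (hnet : Net n deg adj Γ) (H : d.Inv n deg adj Γ h cap) {u v : ℕ}
    (hu : u < n) (hv : v < n) (hnum : d'.num = d.num) (hcov : d'.cov = d.cov)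
    (hs : ∀ j < d.num, TreeStep n deg adj (Γ.deleteEdges {s(u, v)}) h cap u v d d' j)
    (hfresh : ∀ j, d.num ≤ j → j ≤ n → ∀ x < n,
      d'.lab j x = d.lab j x ∧ d'.ptr j x = d.ptr j x) :
    d'.Inv n deg adj (Γ.deleteEdges {s(u, v)}) h cap := by
  classical
  have hle : Γ.deleteEdges {s(u, v)} ≤ Γ := SimpleGraph.deleteEdges_le _
  refine ⟨?_, ?_, ?_, ?_, ?_, ?_, ?_⟩
  · rw [hnum]; exact fun j hj => (hs j hj).tree
  · rw [hnum]; exact fun j hj => (hs j hj).cnt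
  · rw [hnum]
    intro j hj
    have h1 := (hs j hj).root
    have h2 := (hs j hj).lab_root
    by_cases h0 : d'.root j = n
    · exact .inl h0
    right
    rw [newRoot] at h1
    split_ifs at h1 with h3 h4
    · rw [← h1] at h3
      have h5 := (H.root j hj).resolve_left (h1 ▸ h0)
      rw [← h1] at h5
      refine ⟨h5.1, h3.resolve_left h0, ?_⟩
      rw [h2 h5.1]; exact h5.2.2
    · have hb : d'.root j < n := by rw [h1, largeEnd]; split_ifs <;> assumption
      rw [← h1] at h4
      exact ⟨hb, h4.1, by rw [h2 hb]; exact h4.2⟩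
    · exact absurd h1 h0
  · rw [hnum]
    intro j hj j' hj' hne x hx hl
    exact (H.disj j hj j' hj' hne x hx (((hs j hj).mono x hx).trans hl)).trans_le
      ((hs j' hj').mono x hx)
  · rw [hnum]
    have h1 := sum_le_sum fun j hj => H.weight_le hnet (mem_range.1 hj) (hs j (mem_range.1 hj))
    rw [sum_add_distrib, ← card_biUnion] at h1
    · have h2 := H.count
      refine h1.trans ((Nat.add_le_add_right h2 _).trans ?_)
      -- vertices that paid before were in small components already, so no vertex pays twice
      rw [← card_union_of_disjoint]
      · refine card_le_card fun x => ?_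
        simp only [mem_union, mem_filter, mem_biUnion]
        rintro (h3 | ⟨j, -, h3⟩)
        · exact ⟨h3.1, (csize_mono hle x).trans h3.2⟩
        · exact ⟨h3.1, h3.2.2.2⟩
      · refine disjoint_left.2 fun x => ?_
        simp only [mem_filter, mem_biUnion]
        rintro h3 ⟨j, -, h4⟩
        omega
    · intro j hj j' hj' hne
      refine disjoint_left.2 fun x hx hx' => ?_
      simp only [mem_filter, mem_range] at hx hx'
      have := H.disj j (by simpa using hj) j' (by simpa using hj') hne x hx.1 hx.2.1
      omega
  · rw [hnum, hcov]
    intro x hx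
    have h1 := H.cov x hx
    exact ⟨h1.1, fun j hj => (h1.2 j hj).trans_le ((hs j (hj.trans_le h1.1)).mono x hx)⟩
  · rw [hnum]
    intro j h1 h2 x hx
    obtain ⟨h3, h4⟩ := hfresh j h1 h2 x hx
    rw [h3, h4]
    exact H.fresh j h1 h2 x hx

/-- The invariant is preserved when a new centre is opened at a vertex that is not covered. As that
vertex has a label above `2 * h` in all other trees, the vertices at distance at most `h` from it have
labels above `h` there. -/
theorem Inv.opening (hnet : Net n deg adj Γ) (H : d.Inv n deg adj Γ h cap) (hcap : 2 * h ≤ cap)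
    {c : ℕ} (hc : c < n) (hbig : h < csize n Γ c) (hfar : ∀ j < d.num, 2 * h < d.lab j c)
    (hnum : d'.num = d.num + 1)
    (hold : ∀ j < d.num, d'.root j = d.root j ∧ d'.cnt j = d.cnt j ∧
      ∀ x < n, d'.lab j x = d.lab j x ∧ d'.ptr j x = d.ptr j x)
    (htree : TreeInv n deg adj Γ cap (d'.root d.num) (d'.lab d.num) (d'.ptr d.num) fun _ => False)
    (hroot : d'.root d.num = c) (hlab : d'.lab d.num c = 0)
    (hcnt : d'.cnt d.num = inCount n cap (d'.lab d.num))
    (hfresh : ∀ j, d.num < j → j ≤ n → ∀ x < n,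
      d'.lab j x = d.lab j x ∧ d'.ptr j x = d.ptr j x)
    (hcov : ∀ x < n, d'.cov x = d.cov x) :
    d'.Inv n deg adj Γ h cap := by
  have hsplit : ∀ j, j < d.num + 1 → j < d.num ∨ j = d.num := fun j hj => by omega
  have hnew : ∀ j < d.num, ∀ x < n, d'.lab d.num x ≤ h → h < d.lab j x := by
    intro j hj x hx hl
    have h1 := htree.root_lip hnet (H.tree j hj).lip hx (by omega)
    have := hfar j hj
    rw [hroot, hlab] at h1
    omega
  refine ⟨?_, ?_, ?_, ?_, ?_, ?_, ?_⟩
  · rw [hnum]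
    intro j hj
    rcases hsplit j hj with hj | rfl
    · have := (H.tree j hj).congr hnet (fun x hx => ((hold j hj).2.2 x hx).1)
        (fun x hx => ((hold j hj).2.2 x hx).2)
      rw [(hold j hj).1]; exact this
    · exact htree
  · rw [hnum]
    intro j hj
    rcases hsplit j hj with hj | rfl
    · rw [(hold j hj).2.1, H.cnt j hj, inCount_congr fun x hx => ((hold j hj).2.2 x hx).1]
    · exact hcnt
  · rw [hnum]
    intro j hj
    rcases hsplit j hj with hj | rfl
    · rw [(hold j hj).1]
      rcases H.root j hj with h1 | h1
      · exact .inl h1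
      · rw [((hold j hj).2.2 _ h1.1).1]; exact .inr h1
    · rw [hroot]; exact .inr ⟨hc, hbig, by omega⟩
  · rw [hnum]
    intro j hj j' hj' hne x hx hl
    rcases hsplit j hj with hj | rfl <;> rcases hsplit j' hj' with hj' | rfl
    · rw [((hold j hj).2.2 x hx).1] at hl
      rw [((hold j' hj').2.2 x hx).1]
      exact H.disj j hj j' hj' hne x hx hl
    · rw [((hold j hj).2.2 x hx).1] at hl
      by_contra h1
      have := hnew j hj x hx (by omega)
      omega
    · rw [((hold j' hj').2.2 x hx).1]
      exact hnew j' hj' x hx hl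
    · exact absurd rfl hne
  · rw [hnum, sum_range_succ]
    have h1 : ∑ j ∈ range d.num, d'.weight n h j = ∑ j ∈ range d.num, d.weight n h j := by
      refine sum_congr rfl fun j hj => ?_
      rw [mem_range] at hj
      rw [weight, weight, (hold j hj).1]
      split_ifs with h1
      · rfl
      · exact ((hold j hj).2.2 _ ((H.root j hj).resolve_left h1).1).1
    have h2 : d'.weight n h d.num = 0 := by rw [weight, hroot, if_neg hc.ne, hlab]
    rw [h1, h2]
    exact H.count
  · rw [hnum]
    intro x hx
    rw [hcov x hx]
    have h1 := H.cov x hx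
    refine ⟨by omega, fun j hj => ?_⟩
    rw [((hold j (by omega)).2.2 x hx).1]
    exact h1.2 j hj
  · rw [hnum]
    intro j h1 h2 x hx
    obtain ⟨h3, h4⟩ := hfresh j h1 h2 x hx
    rw [h3, h4]
    exact H.fresh j (by omega) h2 x hx

/-- A covered vertex lies in a large component. -/
theorem Inv.large_of_covered (hnet : Net n deg adj Γ) (H : d.Inv n deg adj Γ h cap)
    {x j : ℕ} (hx : x < n) (hj : j < d.num) (hl : d.lab j x ≤ cap) :
    d.root j < n ∧ d.lab j (d.root j) ≤ h ∧ Γ.Reachable (d.root j) x ∧ h < csize n Γ x := by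
  obtain ⟨h1, -, h3⟩ := (H.tree j hj).reachable hnet hx hl
  obtain ⟨h4, h5, h6⟩ := (H.root j hj).resolve_left (by omega)
  exact ⟨h1, h6, h3, csize_eq h3 ▸ h5⟩

/-- From the centre that covers `x`, one can see whether the component of `x` has more than `h'`
vertices. With the radius of the next scale for `h'`, this is how a scale learns which components are
large. -/
theorem Inv.lt_csize_iff (hnet : Net n deg adj Γ) (H : d.Inv n deg adj Γ h cap) {h' x : ℕ}
    (hh : h ≤ h') (hcap : h + h' ≤ cap) (hcap' : 2 * h ≤ cap) (hx : x < n)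
    (hcov : d.cov x < d.num → d.lab (d.cov x) x ≤ 2 * h)
    (hlarge : h < csize n Γ x → d.cov x < d.num) :
    d.cov x < d.num ∧ h' < d.cnt (d.cov x) ↔ h' < csize n Γ x := by
  by_cases hc : d.cov x < d.num
  · obtain ⟨h1, h2, h3, h4⟩ := H.large_of_covered hnet hx hc ((hcov hc).trans hcap')
    rw [and_iff_right hc, H.cnt _ hc, (H.tree _ hc).lt_inCount_iff hnet h1 (by omega),
      csize_eq (n := n) h3]
  · have : ¬ h < csize n Γ x := fun h1 => hc (hlarge h1)
    simp only [hc, false_and, false_iff]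
    omega

end ScaleData
end DecrementalAPSP

namespace DecrementalAPSP
open WordRAM Finset Expr Cmd

/-! ### Updating and opening a single tree -/

/-- The root `rRoot` of the current tree is in a component that became small: move it to an end of the
deleted edge as in `newRoot`, and push the old root on the stack. -/
def moveRoot : Cmd :=
  setArr aStack (const 0) (reg rRoot) ;;
  rSp ::= const 1 ;;
  .ite (arr aBig (reg rU)) (rRoot ::= reg rU) (rRoot ::= reg rV) ;;
  .ite (arr aBig (reg rRoot) * lt (arr aLab (reg rT + reg rRoot)) (reg rH + const 1)) .skip
    (rRoot ::= reg rN) ;;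
  setArr aRoot (reg rTau) (reg rRoot)

/-- Update the tree with the number `rJ` of the current scale after the deletion of the edge with the
ends `rU` and `rV`. -/
def treeStep : Cmd :=
  rTau ::= reg rTb + reg rJ ;;
  rT ::= reg rTau * reg rN ;;
  rRoot ::= arr aRoot (reg rTau) ;;
  rSp ::= const 0 ;;
  .ite (arr aBig (reg rRoot)) .skip moveRoot ;;
  setArr aStack (reg rSp) (reg rU) ;;
  rSp ::= reg rSp + const 1 ;;
  setArr aStack (reg rSp) (reg rV) ;;
  rSp ::= reg rSp + const 1 ;;
  repair

/-- Open the centre number `rC` of the current scale at the vertex `rZ`. All labels and scan pointers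
are still `0`, so the tree is built by the repair of a tree in which all vertices wait for a check. -/
def openTree : Cmd :=
  rTau ::= reg rTb + reg rC ;;
  rT ::= reg rTau * reg rN ;;
  rRoot ::= reg rZ ;;
  setArr aRoot (reg rTau) (reg rZ) ;;
  setArr aCnt (reg rTau) (reg rN) ;;
  rSp ::= const 0 ;;
  .while (lt (reg rSp) (reg rN)) (
    setArr aStack (reg rSp) (reg rSp) ;;
    rSp ::= reg rSp + const 1) ;;
  repair

/-- The data of the scale `i` in the memory. Every scale has room for `n + 1` trees. -/
def scaleAt (n i : ℕ) (σ : State) : ScaleData where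
  num := σ.A aNum i
  root j := σ.A aRoot (i * (n + 1) + j)
  cnt j := σ.A aCnt (i * (n + 1) + j)
  lab j x := σ.A aLab ((i * (n + 1) + j) * n + x)
  ptr j x := σ.A aPtr ((i * (n + 1) + j) * n + x)
  cov x := σ.A aCov (i * n + x)

section scaleAt
variable (n i j : ℕ) (σ : State)
theorem scaleAt_num : (scaleAt n i σ).num = σ.A aNum i := rfl
theorem scaleAt_root : (scaleAt n i σ).root j = σ.A aRoot (i * (n + 1) + j) := rfl
theorem scaleAt_cnt : (scaleAt n i σ).cnt j = σ.A aCnt (i * (n + 1) + j) := rfl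
theorem scaleAt_lab :
    (scaleAt n i σ).lab j = fun x => σ.A aLab ((i * (n + 1) + j) * n + x) := rfl
theorem scaleAt_ptr :
    (scaleAt n i σ).ptr j = fun x => σ.A aPtr ((i * (n + 1) + j) * n + x) := rfl
theorem scaleAt_cov (x : ℕ) : (scaleAt n i σ).cov x = σ.A aCov (i * n + x) := rfl
end scaleAt

/-- The parts of the state that are constant during an update: the number of vertices, the current
graph `Γ` and the adjacency lists. All array indices are below `X`, and the array entries with
such indices can be addressed. -/
structure Static (w n X : ℕ) (Γ : SimpleGraph ℕ) (σ : State) : Prop where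
  addr : σ.reg 31 + 16 * X + 16 ≤ 2 ^ w
  sq_le : n * n ≤ X
  regN : σ.reg rN = n
  alive : AliveRep n Γ σ
  net : Net n (σ.A aDeg) (fun x k => σ.A aAdj (x * n + k)) Γ

theorem Static.transfer {w n X : ℕ} {Γ : SimpleGraph ℕ} {σ σ' : State} (h : Static w n X Γ σ)
    (h31 : σ'.reg 31 = σ.reg 31) (hN : σ'.reg rN = σ.reg rN) (h0 : σ'.A aAdj = σ.A aAdj)
    (h1 : σ'.A aDeg = σ.A aDeg) (h2 : σ'.A aAlive = σ.A aAlive) : Static w n X Γ σ' := by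
  refine ⟨h31 ▸ h.addr, h.sq_le, hN ▸ h.regN, ?_, ?_⟩
  · rw [AliveRep, h2]; exact h.alive
  · rw [h0, h1]; exact h.net

/-- The registers hold the parameters of the scale `i`, and the trees of this scale fit into the
memory. -/
structure AtScale (n X i h cap : ℕ) (σ : State) : Prop where
  index_le : (i * (n + 1) + (n + 1)) * n + n ≤ X
  pot_le : (cap + 1) * (n * (n + 1)) + n + 3 ≤ X
  cap_le : cap + 1 ≤ X
  radius_le : 2 * h ≤ cap
  regI : σ.reg rI = i
  regH : σ.reg rH = h
  regCap : σ.reg rCap = cap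
  regTb : σ.reg rTb = i * (n + 1)
  regCb : σ.reg rCb = i * n

/-- The flags tell which components have more than `h` vertices; the index `n`, which encodes the
absence of a root, has a flag as well. -/
structure BigRep (n : ℕ) (Γ : SimpleGraph ℕ) (h : ℕ) (σ : State) : Prop where
  big : ∀ x < n, h < csize n Γ x ∧ σ.A aBig x = 1 ∨ csize n Γ x ≤ h ∧ σ.A aBig x = 0
  none : σ.A aBig n = 1

/-- From `σ` to `σ'`, only the tree `τ` and auxiliary registers were changed. -/
structure TreeFrame (n τ : ℕ) (σ σ' : State) : Prop where
  regs : ∀ q, q ≠ rTau → q ≠ rT → q ≠ rRoot → q ≠ rSp → q ≠ rX → q ≠ rK → q ≠ rY →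
    σ'.reg q = σ.reg q
  arrs : ∀ k < 16, k ≠ aLab → k ≠ aPtr → k ≠ aCnt → k ≠ aStack → k ≠ aRoot → σ'.A k = σ.A k
  block : ∀ z, z < τ * n ∨ τ * n + n ≤ z → σ'.A aLab z = σ.A aLab z ∧ σ'.A aPtr z = σ.A aPtr z
  root_ne : ∀ z, z ≠ τ → σ'.A aRoot z = σ.A aRoot z
  cnt_ne : ∀ z, z ≠ τ → σ'.A aCnt z = σ.A aCnt z

theorem labelPot_le {n : ℕ} {deg lab : ℕ → ℕ} {cap : ℕ} (hdeg : ∀ x < n, deg x ≤ n) :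
    labelPot n deg cap lab ≤ (cap + 1) * (n * (n + 1)) := by
  refine (sum_le_card_nsmul _ _ ((cap + 1) * (n + 1)) fun x hx => ?_).trans (le_of_eq ?_)
  · exact Nat.mul_le_mul (Nat.sub_le _ _) (Nat.succ_le_succ (hdeg x (mem_range.1 hx)))
  · rw [card_range, smul_eq_mul]; ring

theorem tree_index_le {n X i j : ℕ} (h : (i * (n + 1) + (n + 1)) * n + n ≤ X) (hn : 0 < n)
    (hj : j ≤ n) : (i * (n + 1) + j) * n + n ≤ X ∧ i * (n + 1) + j < X ∧ i * n + n ≤ X ∧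
      i < X := by
  refine ⟨?_, ?_, ?_, ?_⟩ <;> nlinarith [Nat.zero_le (i * n), Nat.zero_le i, Nat.zero_le (i * n * n)]

variable {w : ℕ} [hw : Fact (16 < 2 ^ w)] {n X i h cap : ℕ} {Γ : SimpleGraph ℕ} {σ : State} {Tm : ℕ}

/-- The update of a single tree, in a time that is paid by its potential up to a constant. -/
theorem run_treeStep {u v j : ℕ}
    (hst : Static w n X (Γ.deleteEdges {s(u, v)}) σ) (hsc : AtScale n X i h cap σ)
    (hbig : BigRep n (Γ.deleteEdges {s(u, v)}) h σ)
    (hu : u < n) (hv : v < n) (hU : σ.reg rU = u) (hV : σ.reg rV = v) (hJ : σ.reg rJ = j)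
    (hj : j < n) (htree : TreeInv n (σ.A aDeg) (fun x k => σ.A aAdj (x * n + k)) Γ cap
      ((scaleAt n i σ).root j) ((scaleAt n i σ).lab j) ((scaleAt n i σ).ptr j) fun _ => False)
    (hcnt : (scaleAt n i σ).cnt j = inCount n cap ((scaleAt n i σ).lab j))
    (hrn : (scaleAt n i σ).root j ≤ n) :
    Run w treeStep σ Tm fun σ' Tm' => TreeFrame n (i * (n + 1) + j) σ σ' ∧
      ScaleData.TreeStep n (σ.A aDeg) (fun x k => σ.A aAdj (x * n + k)) (Γ.deleteEdges {s(u, v)})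
        h cap u v (scaleAt n i σ) (scaleAt n i σ') j ∧
      Tm' + treePot n (σ.A aDeg) cap ((scaleAt n i σ').lab j) ((scaleAt n i σ').ptr j) ≤
        Tm + treePot n (σ.A aDeg) cap ((scaleAt n i σ).lab j) ((scaleAt n i σ).ptr j) + 1000 := by
  have h16 := hw.out
  have hw0 : w ≠ 0 := by rintro rfl; simp at h16
  have hX := hst.addr
  have hnX : n ≤ X := (Nat.le_mul_self n).trans hst.sq_le
  obtain ⟨b1, b2, b3, b4⟩ := tree_index_le hsc.index_le (by omega) hj.le
  have hpot := hsc.pot_le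
  have hcapX := hsc.cap_le
  have eN := hst.regN
  have eH := hsc.regH
  have eC := hsc.regCap
  have eT := hsc.regTb
  obtain ⟨τ, hτ⟩ : ∃ τ, i * (n + 1) + j = τ := ⟨_, rfl⟩
  obtain ⟨r, hr⟩ : ∃ r, σ.A aRoot τ = r := ⟨_, rfl⟩
  simp only [scaleAt_root, scaleAt_lab, scaleAt_ptr, scaleAt_cnt, hτ, hr] at hrn htree hcnt b1 b2 ⊢
  have hT : τ * n < X := by omega
  have hdeg := hst.net.deg_le
  have hlp : ∀ lab, labelPot n (σ.A aDeg) cap lab + n + 3 ≤ X := fun lab => by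
    have := labelPot_le (cap := cap) (lab := lab) hdeg; omega
  -- the part after the choice of the root
  have key : ∀ (σ₁ : State) (Tm₁ : ℕ), (∀ q, q ≠ rTau → q ≠ rT → q ≠ rRoot → q ≠ rSp →
        σ₁.reg q = σ.reg q) → σ₁.reg rTau = τ → σ₁.reg rT = τ * n →
      (∀ k < 16, k ≠ aStack → k ≠ aRoot → σ₁.A k = σ.A k) →
      (∀ z, z ≠ τ → σ₁.A aRoot z = σ.A aRoot z) → σ₁.A aRoot τ = σ₁.reg rRoot →
      σ₁.reg rRoot = ScaleData.newRoot n (Γ.deleteEdges {s(u, v)}) h u v r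
        (fun x => σ.A aLab (τ * n + x)) →
      σ₁.reg rSp ≤ 1 → (∀ s < σ₁.reg rSp, σ₁.A aStack s < n) →
      (r ≠ σ₁.reg rRoot → r < n → σ₁.reg rSp = 1 ∧ σ₁.A aStack 0 = r) → Tm₁ ≤ Tm + 300 →
      Run w (setArr aStack (reg rSp) (reg rU) ;; rSp ::= reg rSp + const 1 ;;
        setArr aStack (reg rSp) (reg rV) ;; rSp ::= reg rSp + const 1 ;; repair) σ₁ Tm₁
        fun σ' Tm' => TreeFrame n τ σ σ' ∧
          ScaleData.TreeStep n (σ.A aDeg) (fun x k => σ.A aAdj (x * n + k))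
            (Γ.deleteEdges {s(u, v)}) h cap u v (scaleAt n i σ) (scaleAt n i σ') j ∧
          Tm' + treePot n (σ.A aDeg) cap (fun x => σ'.A aLab (τ * n + x))
              (fun x => σ'.A aPtr (τ * n + x)) ≤
            Tm + treePot n (σ.A aDeg) cap (fun x => σ.A aLab (τ * n + x))
              (fun x => σ.A aPtr (τ * n + x)) + 1000 := by
    intro σ₁ Tm₁ r1 r2 r3 a1 a2 a3 hnew hsp hstk hold htm
    have e1 := r1 rN (by decide) (by decide) (by decide) (by decide)
    have e2 := r1 31 (by decide) (by decide) (by decide) (by decide)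
    have e3 := r1 rU (by decide) (by decide) (by decide) (by decide)
    have e4 := r1 rV (by decide) (by decide) (by decide) (by decide)
    have e5 := r1 rCap (by decide) (by decide) (by decide) (by decide)
    have f0 := a1 aAdj (by decide) (by decide) (by decide)
    have f1 := a1 aDeg (by decide) (by decide) (by decide)
    have f2 := a1 aAlive (by decide) (by decide) (by decide)
    have f3 := a1 aLab (by decide) (by decide) (by decide)
    have f4 := a1 aPtr (by decide) (by decide) (by decide)
    have f6 := a1 aCnt (by decide) (by decide) (by decide)
    simp [e1, e2, e3, e4, hU, hV, and_assoc]
    repeat refine And.intro (by omega) ?_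
    refine (run_repair (w := w) (n := n) (X := X) (T := τ * n) (cap := cap) (r := σ₁.reg rRoot)
      (τ := τ) (Γ := Γ.deleteEdges {s(u, v)}) ?_ hst.sq_le b1 b2 hcapX ?_ ?_ ?_ ?_ ?_ ?_ ?_ ?_ ?_ ?_
      ?_).mono ?_
    · simpa [e2] using hX
    · simp [e1, eN]
    · simp [r3]
    · simp [e5, eC]
    · simp
    · simp [r2]
    · intro x hx y hy
      simpa [f2] using hst.alive x hx y hy
    · simpa [f0, f1] using hst.net
    · have := htree.delete (r' := σ₁.reg rRoot) (u := u) (v := v)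
        (st := fun x => x = u ∨ x = v ∨ (∃ s < σ₁.reg rSp, σ₁.A aStack s = x) ∨ n ≤ x)
        (by tauto) (by
          intro hne
          by_cases hrn' : r < n
          · obtain ⟨h1, h2⟩ := hold hne hrn'
            exact .inr (.inr (.inl ⟨0, by omega, h2⟩))
          · exact .inr (.inr (.inr (by omega))))
      simp [f0, f1, f3, f4, State.A_setA_same]
      refine ⟨this.lip, this.scanned, this.ptr_le, this.lab_le, fun x hx hxr hl hs =>
        this.settled x hx hxr hl fun hs' => hs ?_⟩
      rcases hs' with rfl | rfl | ⟨s, hs1, hs2⟩ | hs'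
      · exact ⟨σ₁.reg rSp, by omega, by simp⟩
      · exact ⟨σ₁.reg rSp + 1, by omega, by simp⟩
      · exact ⟨s, by omega, by rw [if_neg (by omega), if_neg (by omega)]; exact hs2⟩
      · omega
    · intro s hs
      simp [State.A_setA_same] at hs ⊢
      split_ifs with h1 h2
      · exact hv
      · exact hu
      · exact hstk s (by omega)
    · simpa [f6, f3] using hcnt
    · have := hlp (fun x => σ.A aLab (τ * n + x))
      simp [f1, f3]
      omega
    simp [f1, f3, f4]
    intro σ' T' g1 g2 g3
    have hAlab : ∀ z, z < τ * n ∨ τ * n + n ≤ z →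
        σ'.A aLab z = σ.A aLab z ∧ σ'.A aPtr z = σ.A aPtr z := by
      intro z hz
      have := g1.block z hz
      simpa [f3, f4] using this
    have hroot' : ∀ z, σ'.A aRoot z = σ₁.A aRoot z := by
      intro z
      have := congrFun (g1.arrs aRoot (by decide) (by decide) (by decide) (by decide) (by decide)) z
      simpa using this
    refine ⟨⟨?_, ?_, hAlab, ?_, ?_⟩, ⟨?_, ?_, ?_, ?_, ?_⟩, by omega⟩
    · intro q h1 h2 h3 h4 h5 h6 h7
      rw [g1.regs q h4 h5 h6 h7]
      simp [h4, r1 q h1 h2 h3 h4]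
    · intro k hk h1 h2 h3 h4 h5
      rw [g1.arrs k hk h1 h2 h3 h4]
      funext z
      simp [hk, h4, a1 k hk h4 h5]
    · intro z hz
      rw [hroot', a2 z hz]
    · intro z hz
      rw [g1.cnt_ne z hz]
      simp [f6]
    · have := g1.inv.weaken (st' := fun _ => False) (by rintro x ⟨s, hs, -⟩; omega)
      simpa [scaleAt, hτ, hroot', a3, f0, f1] using this
    · have := g1.cnt
      simpa [scaleAt, hτ] using this
    · intro x hx
      have := g1.mono x hx
      simpa [scaleAt, hτ, f3] using this
    · simpa [scaleAt, hτ, hroot', a3, hr] using hnew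
    · intro hlt
      simp only [scaleAt, hτ, hroot', a3] at hlt ⊢
      have := g1.root hlt
      simpa [f3] using this
  -- the choice of the root
  have hbr : (r = n ∨ h < csize n (Γ.deleteEdges {s(u, v)}) r) ∧ σ.A aBig r = 1 ∨
      ¬ (r = n ∨ h < csize n (Γ.deleteEdges {s(u, v)}) r) ∧ σ.A aBig r = 0 := by
    rcases Nat.eq_or_lt_of_le hrn with rfl | hlt
    · exact .inl ⟨.inl rfl, hbig.none⟩
    · rcases hbig.big r hlt with h1 | h1
      · exact .inl ⟨.inr h1.1, h1.2⟩
      · exact .inr ⟨by omega, h1.2⟩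
  rw [treeStep]
  generalize (setArr aStack (reg rSp) (reg rU) ;; rSp ::= reg rSp + const 1 ;;
    setArr aStack (reg rSp) (reg rV) ;; rSp ::= reg rSp + const 1 ;; repair) = tail at key ⊢
  simp [eT, hJ, eN, hτ, hr, and_assoc]
  repeat refine And.intro (by omega) ?_
  rcases hbr with ⟨hb1, hb2⟩ | ⟨hb1, hb2⟩
  · simp [hb2]
    refine key _ _ ?_ ?_ ?_ ?_ ?_ ?_ ?_ ?_ ?_ ?_ ?_
    · intro q h1 h2 h3 h4; simp [h1, h2, h3, h4]
    · simp
    · simp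
    · intro k hk h1 h2; simp
    · simp
    · simp [hr]
    · simp [ScaleData.newRoot, hb1]
    · simp
    · simp
    · simp
    · omega
  · have hrlt : r < n := by omega
    obtain ⟨b, hb⟩ : ∃ b, ScaleData.largeEnd n (Γ.deleteEdges {s(u, v)}) h u v = b := ⟨_, rfl⟩
    have hbn : b < n := by
      rw [← hb, ScaleData.largeEnd]; split_ifs <;> assumption
    obtain ⟨β, hβ⟩ : ∃ β, σ.A aBig u = β ∧ (β ≠ 0 → b = u) ∧ (β = 0 → b = v) := by
      refine ⟨_, rfl, ?_⟩
      rw [← hb, ScaleData.largeEnd]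
      rcases hbig.big u hu with h1 | h1
      · simp [h1.1, h1.2]
      · simp [h1.2, not_lt.2 h1.1]
    obtain ⟨γ, hγ⟩ : ∃ γ, σ.A aBig b = γ := ⟨_, rfl⟩
    have hγ1 : γ ≤ 1 := by
      rcases hbig.big b hbn with h1 | h1 <;> omega
    have hnew : ScaleData.newRoot n (Γ.deleteEdges {s(u, v)}) h u v r
        (fun x => σ.A aLab (τ * n + x)) =
        if γ = 0 ∨ h < σ.A aLab (τ * n + b) then n else b := by
      rw [ScaleData.newRoot, if_neg hb1, hb]
      rcases hbig.big b hbn with h1 | h1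
      · rw [← hγ, h1.2]
        simp only [h1.1, true_and, one_ne_zero, false_or, ← not_le, ite_not]
      · rw [← hγ, h1.2]
        simp [not_lt.2 h1.1]
    have hprod : γ * (if σ.A aLab (τ * n + b) < h + 1 then 1 else 0) < 2 ^ w := by
      split_ifs <;> omega
    have hlabc := htree.lab_le b hbn
    have hhX := hsc.radius_le
    simp only [hb2, moveRoot, run_ite, run_seq, run_assign, run_setArr, Nat.reduceLT]
    simp [eN, eH, hU, hV, hβ.1, and_assoc]
    repeat refine And.intro (by omega) ?_
    constructor
    · intro h0
      obtain rfl := hβ.2.1 h0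
      have hβγ : β = γ := hβ.1.symm.trans hγ
      repeat refine And.intro (by first | omega | (split_ifs <;> omega)) ?_
      constructor
      all_goals
        intro h1
        try intro h2
        refine And.intro (by omega) ?_
        refine key _ _ ?_ ?_ ?_ ?_ ?_ ?_ ?_ ?_ ?_ ?_ ?_
        · intro q h1 h2 h3 h4; simp [h1, h2, h3, h4]
        · simp
        · simp
        · intro k hk h1 h2; simp [hk, h1, h2]
        · intro z hz; simp [State.A_setA_same, hz]
        · simp
        · simp only [State.reg_setA, State.reg_setReg_same]
          rw [hnew]
          split_ifs with h3 <;> first | rfl | (exfalso; omega)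
        · simp
        · simp [hrlt]
        · simp
        · omega
    · intro h0
      obtain rfl := hβ.2.2 h0
      repeat refine And.intro (by first | omega | (split_ifs <;> omega)) ?_
      constructor
      all_goals
        intro h1
        try intro h2
        refine And.intro (by omega) ?_
        refine key _ _ ?_ ?_ ?_ ?_ ?_ ?_ ?_ ?_ ?_ ?_ ?_
        · intro q h1 h2 h3 h4; simp [h1, h2, h3, h4]
        · simp
        · simp
        · intro k hk h1 h2; simp [hk, h1, h2]
        · intro z hz; simp [State.A_setA_same, hz]
        · simp
        · simp only [State.reg_setA, State.reg_setReg_same]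
          rw [hnew]
          split_ifs with h3 <;> first | rfl | (exfalso; omega)
        · simp
        · simp [hrlt]
        · simp
        · omega

/-- The time for opening a centre is paid by the potential of a tree with all labels `0`, up to a linear
term. -/
theorem run_openTree {z c : ℕ}
    (hst : Static w n X Γ σ) (hsc : AtScale n X i h cap σ)
    (hZ : σ.reg rZ = z) (hz : z < n) (hC : σ.reg rC = c) (hc : c ≤ n)
    (hfresh : ∀ x < n, (scaleAt n i σ).lab c x = 0 ∧ (scaleAt n i σ).ptr c x = 0) :
    Run w openTree σ Tm fun σ' Tm' => TreeFrame n (i * (n + 1) + c) σ σ' ∧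
      TreeInv n (σ.A aDeg) (fun x k => σ.A aAdj (x * n + k)) Γ cap z ((scaleAt n i σ').lab c)
        ((scaleAt n i σ').ptr c) (fun _ => False) ∧
      (scaleAt n i σ').root c = z ∧ (scaleAt n i σ').lab c z = 0 ∧
      (scaleAt n i σ').cnt c = inCount n cap ((scaleAt n i σ').lab c) ∧
      Tm' + treePot n (σ.A aDeg) cap ((scaleAt n i σ').lab c) ((scaleAt n i σ').ptr c) ≤
        Tm + treePot n (σ.A aDeg) cap (fun _ => 0) (fun _ => 0) + 200 * n + 1000 := by
  have h16 := hw.out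
  have hw0 : w ≠ 0 := by rintro rfl; simp at h16
  have hX := hst.addr
  have hnX : n ≤ X := (Nat.le_mul_self n).trans hst.sq_le
  obtain ⟨b1, b2, b3, b4⟩ := tree_index_le hsc.index_le (by omega) hc
  have hpot := hsc.pot_le
  have hcapX := hsc.cap_le
  have eN := hst.regN
  have eC := hsc.regCap
  have eT := hsc.regTb
  obtain ⟨τ, hτ⟩ : ∃ τ, i * (n + 1) + c = τ := ⟨_, rfl⟩
  simp only [scaleAt_root, scaleAt_lab, scaleAt_ptr, scaleAt_cnt, hτ] at hfresh b1 b2 ⊢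
  have hT : τ * n < X := by omega
  have hdeg := hst.net.deg_le
  simp only [openTree, run_seq, run_assign, run_setArr, Nat.reduceLT]
  simp [eT, hC, eN, hτ, hZ, and_assoc]
  repeat refine And.intro (by omega) ?_
  generalize hσ₁ : ((((((σ.setReg rTau τ).setReg rT (τ * n)).setReg rRoot z).setA aRoot τ z).setA
    aCnt τ n).setReg rSp 0) = σ₁
  have hreg₁ : ∀ q, q ≠ rTau → q ≠ rT → q ≠ rRoot → q ≠ rSp → σ₁.reg q = σ.reg q := by
    intro q h1 h2 h3 h4; simp [← hσ₁, h1, h2, h3, h4]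
  have htau₁ : σ₁.reg rTau = τ := by simp [← hσ₁]
  have ht₁ : σ₁.reg rT = τ * n := by simp [← hσ₁]
  have hr₁ : σ₁.reg rRoot = z := by simp [← hσ₁]
  have hs₁ : σ₁.reg rSp = 0 := by simp [← hσ₁]
  have hA₁ : ∀ k < 16, k ≠ aRoot → k ≠ aCnt → σ₁.A k = σ.A k := by
    intro k hk h1 h2; simp [← hσ₁, hk, h1, h2]
  have hroot₁ : ∀ y, σ₁.A aRoot y = if y = τ then z else σ.A aRoot y := by
    intro y; simp [← hσ₁, State.A_setA_same]
  have hcnt₁ : ∀ y, σ₁.A aCnt y = if y = τ then n else σ.A aCnt y := by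
    intro y; simp [← hσ₁, State.A_setA_same]
  clear hσ₁
  refine run_while (fun σ₂ T₂ => (∀ q, q ≠ rSp → σ₂.reg q = σ₁.reg q) ∧
      (∀ k < 16, k ≠ aStack → σ₂.A k = σ₁.A k) ∧ σ₂.reg rSp ≤ n ∧
      (∀ s < σ₂.reg rSp, σ₂.A aStack s = s) ∧ T₂ + 40 * (n - σ₂.reg rSp) ≤ Tm + 200 + 40 * n)
    (Tm + 200 + 40 * n) (by intros; omega) ?_ ?_ ?_ ?_
  · intro σ₂ T₂ _; simp
  · rintro σ₂ T₂ ⟨g1, g2, g3, g4, g5⟩ hcond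
    have e1 := g1 rN (by decide)
    have e2 := g1 31 (by decide)
    have e3 := hreg₁ rN (by decide) (by decide) (by decide) (by decide)
    have e4 := hreg₁ 31 (by decide) (by decide) (by decide) (by decide)
    simp [e1, e3, eN] at hcond
    simp [e2, e4, and_assoc]
    repeat refine And.intro (by omega) ?_
    refine ⟨?_, ?_, by omega, ?_, by omega⟩
    · intro q hq; simp [hq, g1]
    · intro k hk h1; simp [hk, h1, g2]
    · intro s hs
      rw [State.A_setA_same]
      split_ifs with h1
      · exact h1.symm
      · exact g4 s (by omega)
  · rintro σ₂ T₂ ⟨g1, g2, g3, g4, g5⟩ hcond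
    have e1 := g1 rN (by decide)
    have e2 := g1 31 (by decide)
    have e3 := hreg₁ rN (by decide) (by decide) (by decide) (by decide)
    have e4 := hreg₁ 31 (by decide) (by decide) (by decide) (by decide)
    have e5 := hreg₁ rCap (by decide) (by decide) (by decide) (by decide)
    simp [e1, e3, eN] at hcond
    have hsp : σ₂.reg rSp = n := by omega
    have f0 := (g2 aAdj (by decide) (by decide)).trans (hA₁ aAdj (by decide) (by decide) (by decide))
    have f1 := (g2 aDeg (by decide) (by decide)).trans (hA₁ aDeg (by decide) (by decide) (by decide))
    have f2 := (g2 aAlive (by decide) (by decide)).trans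
      (hA₁ aAlive (by decide) (by decide) (by decide))
    have f3 := (g2 aLab (by decide) (by decide)).trans (hA₁ aLab (by decide) (by decide) (by decide))
    have f4 := (g2 aPtr (by decide) (by decide)).trans (hA₁ aPtr (by decide) (by decide) (by decide))
    have f5 := g2 aRoot (by decide) (by decide)
    have f6 := g2 aCnt (by decide) (by decide)
    have hl0 : ∀ x < n, σ₂.A aLab (τ * n + x) = 0 := fun x hx => by rw [f3]; exact (hfresh x hx).1
    have hp0 : ∀ x < n, σ₂.A aPtr (τ * n + x) = 0 := fun x hx => by rw [f4]; exact (hfresh x hx).2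
    have hlp := labelPot_le (lab := fun x => σ₂.A aLab (τ * n + x)) (cap := cap) hdeg
    refine (run_repair (w := w) (n := n) (X := X) (T := τ * n) (cap := cap) (r := z)
      (τ := τ) (Γ := Γ) ?_ hst.sq_le b1 b2 hcapX ?_ ?_ ?_ ?_ ?_ ?_ ?_ ?_ ?_ ?_ ?_).mono ?_
    · rw [e2, e4]; exact hX
    · rw [e1, e3]; exact eN
    · rw [g1 _ (by decide)]; exact ht₁
    · rw [g1 _ (by decide), e5]; exact eC
    · rw [g1 _ (by decide)]; exact hr₁
    · rw [g1 _ (by decide)]; exact htau₁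
    · rw [AliveRep, f2]; exact hst.alive
    · rw [f0, f1]; exact hst.net
    · refine ⟨fun x y hxy => ?_, fun x hx k hk => ?_, fun x hx => ?_, fun x hx => ?_,
        fun x hx _ _ hns => absurd ⟨x, by omega, g4 x (by omega)⟩ hns⟩
      · rw [hl0 x (hst.net.mem_adj x y hxy).1]; omega
      · rw [hp0 x hx] at hk; omega
      · rw [hp0 x hx]; omega
      · rw [hl0 x hx]; omega
    · intro s hs; rw [g4 s hs]; omega
    · rw [f6, hcnt₁, if_pos rfl, inCount, filter_true_of_mem, card_range]
      intro x hx
      rw [hl0 x (mem_range.1 hx)]; omega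
    · rw [f1]; omega
    rintro σ' T' ⟨⟨k1, k2, k3, k4, k5, k6, k7, k8, k9⟩, m1, m2⟩
    have n5 := k2 aRoot (by decide) (by decide) (by decide) (by decide) (by decide)
    have hpot0 : treePot n (σ.A aDeg) cap (fun x => σ₂.A aLab (τ * n + x))
        (fun x => σ₂.A aPtr (τ * n + x)) = treePot n (σ.A aDeg) cap (fun _ => 0) (fun _ => 0) :=
      treePot_congr hl0 hp0
    rw [f1, hpot0] at m2
    refine ⟨⟨?_, ?_, ?_, ?_, ?_⟩, ?_, ?_, ?_, k7, ?_⟩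
    · intro q h1 h2 h3 h4 h5 h6 h7
      rw [k1 q h4 h5 h6 h7, g1 q h4, hreg₁ q h1 h2 h3 h4]
    · intro k hk h1 h2 h3 h4 h5
      rw [k2 k hk h1 h2 h3 h4, g2 k hk h4, hA₁ k hk h5 h3]
    · intro y hy
      have := k3 y hy
      rwa [f3, f4] at this
    · intro y hy; rw [n5, f5, hroot₁, if_neg hy]
    · intro y hy; rw [k4 y hy, f6, hcnt₁, if_neg hy]
    · rw [f0, f1] at k5
      exact k5.weaken (by rintro x ⟨s, hs, -⟩; omega)
    · rw [n5, f5, hroot₁, if_pos rfl]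
    · rw [k9 hz, hl0 z hz]
    · simp only [cost_lt, cost_reg] at m2 ⊢
      omega
  · exact ⟨fun _ _ => rfl, fun _ _ _ => rfl, by omega, by intro s hs; omega, by omega⟩

end DecrementalAPSP

namespace DecrementalAPSP
open WordRAM Finset Expr Cmd

/-! ### The update of one scale -/

/-- Update all trees of the current scale. -/
def updateTrees : Cmd :=
  rJ ::= const 0 ;;
  .while (lt (reg rJ) (arr aNum (reg rI))) (treeStep ;; rJ ::= reg rJ + const 1)

/-- Advance the pointer of the vertex `rZ` to the first centre that covers it. As labels never decrease,
the centres that were passed once need not be considered again. -/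
def coverScan : Cmd :=
  rC ::= arr aCov (reg rCb + reg rZ) ;;
  .while (lt (reg rC) (arr aNum (reg rI)) *
      lt (reg rH + reg rH) (arr aLab ((reg rTb + reg rC) * reg rN + reg rZ)))
    (rC ::= reg rC + const 1) ;;
  setArr aCov (reg rCb + reg rZ) (reg rC)

/-- If the vertex `rZ` is not covered but lies in a large component, open a centre at `rZ`. -/
def coverOpen : Cmd :=
  .ite (lt (reg rC) (arr aNum (reg rI))) .skip
    (.ite (arr aBig (reg rZ)) (openTree ;; setArr aNum (reg rI) (reg rC + const 1)) .skip)

/-- Find or open a centre that covers the vertex `rZ`, and set the flag of `rZ` for the next scale. -/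
def coverStep : Cmd :=
  coverScan ;;
  coverOpen ;;
  setArr aBig (reg rZ)
    (lt (reg rC) (arr aNum (reg rI)) * lt (reg rHn) (arr aCnt (reg rTb + reg rC)))

/-- Find or open covering centres for all vertices of the current scale. -/
def updateCover : Cmd :=
  rZ ::= const 0 ;;
  .while (lt (reg rZ) (reg rN)) (coverStep ;; rZ ::= reg rZ + const 1)

/-- From `σ` to `σ'`, only the data of the scale `i`, the flags and auxiliary registers were
changed. -/
structure ScaleFrame (n i : ℕ) (σ σ' : State) : Prop where
  regs : ∀ q, q ≠ rJ → q ≠ rTau → q ≠ rT → q ≠ rRoot → q ≠ rSp → q ≠ rX → q ≠ rK → q ≠ rY →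
    q ≠ rZ → q ≠ rC → σ'.reg q = σ.reg q
  arrs : ∀ k < 16, k ≠ aLab → k ≠ aPtr → k ≠ aCnt → k ≠ aStack → k ≠ aRoot → k ≠ aCov →
    k ≠ aNum → k ≠ aBig → σ'.A k = σ.A k
  block : ∀ z, z < i * (n + 1) * n ∨ (i * (n + 1) + (n + 1)) * n ≤ z →
    σ'.A aLab z = σ.A aLab z ∧ σ'.A aPtr z = σ.A aPtr z
  tree : ∀ z, z < i * (n + 1) ∨ i * (n + 1) + (n + 1) ≤ z →
    σ'.A aRoot z = σ.A aRoot z ∧ σ'.A aCnt z = σ.A aCnt z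
  cov : ∀ z, z < i * n ∨ i * n + n ≤ z → σ'.A aCov z = σ.A aCov z
  num : ∀ z, z ≠ i → σ'.A aNum z = σ.A aNum z

theorem ScaleFrame.refl (n i : ℕ) (σ : State) : ScaleFrame n i σ σ :=
  ⟨fun _ _ _ _ _ _ _ _ _ _ _ => rfl, fun _ _ _ _ _ _ _ _ _ _ => rfl, fun _ _ => ⟨rfl, rfl⟩,
    fun _ _ => ⟨rfl, rfl⟩, fun _ _ => rfl, fun _ _ => rfl⟩

theorem ScaleFrame.trans {n i : ℕ} {σ σ' σ'' : State} (h : ScaleFrame n i σ σ')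
    (h' : ScaleFrame n i σ' σ'') : ScaleFrame n i σ σ'' where
  regs q h1 h2 h3 h4 h5 h6 h7 h8 h9 h10 :=
    (h'.regs q h1 h2 h3 h4 h5 h6 h7 h8 h9 h10).trans (h.regs q h1 h2 h3 h4 h5 h6 h7 h8 h9 h10)
  arrs k hk h1 h2 h3 h4 h5 h6 h7 h8 :=
    (h'.arrs k hk h1 h2 h3 h4 h5 h6 h7 h8).trans (h.arrs k hk h1 h2 h3 h4 h5 h6 h7 h8)
  block z hz := ⟨(h'.block z hz).1.trans (h.block z hz).1, (h'.block z hz).2.trans (h.block z hz).2⟩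
  tree z hz := ⟨(h'.tree z hz).1.trans (h.tree z hz).1, (h'.tree z hz).2.trans (h.tree z hz).2⟩
  cov z hz := (h'.cov z hz).trans (h.cov z hz)
  num z hz := (h'.num z hz).trans (h.num z hz)

theorem TreeFrame.scaleFrame {n i j : ℕ} {σ σ' : State} (h : TreeFrame n (i * (n + 1) + j) σ σ')
    (hj : j ≤ n) : ScaleFrame n i σ σ' where
  regs q _ h2 h3 h4 h5 h6 h7 h8 _ _ := h.regs q h2 h3 h4 h5 h6 h7 h8
  arrs k hk h1 h2 h3 h4 h5 _ _ _ := h.arrs k hk h1 h2 h3 h4 h5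
  block z hz := h.block z <| by
    have h1 : (i * (n + 1) + j) * n + n ≤ (i * (n + 1) + (n + 1)) * n := by nlinarith
    have h2 : i * (n + 1) * n ≤ (i * (n + 1) + j) * n := Nat.mul_le_mul_right _ (by omega)
    omega
  tree z hz := ⟨h.root_ne z (by omega), h.cnt_ne z (by omega)⟩
  cov z _ := congrFun (h.arrs aCov (by decide) (by decide) (by decide) (by decide) (by decide)
    (by decide)) z
  num z _ := congrFun (h.arrs aNum (by decide) (by decide) (by decide) (by decide) (by decide)
    (by decide)) z

theorem block_disjoint {n τ τ' x : ℕ} (hne : τ' ≠ τ) (hx : x < n) :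
    τ' * n + x < τ * n ∨ τ * n + n ≤ τ' * n + x := by
  rcases Nat.lt_or_gt_of_ne hne with h | h
  · left; nlinarith
  · right; nlinarith

theorem TreeFrame.other {n i j j' : ℕ} {σ σ' : State} (h : TreeFrame n (i * (n + 1) + j) σ σ')
    (hne : j' ≠ j) : (scaleAt n i σ').root j' = (scaleAt n i σ).root j' ∧
      (scaleAt n i σ').cnt j' = (scaleAt n i σ).cnt j' ∧
      ∀ x < n, (scaleAt n i σ').lab j' x = (scaleAt n i σ).lab j' x ∧
        (scaleAt n i σ').ptr j' x = (scaleAt n i σ).ptr j' x :=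
  ⟨h.root_ne _ (by omega), h.cnt_ne _ (by omega), fun x hx =>
    h.block _ (block_disjoint (by omega) hx)⟩

theorem TreeFrame.cov {n τ i : ℕ} {σ σ' : State} (h : TreeFrame n τ σ σ') :
    (scaleAt n i σ').cov = (scaleAt n i σ).cov := by
  funext x
  exact congrFun (h.arrs aCov (by decide) (by decide) (by decide) (by decide) (by decide)
    (by decide)) _

section
variable {w n X i h cap : ℕ} {Γ Γ' : SimpleGraph ℕ} {σ σ' : State}

theorem ScaleFrame.static (hf : ScaleFrame n i σ σ') (h : Static w n X Γ σ) :
    Static w n X Γ σ' := by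
  refine h.transfer ?_ ?_ ?_ ?_ ?_
  · exact hf.regs _ (by decide) (by decide) (by decide) (by decide) (by decide) (by decide)
      (by decide) (by decide) (by decide) (by decide)
  · exact hf.regs _ (by decide) (by decide) (by decide) (by decide) (by decide) (by decide)
      (by decide) (by decide) (by decide) (by decide)
  all_goals
    exact hf.arrs _ (by decide) (by decide) (by decide) (by decide) (by decide) (by decide)
      (by decide) (by decide) (by decide)

theorem AtScale.transfer (hs : AtScale n X i h cap σ)
    (hr : ∀ q, 25 ≤ q → q ≤ 29 → σ'.reg q = σ.reg q) : AtScale n X i h cap σ' :=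
  ⟨hs.index_le, hs.pot_le, hs.cap_le, hs.radius_le,
    (hr _ (by decide) (by decide)).trans hs.regI, (hr _ (by decide) (by decide)).trans hs.regH,
    (hr _ (by decide) (by decide)).trans hs.regCap, (hr _ (by decide) (by decide)).trans hs.regTb,
    (hr _ (by decide) (by decide)).trans hs.regCb⟩

theorem ScaleFrame.atScale (hf : ScaleFrame n i σ σ') (hs : AtScale n X i h cap σ) :
    AtScale n X i h cap σ' :=
  hs.transfer fun q h1 h2 => hf.regs q (by omega) (by omega) (by omega) (by omega) (by omega)
    (by omega) (by omega) (by omega) (by omega) (by omega)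

end

namespace ScaleData

/-- Only the labels of vertices below `n` matter. -/
theorem newRoot_congr {n : ℕ} {Γ' : SimpleGraph ℕ} {h u v r : ℕ} {lab lab' : ℕ → ℕ}
    (hu : u < n) (hv : v < n) (hl : ∀ x < n, lab' x = lab x) :
    newRoot n Γ' h u v r lab' = newRoot n Γ' h u v r lab := by
  have hb : largeEnd n Γ' h u v < n := by rw [largeEnd]; split_ifs <;> assumption
  rw [newRoot, newRoot, hl _ hb]

/-- The potential of a scale. It pays for the trees, for all centres that may still be opened, and
for the search for covering centres. -/
def pot (n : ℕ) (deg : ℕ → ℕ) (h cap : ℕ) (d : ScaleData) : ℕ :=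
  ∑ j ∈ range d.num, treePot n deg cap (d.lab j) (d.ptr j) +
    (n / (h + 1) - d.num) * (treePot n deg cap (fun _ => 0) (fun _ => 0) + 200 * n + 2000) +
    100 * ∑ x ∈ range n, (n / (h + 1) - d.cov x)

/-- The vertex `x` is covered by the centre to which it points. -/
def Covered (d : ScaleData) (h x : ℕ) : Prop :=
  d.cov x < d.num ∧ d.lab (d.cov x) x ≤ 2 * h

end ScaleData

variable {w : ℕ} [hw : Fact (16 < 2 ^ w)] {n X i h cap : ℕ} {Γ : SimpleGraph ℕ} {σ : State} {Tm : ℕ}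

/-- The trees of a scale are updated in a time that is paid by the potential, up to `O(n)`; there are at
most `n` centres. -/
theorem run_updateTrees {u v : ℕ}
    (hst : Static w n X (Γ.deleteEdges {s(u, v)}) σ) (hsc : AtScale n X i h cap σ)
    (hnet : Net n (σ.A aDeg) (fun x k => σ.A aAdj (x * n + k)) Γ)
    (hbig : BigRep n (Γ.deleteEdges {s(u, v)}) h σ)
    (hu : u < n) (hv : v < n) (hU : σ.reg rU = u) (hV : σ.reg rV = v)
    (H : (scaleAt n i σ).Inv n (σ.A aDeg) (fun x k => σ.A aAdj (x * n + k)) Γ h cap) :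
    Run w updateTrees σ Tm fun σ' Tm' => ScaleFrame n i σ σ' ∧ σ'.A aBig = σ.A aBig ∧
      (scaleAt n i σ').Inv n (σ.A aDeg) (fun x k => σ.A aAdj (x * n + k))
        (Γ.deleteEdges {s(u, v)}) h cap ∧
      Tm' + (scaleAt n i σ').pot n (σ.A aDeg) h cap ≤
        Tm + (scaleAt n i σ).pot n (σ.A aDeg) h cap + 2000 * n + 100 := by
  have h16 := hw.out
  have hX := hst.addr
  have hnX : n ≤ X := (Nat.le_mul_self n).trans hst.sq_le
  obtain ⟨b1, b2, b3, b4⟩ := tree_index_le hsc.index_le (by omega) (Nat.zero_le n)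
  have hNn := H.num_le hnet
  generalize hN : (scaleAt n i σ).num = N at *
  have hN' : σ.A aNum i = N := hN
  simp only [updateTrees, run_seq, run_assign]
  refine ⟨by simp, ?_⟩
  -- the trees below `rJ` are updated, and the other ones are unchanged
  refine run_while (fun σ₁ T₁ => (∀ q, q ≠ rJ → q ≠ rTau → q ≠ rT → q ≠ rRoot → q ≠ rSp → q ≠ rX →
        q ≠ rK → q ≠ rY → σ₁.reg q = σ.reg q) ∧
      (∀ k < 16, k ≠ aLab → k ≠ aPtr → k ≠ aCnt → k ≠ aStack → k ≠ aRoot → σ₁.A k = σ.A k) ∧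
      ScaleFrame n i σ σ₁ ∧ σ₁.reg rJ ≤ N ∧
      (∀ j < σ₁.reg rJ, ScaleData.TreeStep n (σ.A aDeg) (fun x k => σ.A aAdj (x * n + k))
        (Γ.deleteEdges {s(u, v)}) h cap u v (scaleAt n i σ) (scaleAt n i σ₁) j) ∧
      (∀ j, σ₁.reg rJ ≤ j → (scaleAt n i σ₁).root j = (scaleAt n i σ).root j ∧
        (scaleAt n i σ₁).cnt j = (scaleAt n i σ).cnt j ∧
        ∀ x < n, (scaleAt n i σ₁).lab j x = (scaleAt n i σ).lab j x ∧
          (scaleAt n i σ₁).ptr j x = (scaleAt n i σ).ptr j x) ∧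
      T₁ + ∑ j ∈ range N, treePot n (σ.A aDeg) cap ((scaleAt n i σ₁).lab j)
          ((scaleAt n i σ₁).ptr j) + 2000 * (N - σ₁.reg rJ) ≤
        Tm + ∑ j ∈ range N, treePot n (σ.A aDeg) cap ((scaleAt n i σ).lab j)
          ((scaleAt n i σ).ptr j) + 2000 * N + 50)
    (Tm + ∑ j ∈ range N, treePot n (σ.A aDeg) cap ((scaleAt n i σ).lab j)
          ((scaleAt n i σ).ptr j) + 2000 * N + 50) (by intros; omega) ?_ ?_ ?_ ?_
  · rintro σ₁ T₁ ⟨g1, g2, -⟩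
    have e1 := g1 rI (by decide) (by decide) (by decide) (by decide) (by decide) (by decide)
      (by decide) (by decide)
    have e2 := g1 31 (by decide) (by decide) (by decide) (by decide) (by decide) (by decide)
      (by decide) (by decide)
    simp [e1, e2, hsc.regI]
    omega
  · rintro σ₁ T₁ ⟨g1, g2, g3, g4, g5, g6, g7⟩ hc
    have hg1 : ∀ q, 20 ≤ q → σ₁.reg q = σ.reg q := fun q hq =>
      g1 q (by omega) (by omega) (by omega) (by omega) (by omega) (by omega) (by omega) (by omega)
    have e1 := hg1 rI (by decide)
    have f8 := g2 aNum (by decide) (by decide) (by decide) (by decide) (by decide) (by decide)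
    have f12 := g2 aBig (by decide) (by decide) (by decide) (by decide) (by decide) (by decide)
    have f0 := g2 aAdj (by decide) (by decide) (by decide) (by decide) (by decide) (by decide)
    have f1 := g2 aDeg (by decide) (by decide) (by decide) (by decide) (by decide) (by decide)
    obtain ⟨j, hj⟩ : ∃ j, σ₁.reg rJ = j := ⟨_, rfl⟩
    simp [e1, hsc.regI, f8, hN', hj] at hc
    rw [hj] at g4 g5 g6 g7
    have htree := (H.tree j (by omega)).congr hnet (fun x hx => ((g6 j le_rfl).2.2 x hx).1)
      (fun x hx => ((g6 j le_rfl).2.2 x hx).2)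
    rw [run_seq]
    refine (run_treeStep (Γ := Γ) (X := X) (i := i) (h := h) (cap := cap) (j := j) (u := u) (v := v)
      (g3.static hst) (g3.atScale hsc) ?_ hu hv ((hg1 _ (by decide)).trans hU)
      ((hg1 _ (by decide)).trans hV) hj (by omega) ?_ ?_ ?_).mono ?_
    · refine ⟨?_, ?_⟩
      · rw [f12]; exact hbig.big
      · rw [f12]; exact hbig.none
    · rw [f0, f1, (g6 j le_rfl).1]; exact htree
    · rw [(g6 j le_rfl).2.1, H.cnt j (by omega),
        inCount_congr fun x hx => ((g6 j le_rfl).2.2 x hx).1]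
    · rw [(g6 j le_rfl).1]
      rcases H.root j (by omega) with h1 | h1 <;> omega
    rw [f0, f1]
    rintro σ₂ T₂ ⟨k1, k2, k3⟩
    have m1 : σ₂.reg rJ = j := by
      rw [k1.regs _ (by decide) (by decide) (by decide) (by decide) (by decide) (by decide)
        (by decide)]; exact hj
    have hframe := g3.trans (k1.scaleFrame (by omega))
    simp [m1]
    have hscale : scaleAt n i (σ₂.setReg rJ (j + 1)) = scaleAt n i σ₂ := by
      simp [scaleAt]
    refine ⟨by omega, ?_, ?_, ?_, by omega, ?_, ?_, ?_⟩
    · intro q h1 h2 h3 h4 h5 h6 h7 h8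
      simp [h1, k1.regs q h2 h3 h4 h5 h6 h7 h8, g1 q h1 h2 h3 h4 h5 h6 h7 h8]
    · intro k hk h1 h2 h3 h4 h5
      simp [k1.arrs k hk h1 h2 h3 h4 h5, g2 k hk h1 h2 h3 h4 h5]
    · refine hframe.trans ⟨?_, ?_, ?_, ?_, ?_, ?_⟩
      · intro q h1 h2 h3 h4 h5 h6 h7 h8 h9 h10; simp [h1]
      all_goals intros; simp
    · rw [hscale]
      intro j' hj'
      rcases Nat.lt_or_eq_of_le hj' with h1 | rfl
      · obtain ⟨o1, o2, o3⟩ := k1.other (j' := j') (by omega)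
        have o4 := g5 j' h1
        refine ⟨?_, ?_, fun x hx => by rw [(o3 x hx).1]; exact o4.mono x hx, by
          rw [o1]; exact o4.root, fun hlt => ?_⟩
        · rw [o1]
          exact o4.tree.congr (hst.net) (fun x hx => (o3 x hx).1) (fun x hx => (o3 x hx).2)
        · rw [o2, o4.cnt, inCount_congr fun x hx => (o3 x hx).1]
        · rw [o1] at hlt
          rw [o1, (o3 _ hlt).1]
          exact o4.lab_root hlt
      · obtain ⟨o1, o2, o3⟩ := g6 j' le_rfl
        refine ⟨k2.tree, k2.cnt, fun x hx => ?_, ?_, fun hlt => ?_⟩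
        · rw [← (o3 x hx).1]; exact k2.mono x hx
        · rw [k2.root, o1]
          exact ScaleData.newRoot_congr hu hv fun x hx => (o3 x hx).1
        · rw [← (o3 _ hlt).1]; exact k2.lab_root hlt
    · rw [hscale]
      intro j' hj'
      obtain ⟨o1, o2, o3⟩ := k1.other (j' := j') (by omega)
      obtain ⟨p1, p2, p3⟩ := g6 j' (by omega)
      exact ⟨o1.trans p1, o2.trans p2, fun x hx =>
        ⟨(o3 x hx).1.trans (p3 x hx).1, (o3 x hx).2.trans (p3 x hx).2⟩⟩
    · rw [hscale]
      have hjN : j ∈ range N := mem_range.2 hc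
      have hsum : ∑ j' ∈ (range N).erase j, treePot n (σ.A aDeg) cap ((scaleAt n i σ₂).lab j')
          ((scaleAt n i σ₂).ptr j') = ∑ j' ∈ (range N).erase j, treePot n (σ.A aDeg) cap
          ((scaleAt n i σ₁).lab j') ((scaleAt n i σ₁).ptr j') := by
        refine sum_congr rfl fun j' hj' => ?_
        obtain ⟨o1, o2, o3⟩ := k1.other (j' := j') (ne_of_mem_erase hj')
        exact treePot_congr (fun x hx => (o3 x hx).1) (fun x hx => (o3 x hx).2)
      have s1 := add_sum_erase (range N) (fun j' => treePot n (σ.A aDeg) cap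
        ((scaleAt n i σ₂).lab j') ((scaleAt n i σ₂).ptr j')) hjN
      have s2 := add_sum_erase (range N) (fun j' => treePot n (σ.A aDeg) cap
        ((scaleAt n i σ₁).lab j') ((scaleAt n i σ₁).ptr j')) hjN
      simp only [cost_lt, cost_reg, cost_arr] at k3
      omega
  · rintro σ₁ T₁ ⟨g1, g2, g3, g4, g5, g6, g7⟩ hc
    have e1 := g1 rI (by decide) (by decide) (by decide) (by decide) (by decide) (by decide)
      (by decide) (by decide)
    have f8 := g2 aNum (by decide) (by decide) (by decide) (by decide) (by decide) (by decide)
    have f7 := g2 aCov (by decide) (by decide) (by decide) (by decide) (by decide) (by decide)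
    have f12 := g2 aBig (by decide) (by decide) (by decide) (by decide) (by decide) (by decide)
    simp [e1, hsc.regI, f8, hN'] at hc
    have hjN : σ₁.reg rJ = N := by omega
    rw [hjN] at g5 g6
    have hnum : (scaleAt n i σ₁).num = N := by rw [scaleAt_num, f8]; exact hN'
    have hcov : (scaleAt n i σ₁).cov = (scaleAt n i σ).cov := by
      funext x; rw [scaleAt_cov, scaleAt_cov, f7]
    refine ⟨g3, f12, H.delete hnet hu hv (hnum.trans hN.symm) hcov (by rwa [hN])
      (fun j hj _ x hx => (g6 j (by omega)).2.2 x hx), ?_⟩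
    rw [ScaleData.pot, ScaleData.pot, hnum, hN, hcov]
    simp
    omega
  · refine ⟨?_, ?_, ?_, by simp, by simp, ?_, ?_⟩
    · intro q h1 h2 h3 h4 h5 h6 h7 h8; simp [h1]
    · intros; simp
    · refine ⟨?_, ?_, ?_, ?_, ?_, ?_⟩
      · intro q h1 h2 h3 h4 h5 h6 h7 h8 h9 h10; simp [h1]
      all_goals intros; simp
    · intros; simp [scaleAt]
    · simp [scaleAt]
      omega

end DecrementalAPSP

namespace DecrementalAPSP
open WordRAM Finset Expr Cmd

/-! ### Finding and opening covering centres -/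

namespace ScaleData
variable {n : ℕ} {deg : ℕ → ℕ} {adj : ℕ → ℕ → ℕ} {Γ : SimpleGraph ℕ} {h cap : ℕ} {d d' : ScaleData}

/-- The two data agree on the part that is used for a graph with `n` vertices, except possibly for
the numbers of the covering centres. -/
structure SameTrees (n : ℕ) (d d' : ScaleData) : Prop where
  num : d'.num = d.num
  root : ∀ j ≤ n, d'.root j = d.root j
  cnt : ∀ j ≤ n, d'.cnt j = d.cnt j
  lab : ∀ j ≤ n, ∀ x < n, d'.lab j x = d.lab j x
  ptr : ∀ j ≤ n, ∀ x < n, d'.ptr j x = d.ptr j x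

theorem Inv.of_sameTrees (hnet : Net n deg adj Γ) (H : d.Inv n deg adj Γ h cap)
    (hd : SameTrees n d d')
    (hcov : ∀ x < n, d'.cov x ≤ d.num ∧ ∀ j < d'.cov x, 2 * h < d.lab j x) :
    d'.Inv n deg adj Γ h cap := by
  have hn := H.num_le hnet
  refine ⟨?_, ?_, ?_, ?_, ?_, ?_, ?_⟩
  · rw [hd.num]
    intro j hj
    rw [hd.root j (by omega)]
    exact (H.tree j hj).congr hnet (hd.lab j (by omega)) (hd.ptr j (by omega))
  · rw [hd.num]
    intro j hj
    rw [hd.cnt j (by omega), H.cnt j hj, inCount_congr (hd.lab j (by omega))]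
  · rw [hd.num]
    intro j hj
    rw [hd.root j (by omega)]
    rcases H.root j hj with h1 | h1
    · exact .inl h1
    · rw [hd.lab j (by omega) _ h1.1]; exact .inr h1
  · rw [hd.num]
    intro j hj j' hj' hne x hx hl
    rw [hd.lab j (by omega) x hx] at hl
    rw [hd.lab j' (by omega) x hx]
    exact H.disj j hj j' hj' hne x hx hl
  · rw [hd.num]
    refine (sum_le_sum fun j hj => ?_).trans H.count
    rw [mem_range] at hj
    rw [weight, weight, hd.root j (by omega)]
    split_ifs with h1
    · exact le_rfl
    · rw [hd.lab j (by omega) _ ((H.root j hj).resolve_left h1).1]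
  · rw [hd.num]
    intro x hx
    obtain ⟨h1, h2⟩ := hcov x hx
    exact ⟨h1, fun j hj => by rw [hd.lab j (by omega) x hx]; exact h2 j hj⟩
  · rw [hd.num]
    intro j h1 h2 x hx
    rw [hd.lab j h2 x hx, hd.ptr j h2 x hx]
    exact H.fresh j h1 h2 x hx

theorem Inv.congr (hnet : Net n deg adj Γ) (H : d.Inv n deg adj Γ h cap)
    (hd : SameTrees n d d') (hcov : ∀ x < n, d'.cov x = d.cov x) : d'.Inv n deg adj Γ h cap :=
  H.of_sameTrees hnet hd fun x hx => by rw [hcov x hx]; exact H.cov x hx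

theorem sum_treePot_congr (hd : SameTrees n d d') {N : ℕ} (hN : N ≤ n + 1) :
    ∑ j ∈ range N, treePot n deg cap (d'.lab j) (d'.ptr j) =
      ∑ j ∈ range N, treePot n deg cap (d.lab j) (d.ptr j) := by
  refine sum_congr rfl fun j hj => ?_
  rw [mem_range] at hj
  exact treePot_congr (hd.lab j (by omega)) (hd.ptr j (by omega))

theorem pot_congr (hn : d.num ≤ n) (hd : SameTrees n d d') (hcov : ∀ x < n, d'.cov x = d.cov x) :
    d'.pot n deg h cap = d.pot n deg h cap := by
  rw [pot, pot, hd.num, sum_treePot_congr hd (by omega)]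
  congr 2
  exact sum_congr rfl fun x hx => by rw [hcov x (mem_range.1 hx)]

/-- The search for a covering centre is paid by the progress of the search. -/
theorem pot_cov (hn : d.num ≤ n) (hd : SameTrees n d d') {z : ℕ} (hz : z < n)
    (hcov : ∀ x < n, x ≠ z → d'.cov x = d.cov x) :
    d'.pot n deg h cap + 100 * (n / (h + 1) - d.cov z) =
      d.pot n deg h cap + 100 * (n / (h + 1) - d'.cov z) := by
  rw [pot, pot, hd.num, sum_treePot_congr hd (by omega)]
  have h1 := add_sum_erase (range n) (fun x => n / (h + 1) - d.cov x) (mem_range.2 hz)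
  have h2 := add_sum_erase (range n) (fun x => n / (h + 1) - d'.cov x) (mem_range.2 hz)
  have h3 : ∑ x ∈ (range n).erase z, (n / (h + 1) - d'.cov x) =
      ∑ x ∈ (range n).erase z, (n / (h + 1) - d.cov x) := by
    refine sum_congr rfl fun x hx => ?_
    rw [mem_erase, mem_range] at hx
    rw [hcov x hx.2 hx.1]
  omega

end ScaleData

section
variable {n i : ℕ} {σ σ' : State}

theorem ScaleFrame.setReg (hf : ScaleFrame n i σ σ') {q : ℕ} (hq : q = rJ ∨ q = rZ ∨ q = rC)
    (v : ℕ) : ScaleFrame n i σ (σ'.setReg q v) := by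
  have h31 : 31 ≠ q := by omega
  refine ⟨fun q' h1 h2 h3 h4 h5 h6 h7 h8 h9 h10 => ?_, ?_, ?_, ?_, ?_, ?_⟩
  · rw [State.reg_setReg_ne _ _ (by omega)]
    exact hf.regs q' h1 h2 h3 h4 h5 h6 h7 h8 h9 h10
  all_goals simp only [State.A_setReg _ _ _ h31]
  exacts [hf.arrs, hf.block, hf.tree, hf.cov, hf.num]

theorem ScaleFrame.setA_cov (hf : ScaleFrame n i σ σ') {z : ℕ} (hz : z < n) (v : ℕ) :
    ScaleFrame n i σ (σ'.setA aCov (i * n + z) v) := by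
  refine ⟨hf.regs, fun k hk h1 h2 h3 h4 h5 h6 h7 h8 => ?_, ?_, ?_, fun y hy => ?_, ?_⟩
  · rw [State.A_setA_ne _ _ _ h6 (by decide) hk]
    exact hf.arrs k hk h1 h2 h3 h4 h5 h6 h7 h8
  · simpa using hf.block
  · simpa using hf.tree
  · rw [State.A_setA_same, if_neg (by omega)]; exact hf.cov y hy
  · simpa using hf.num

theorem ScaleFrame.setA_num (hf : ScaleFrame n i σ σ') (v : ℕ) :
    ScaleFrame n i σ (σ'.setA aNum i v) := by
  refine ⟨hf.regs, fun k hk h1 h2 h3 h4 h5 h6 h7 h8 => ?_, ?_, ?_, ?_, fun y hy => ?_⟩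
  · rw [State.A_setA_ne _ _ _ h7 (by decide) hk]
    exact hf.arrs k hk h1 h2 h3 h4 h5 h6 h7 h8
  · simpa using hf.block
  · simpa using hf.tree
  · simpa using hf.cov
  · rw [State.A_setA_same, if_neg (by omega)]; exact hf.num y hy

theorem ScaleFrame.setA_big (hf : ScaleFrame n i σ σ') (z v : ℕ) :
    ScaleFrame n i σ (σ'.setA aBig z v) := by
  refine ⟨hf.regs, fun k hk h1 h2 h3 h4 h5 h6 h7 h8 => ?_, ?_, ?_, ?_, ?_⟩
  · rw [State.A_setA_ne _ _ _ h8 (by decide) hk]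
    exact hf.arrs k hk h1 h2 h3 h4 h5 h6 h7 h8
  · simpa using hf.block
  · simpa using hf.tree
  · simpa using hf.cov
  · simpa using hf.num

end

variable {w : ℕ} [hw : Fact (16 < 2 ^ w)] {n X i h cap : ℕ} {Γ : SimpleGraph ℕ} {σ : State} {Tm : ℕ}

theorem run_coverScan {z M : ℕ}
    (hst : Static w n X Γ σ) (hsc : AtScale n X i h cap σ) (hZ : σ.reg rZ = z) (hz : z < n)
    (hN : (scaleAt n i σ).num ≤ n) (hM : (scaleAt n i σ).num ≤ M)
    (hcov : (scaleAt n i σ).cov z ≤ (scaleAt n i σ).num)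
    (hcov' : ∀ j < (scaleAt n i σ).cov z, 2 * h < (scaleAt n i σ).lab j z) :
    Run w coverScan σ Tm fun σ' Tm' => ∃ c, σ' = (σ.setReg rC c).setA aCov (i * n + z) c ∧
      c ≤ (scaleAt n i σ).num ∧ (∀ j < c, 2 * h < (scaleAt n i σ).lab j z) ∧
      (c < (scaleAt n i σ).num → (scaleAt n i σ).lab c z ≤ 2 * h) ∧
      Tm' + 100 * (M - c) ≤ Tm + 100 * (M - (scaleAt n i σ).cov z) + 200 := by
  have h16 := hw.out
  have hw0 : w ≠ 0 := by rintro rfl; simp at h16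
  have hX := hst.addr
  have hnX : n ≤ X := (Nat.le_mul_self n).trans hst.sq_le
  obtain ⟨b1, b2, b3, b4⟩ := tree_index_le hsc.index_le (by omega) le_rfl
  have hcapX := hsc.cap_le
  have hrad := hsc.radius_le
  obtain ⟨N, hN'⟩ : ∃ N, σ.A aNum i = N := ⟨_, rfl⟩
  obtain ⟨c₀, hc₀⟩ : ∃ c₀, σ.A aCov (i * n + z) = c₀ := ⟨_, rfl⟩
  simp only [scaleAt_num, scaleAt_cov, scaleAt_lab, hN', hc₀] at hN hM hcov hcov' ⊢
  simp only [coverScan, run_seq, run_assign]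
  simp [hsc.regCb, hZ, hc₀, and_assoc]
  repeat refine And.intro (by omega) ?_
  refine run_while (fun σ₁ T₁ => ∃ c, σ₁ = σ.setReg rC c ∧ c ≤ N ∧
      (∀ j < c, 2 * h < σ.A aLab ((i * (n + 1) + j) * n + z)) ∧
      T₁ + 100 * (M - c) ≤ Tm + 100 * (M - c₀) + 50)
    (Tm + 100 * (M - c₀) + 50) ?_ ?_ ?_ ?_ ?_
  · rintro σ₁ T₁ ⟨c, -, -, -, h1⟩; omega
  · rintro σ₁ T₁ ⟨c, rfl, h1, h2, -⟩
    have hidx : (i * (n + 1) + c) * n ≤ (i * (n + 1) + n) * n :=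
      Nat.mul_le_mul_right _ (by omega)
    simp [hsc.regI, hsc.regH, hsc.regTb, hst.regN, hZ, hN', and_assoc]
    repeat refine And.intro (by omega) ?_
    split_ifs <;> omega
  · rintro σ₁ T₁ ⟨c, rfl, h1, h2, h3⟩ hcond
    simp [hsc.regI, hsc.regH, hsc.regTb, hst.regN, hZ, hN'] at hcond
    simp
    refine ⟨by omega, c + 1, by simp, by omega, fun j hj => ?_, by omega⟩
    rcases Nat.lt_succ_iff_lt_or_eq.1 hj with hj | rfl
    · exact h2 j hj
    · omega
  · rintro σ₁ T₁ ⟨c, rfl, h1, h2, h3⟩ hcond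
    simp [hsc.regI, hsc.regH, hsc.regTb, hst.regN, hZ, hN'] at hcond
    simp [hsc.regCb, hZ]
    refine ⟨by omega, by omega, c, rfl, h1, h2, fun h4 => ?_, by omega⟩
    by_contra h5
    have := hcond (by omega)
    omega
  · exact ⟨c₀, rfl, hcov, hcov', by omega⟩

theorem run_coverOpen {z c : ℕ}
    (hst : Static w n X Γ σ) (hsc : AtScale n X i h cap σ) (hZ : σ.reg rZ = z) (hz : z < n)
    (hC : σ.reg rC = c)
    (H : (scaleAt n i σ).Inv n (σ.A aDeg) (fun x k => σ.A aAdj (x * n + k)) Γ h cap)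
    (hflag : h < csize n Γ z ∧ σ.A aBig z = 1 ∨ csize n Γ z ≤ h ∧ σ.A aBig z = 0)
    (hc : c ≤ (scaleAt n i σ).num)
    (hcov : ∀ j < c, 2 * h < (scaleAt n i σ).lab j z)
    (hlab : c < (scaleAt n i σ).num → (scaleAt n i σ).lab c z ≤ 2 * h) :
    Run w coverOpen σ Tm fun σ' Tm' => ScaleFrame n i σ σ' ∧ σ'.reg rZ = z ∧ σ'.reg rC = c ∧
      σ'.A aBig = σ.A aBig ∧ (scaleAt n i σ').cov = (scaleAt n i σ).cov ∧
      (scaleAt n i σ').Inv n (σ.A aDeg) (fun x k => σ.A aAdj (x * n + k)) Γ h cap ∧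
      (scaleAt n i σ).num ≤ (scaleAt n i σ').num ∧
      (∀ j < (scaleAt n i σ).num, ∀ x < n,
        (scaleAt n i σ').lab j x = (scaleAt n i σ).lab j x) ∧
      (h < csize n Γ z → c < (scaleAt n i σ').num) ∧
      (c < (scaleAt n i σ').num → (scaleAt n i σ').lab c z ≤ 2 * h) ∧
      Tm' + (scaleAt n i σ').pot n (σ.A aDeg) h cap ≤
        Tm + (scaleAt n i σ).pot n (σ.A aDeg) h cap + 100 := by
  have h16 := hw.out
  have hw0 : w ≠ 0 := by rintro rfl; simp at h16
  have hX := hst.addr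
  have hnX : n ≤ X := (Nat.le_mul_self n).trans hst.sq_le
  have hNn := H.num_le hst.net
  obtain ⟨b1, b2, b3, b4⟩ := tree_index_le hsc.index_le (by omega) le_rfl
  obtain ⟨N, hN⟩ : ∃ N, (scaleAt n i σ).num = N := ⟨_, rfl⟩
  have hN' : σ.A aNum i = N := hN
  rw [hN] at hNn hc hlab ⊢
  simp only [coverOpen, run_ite, run_seq, run_setArr, run_skip, Nat.reduceLT]
  simp [hsc.regI, hZ, hC, hN']
  refine ⟨by omega, fun h1 => ?_, fun h1 => ⟨by omega, fun h2 => ?_, fun h2 => ?_⟩⟩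
  · exact ⟨.refl .., H, hN.ge, fun _ => hN.symm ▸ h1, fun _ => hlab h1, by omega⟩
  · obtain rfl : c = N := by omega
    have hbig : h < csize n Γ z := by
      rcases hflag with h3 | h3
      · exact h3.1
      · omega
    refine (run_openTree (w := w) hst hsc hZ hz hC hNn (H.fresh c hN.le hNn)).mono ?_
    rintro σ₁ T₁ ⟨g1, g2, g3, g4, g5, g6⟩
    have e1 := g1.regs rI (by decide) (by decide) (by decide) (by decide) (by decide) (by decide)
      (by decide)
    have e2 := g1.regs 31 (by decide) (by decide) (by decide) (by decide) (by decide) (by decide)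
      (by decide)
    have e3 := g1.regs rC (by decide) (by decide) (by decide) (by decide) (by decide) (by decide)
      (by decide)
    have e4 := g1.regs rZ (by decide) (by decide) (by decide) (by decide) (by decide) (by decide)
      (by decide)
    have f12 := g1.arrs aBig (by decide) (by decide) (by decide) (by decide) (by decide) (by decide)
    have f7 := g1.cov (i := i)
    simp [e1, e2, e3, e4, hZ, hC, hsc.regI, f12, and_assoc]
    have hs : scaleAt n i (σ₁.setA aNum i (c + 1)) = ⟨c + 1, (scaleAt n i σ₁).root,
        (scaleAt n i σ₁).cnt, (scaleAt n i σ₁).lab, (scaleAt n i σ₁).ptr,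
        (scaleAt n i σ₁).cov⟩ := by
      simp [scaleAt]
    have hnew : (scaleAt n i (σ₁.setA aNum i (c + 1))).Inv n (σ.A aDeg)
        (fun x k => σ.A aAdj (x * n + k)) Γ h cap := by
      rw [hs]
      refine H.opening hst.net hsc.radius_le hz hbig (by rw [hN]; exact hcov) (by simp [hN])
        (fun j hj => ?_) ?_ ?_ ?_ ?_ (fun j hj hj' => ?_) (fun x _ => ?_)
      · exact g1.other (by omega)
      all_goals simp only [hN]
      · rw [g3]; exact g2
      · exact g3
      · exact g4
      · exact g5
      · rw [hN] at hj; exact (g1.other (by omega)).2.2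
      · rw [f7]
    have hM : (scaleAt n i (σ₁.setA aNum i (c + 1))).num ≤ n / (h + 1) := (Nat.le_div_iff_mul_le h.succ_pos).2 (hnew.num_mul_le hst.net)
    refine ⟨by omega, by omega, (g1.scaleFrame hNn).setA_num _, ?_, hnew, ?_, ?_, ?_, ?_, ?_⟩
    · rw [hs]; exact f7
    · rw [hs]; simp
    · rw [hs]; intro j hj x hx; exact ((g1.other (by omega)).2.2 x hx).1
    · rw [hs]; simp
    · rw [hs]; simp [g4]
    · have hsum : ∑ j ∈ range c, treePot n (σ.A aDeg) cap ((scaleAt n i σ₁).lab j)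
          ((scaleAt n i σ₁).ptr j) = ∑ j ∈ range c, treePot n (σ.A aDeg) cap
          ((scaleAt n i σ).lab j) ((scaleAt n i σ).ptr j) := by
        refine sum_congr rfl fun j hj => ?_
        have := g1.other (i := i) (j := c) (j' := j) (by rw [mem_range] at hj; omega)
        exact treePot_congr (fun x hx => (this.2.2 x hx).1) (fun x hx => (this.2.2 x hx).2)
      rw [hs] at hM ⊢
      simp only [ScaleData.pot, hN, f7, sum_range_succ, hsum] at hM ⊢
      obtain ⟨k, hk⟩ := Nat.exists_eq_add_of_le hM
      rw [hk, show c + 1 + k - (c + 1) = k by omega, show c + 1 + k - c = k + 1 by omega,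
        Nat.add_one_mul k]
      omega
  · have hbig : csize n Γ z ≤ h := by
      rcases hflag with h3 | h3 <;> omega
    exact ⟨.refl .., H, hN.ge, fun h3 => by omega, fun h3 => by omega, by omega⟩

theorem run_coverStep {z hn : ℕ}
    (hst : Static w n X Γ σ) (hsc : AtScale n X i h cap σ) (hZ : σ.reg rZ = z) (hz : z < n)
    (hHn : σ.reg rHn = hn) (hh : h ≤ hn) (hcap : h + hn ≤ cap)
    (H : (scaleAt n i σ).Inv n (σ.A aDeg) (fun x k => σ.A aAdj (x * n + k)) Γ h cap)
    (hflag : h < csize n Γ z ∧ σ.A aBig z = 1 ∨ csize n Γ z ≤ h ∧ σ.A aBig z = 0) :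
    Run w coverStep σ Tm fun σ' Tm' => ScaleFrame n i σ σ' ∧ σ'.reg rZ = z ∧
      (scaleAt n i σ').Inv n (σ.A aDeg) (fun x k => σ.A aAdj (x * n + k)) Γ h cap ∧
      (h < csize n Γ z → (scaleAt n i σ').Covered h z) ∧
      (∀ x < n, x ≠ z → (scaleAt n i σ).Covered h x → (scaleAt n i σ').Covered h x) ∧
      (hn < csize n Γ z ∧ σ'.A aBig z = 1 ∨ csize n Γ z ≤ hn ∧ σ'.A aBig z = 0) ∧
      (∀ y ≠ z, σ'.A aBig y = σ.A aBig y) ∧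
      Tm' + (scaleAt n i σ').pot n (σ.A aDeg) h cap ≤
        Tm + (scaleAt n i σ).pot n (σ.A aDeg) h cap + 1000 := by
  have h16 := hw.out
  have hw0 : w ≠ 0 := by rintro rfl; simp at h16
  have hX := hst.addr
  have hnX : n ≤ X := (Nat.le_mul_self n).trans hst.sq_le
  have hNn := H.num_le hst.net
  have hNM : (scaleAt n i σ).num ≤ n / (h + 1) := (Nat.le_div_iff_mul_le h.succ_pos).2 (H.num_mul_le hst.net)
  obtain ⟨b1, b2, b3, b4⟩ := tree_index_le hsc.index_le (by omega) le_rfl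
  simp only [coverStep, run_seq, run_setArr, Nat.reduceLT]
  refine (run_coverScan (w := w) hst hsc hZ hz hNn hNM (H.cov z hz).1 (H.cov z hz).2).mono ?_
  rintro σ₁ T₁ ⟨c, rfl, g1, g2, g3, g4⟩
  have hfr : ScaleFrame n i σ ((σ.setReg rC c).setA aCov (i * n + z) c) :=
    ((ScaleFrame.refl n i σ).setReg (by simp) c).setA_cov hz c
  have hs : scaleAt n i ((σ.setReg rC c).setA aCov (i * n + z) c) =
      ⟨(scaleAt n i σ).num, (scaleAt n i σ).root, (scaleAt n i σ).cnt, (scaleAt n i σ).lab,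
        (scaleAt n i σ).ptr, fun x => if x = z then c else (scaleAt n i σ).cov x⟩ := by
    simp [scaleAt, State.A_setA_same]
  generalize hσ₁ : (σ.setReg rC c).setA aCov (i * n + z) c = σ₁ at hfr hs ⊢
  have hsame : ScaleData.SameTrees n (scaleAt n i σ) (scaleAt n i σ₁) := by
    rw [hs]
    exact ⟨rfl, fun _ _ => rfl, fun _ _ => rfl, fun _ _ _ _ => rfl, fun _ _ _ _ => rfl⟩
  have f0 : σ₁.A aAdj = σ.A aAdj := by simp [← hσ₁]
  have f1 : σ₁.A aDeg = σ.A aDeg := by simp [← hσ₁]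
  have f12 : σ₁.A aBig = σ.A aBig := by simp [← hσ₁]
  have eZ : σ₁.reg rZ = z := by simp [← hσ₁, hZ]
  have eC : σ₁.reg rC = c := by simp [← hσ₁]
  have hcz : (scaleAt n i σ₁).cov z = c := by rw [hs]; simp
  have hcx : ∀ x < n, x ≠ z → (scaleAt n i σ₁).cov x = (scaleAt n i σ).cov x := by
    intro x _ hx; rw [hs]; simp [hx]
  have H₁ : (scaleAt n i σ₁).Inv n (σ.A aDeg) (fun x k => σ.A aAdj (x * n + k)) Γ h cap := by
    refine H.of_sameTrees hst.net hsame fun x hx => ?_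
    by_cases hxz : x = z
    · subst hxz; rw [hcz]; exact ⟨g1, g2⟩
    · rw [hcx x hx hxz]; exact H.cov x hx
  have hpot := ScaleData.pot_cov (deg := σ.A aDeg) (h := h) (cap := cap) hNn hsame hz hcx
  rw [hcz] at hpot
  have hlabz : ∀ j ≤ n, (scaleAt n i σ₁).lab j z = (scaleAt n i σ).lab j z := fun j hj =>
    hsame.lab j hj z hz
  refine (run_coverOpen (w := w) (Γ := Γ) (hfr.static hst) (hfr.atScale hsc) eZ hz eC
    (by rw [f0, f1]; exact H₁) (by rw [f12]; exact hflag) (by rw [hsame.num]; exact g1)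
    (fun j hj => by rw [hlabz j (by omega)]; exact g2 j hj)
    (fun hlt => by rw [hsame.num] at hlt; rw [hlabz c (by omega)]; exact g3 hlt)).mono ?_
  rw [f0, f1, f12]
  rintro σ₂ T₂ ⟨k1, k2, k3, k4, k5, k6, k7, k8, k9, k10, k11⟩
  have hfr₂ := hfr.trans k1
  have e1 := hfr₂.regs rI (by decide) (by decide) (by decide) (by decide) (by decide) (by decide)
    (by decide) (by decide) (by decide) (by decide)
  have e2 := hfr₂.regs 31 (by decide) (by decide) (by decide) (by decide) (by decide) (by decide)
    (by decide) (by decide) (by decide) (by decide)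
  have e3 := hfr₂.regs rTb (by decide) (by decide) (by decide) (by decide) (by decide) (by decide)
    (by decide) (by decide) (by decide) (by decide)
  have e4 := hfr₂.regs rHn (by decide) (by decide) (by decide) (by decide) (by decide) (by decide)
    (by decide) (by decide) (by decide) (by decide)
  have hcz₂ : (scaleAt n i σ₂).cov z = c := by rw [k5, hcz]
  have hiff := k6.lt_csize_iff hst.net (h' := hn) hh hcap hsc.radius_le hz
    (by rw [hcz₂]; exact k10) (by rw [hcz₂]; exact k9)
  rw [hcz₂, scaleAt_num, scaleAt_cnt] at hiff
  simp [e1, e2, e3, e4, k2, k3, hsc.regI, hsc.regTb, hHn, and_assoc]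
  have hs₃ : ∀ v, scaleAt n i (σ₂.setA aBig z v) = scaleAt n i σ₂ := by
    intro v; simp [scaleAt]
  rw [hs₃]
  repeat (refine And.intro ?_ ?_; focus (first | omega | (split_ifs <;> omega)))
  refine ⟨hfr₂.setA_big _ _, k6, ?_, ?_, ?_, ?_, by omega⟩
  · intro hlt
    rw [ScaleData.Covered, hcz₂]
    exact ⟨k9 hlt, k10 (k9 hlt)⟩
  · intro x hx hxz hcov
    rw [ScaleData.Covered, k5, hcx x hx hxz]
    rw [ScaleData.Covered] at hcov
    have h1 : (scaleAt n i σ).cov x < (scaleAt n i σ₁).num := by rw [hsame.num]; exact hcov.1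
    refine ⟨h1.trans_le k7, ?_⟩
    rw [k8 _ h1 x hx, hsame.lab _ (by have := hcov.1; omega) x hx]
    exact hcov.2
  · by_cases hlt : hn < csize n Γ z
    · have := hiff.2 hlt
      exact .inl ⟨hlt, by simp [this.1, this.2]⟩
    · refine .inr ⟨by omega, ?_⟩
      intro h2
      by_contra h3
      exact hlt (hiff.1 ⟨by omega, h2⟩)
  · intro y hy
    rw [State.A_setA_same, if_neg hy, k4]

/-- All large components are covered afterwards, and the flags are those for the next scale. -/
theorem run_updateCover {hn : ℕ}
    (hst : Static w n X Γ σ) (hsc : AtScale n X i h cap σ)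
    (hHn : σ.reg rHn = hn) (hh : h ≤ hn) (hcap : h + hn ≤ cap)
    (H : (scaleAt n i σ).Inv n (σ.A aDeg) (fun x k => σ.A aAdj (x * n + k)) Γ h cap)
    (hbig : BigRep n Γ h σ) (hn0 : 0 < n) :
    Run w updateCover σ Tm fun σ' Tm' => ScaleFrame n i σ σ' ∧
      (scaleAt n i σ').Inv n (σ.A aDeg) (fun x k => σ.A aAdj (x * n + k)) Γ h cap ∧
      (∀ x < n, h < csize n Γ x → (scaleAt n i σ').Covered h x) ∧ BigRep n Γ hn σ' ∧
      Tm' + (scaleAt n i σ').pot n (σ.A aDeg) h cap ≤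
        Tm + (scaleAt n i σ).pot n (σ.A aDeg) h cap + 1100 * n + 100 := by
  have h16 := hw.out
  have hw0 : w ≠ 0 := by rintro rfl; simp at h16
  have hX := hst.addr
  have hnX : n ≤ X := (Nat.le_mul_self n).trans hst.sq_le
  obtain ⟨b1, b2, b3, b4⟩ := tree_index_le hsc.index_le hn0 le_rfl
  simp only [updateCover, run_seq, run_assign]
  refine ⟨by simp, ?_⟩
  -- the flags of the vertices below `rZ` are those for the next scale already
  refine run_while (fun σ₁ T₁ => ScaleFrame n i σ σ₁ ∧ σ₁.reg rZ ≤ n ∧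
      (scaleAt n i σ₁).Inv n (σ.A aDeg) (fun x k => σ.A aAdj (x * n + k)) Γ h cap ∧
      (∀ x < σ₁.reg rZ, h < csize n Γ x → (scaleAt n i σ₁).Covered h x) ∧
      (∀ x < σ₁.reg rZ, hn < csize n Γ x ∧ σ₁.A aBig x = 1 ∨
        csize n Γ x ≤ hn ∧ σ₁.A aBig x = 0) ∧
      (∀ x, σ₁.reg rZ ≤ x → σ₁.A aBig x = σ.A aBig x) ∧
      T₁ + (scaleAt n i σ₁).pot n (σ.A aDeg) h cap + 1100 * (n - σ₁.reg rZ) ≤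
        Tm + (scaleAt n i σ).pot n (σ.A aDeg) h cap + 1100 * n + 10)
    (Tm + (scaleAt n i σ).pot n (σ.A aDeg) h cap + 1100 * n + 10) (by intros; omega) ?_ ?_ ?_ ?_
  · intros; simp
  · rintro σ₁ T₁ ⟨g1, g2, g3, g4, g5, g6, g7⟩ hc
    have e1 := g1.regs rN (by decide) (by decide) (by decide) (by decide) (by decide) (by decide)
      (by decide) (by decide) (by decide) (by decide)
    have e2 := g1.regs rHn (by decide) (by decide) (by decide) (by decide) (by decide) (by decide)
      (by decide) (by decide) (by decide) (by decide)
    have f0 := g1.arrs aAdj (by decide) (by decide) (by decide) (by decide) (by decide) (by decide)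
      (by decide) (by decide) (by decide)
    have f1 := g1.arrs aDeg (by decide) (by decide) (by decide) (by decide) (by decide) (by decide)
      (by decide) (by decide) (by decide)
    obtain ⟨z, hz⟩ : ∃ z, σ₁.reg rZ = z := ⟨_, rfl⟩
    simp [e1, hst.regN, hz] at hc
    rw [hz] at g2 g4 g5 g6 g7
    rw [run_seq]
    refine (run_coverStep (w := w) (Γ := Γ) (g1.static hst) (g1.atScale hsc) hz hc (e2.trans hHn)
      hh hcap (by rw [f0, f1]; exact g3) (by rw [g6 z le_rfl]; exact hbig.big z hc)).mono ?_
    rw [f0, f1]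
    rintro σ₂ T₂ ⟨k1, k2, k3, k4, k5, k6, k7, k8⟩
    have hs : scaleAt n i (σ₂.setReg rZ (z + 1)) = scaleAt n i σ₂ := by simp [scaleAt]
    simp only [run_assign, Expr.val_add, Expr.val_reg, Expr.val_const, k2, hs,
      State.reg_setReg_same]
    refine ⟨by simp [k2]; omega, (g1.trans k1).setReg (by simp) _, by omega, k3, ?_, ?_, ?_, ?_⟩
    · intro x hx hlt
      rcases Nat.lt_succ_iff_lt_or_eq.1 hx with hx' | rfl
      · exact k5 x (by omega) (by omega) (g4 x hx' hlt)
      · exact k4 hlt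
    · intro x hx
      rw [State.A_setReg _ _ _ (by decide)]
      rcases Nat.lt_succ_iff_lt_or_eq.1 hx with hx' | rfl
      · rw [k7 x (by omega)]; exact g5 x hx'
      · exact k6
    · intro x hx
      rw [State.A_setReg _ _ _ (by decide), k7 x (by omega), g6 x (by omega)]
    · simp only [Expr.cost_lt, Expr.cost_reg, Expr.cost_add, Expr.cost_const] at k8 ⊢
      omega
  · rintro σ₁ T₁ ⟨g1, g2, g3, g4, g5, g6, g7⟩ hc
    have e1 := g1.regs rN (by decide) (by decide) (by decide) (by decide) (by decide) (by decide)
      (by decide) (by decide) (by decide) (by decide)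
    simp [e1, hst.regN] at hc
    have hz : σ₁.reg rZ = n := by omega
    rw [hz] at g4 g5 g6
    refine ⟨g1, g3, g4, ⟨g5, by rw [g6 n le_rfl, hbig.none]⟩, ?_⟩
    simp only [Expr.cost_lt, Expr.cost_reg]
    omega
  · have hs : scaleAt n i (σ.setReg rZ 0) = scaleAt n i σ := by simp [scaleAt]
    simp only [Expr.val_const, hs, State.reg_setReg_same]
    refine ⟨(ScaleFrame.refl n i σ).setReg (by simp) _, by omega, H, by omega, by omega, ?_, ?_⟩
    · intro x _; simp
    · simp only [Expr.cost_const]; omega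

end DecrementalAPSP

namespace DecrementalAPSP
open WordRAM Finset Expr Cmd

/-! ### The pass over all scales -/

/-- The update of the scale `rI`: load its parameters, update its trees, then its centres. -/
def scalePass : Cmd :=
  rH ::= arr aH (reg rI) ;;
  rCap ::= arr aCap (reg rI) ;;
  rTb ::= reg rI * (reg rN + const 1) ;;
  rCb ::= reg rI * reg rN ;;
  rHn ::= arr aH (reg rI + const 1) ;;
  updateTrees ;; updateCover

/-- Set all flags, including the one for the index `n`. -/
def setFlags : Cmd :=
  rK ::= const 0 ;;
  .while (lt (reg rK) (reg rN + const 1)) (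
    setArr aBig (reg rK) (const 1) ;;
    rK ::= reg rK + const 1)

/-- The update of all scales after the edge with the ends `rU` and `rV` was deleted. -/
def pass : Cmd :=
  setFlags ;;
  rI ::= const 0 ;;
  .while (lt (reg rI) (reg rNum)) (scalePass ;; rI ::= reg rI + const 1)

/-- The conditions on the radii `hs i` and the depths `caps i` of the scales `i < s`. Here `X` bounds
all array indices and all counters. -/
structure Params (n X s : ℕ) (hs caps : ℕ → ℕ) : Prop where
  index_le : ∀ i < s, (i * (n + 1) + (n + 1)) * n + n ≤ X
  pot_le : ∀ i < s, (caps i + 1) * (n * (n + 1)) + n + 3 ≤ X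
  cap_le : ∀ i < s, caps i + 1 ≤ X
  num_le : s ≤ X
  zero : hs 0 = 0
  mono : ∀ i < s, hs i ≤ hs (i + 1)
  add_le : ∀ i < s, hs i + hs (i + 1) ≤ caps i

/-- The parts of the state that are constant during the pass over the scales. -/
structure Common (w n X s : ℕ) (hs caps : ℕ → ℕ) (Γ : SimpleGraph ℕ) (σ : State) : Prop where
  static : Static w n X Γ σ
  regNum : σ.reg rNum = s
  radius : ∀ i ≤ s, σ.A aH i = hs i
  depth : ∀ i < s, σ.A aCap i = caps i

/-- The invariant of the scale `i` for the graph `Γ`. -/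
def InvAt (n i : ℕ) (Γ : SimpleGraph ℕ) (h cap : ℕ) (σ : State) : Prop :=
  (scaleAt n i σ).Inv n (σ.A aDeg) (fun x k => σ.A aAdj (x * n + k)) Γ h cap

/-- All vertices in large components are covered at the scale `i`. -/
def CoveredAt (n i : ℕ) (Γ : SimpleGraph ℕ) (h : ℕ) (σ : State) : Prop :=
  ∀ x < n, h < csize n Γ x → (scaleAt n i σ).Covered h x

/-- From `σ` to `σ'`, only the scale `i`, the flags and auxiliary registers were changed. -/
structure PassFrame (n i : ℕ) (σ σ' : State) : Prop where
  regs : ∀ q, q < 5 ∨ 14 < q → q < 26 ∨ 30 < q → σ'.reg q = σ.reg q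
  arrs : ∀ k < 16, k ≠ aLab → k ≠ aPtr → k ≠ aCnt → k ≠ aStack → k ≠ aRoot → k ≠ aCov →
    k ≠ aNum → k ≠ aBig → σ'.A k = σ.A k
  other : ∀ i' ≠ i, ScaleData.SameTrees n (scaleAt n i' σ) (scaleAt n i' σ')
  other_cov : ∀ i' ≠ i, ∀ x < n, (scaleAt n i' σ').cov x = (scaleAt n i' σ).cov x

section
variable {w n X s i h cap : ℕ} {hs caps : ℕ → ℕ} {Γ : SimpleGraph ℕ} {σ σ' : State}

theorem Common.transfer (hc : Common w n X s hs caps Γ σ) (h31 : σ'.reg 31 = σ.reg 31)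
    (hN : σ'.reg rN = σ.reg rN) (hNum : σ'.reg rNum = σ.reg rNum)
    (ha : ∀ k < 16, k ≠ aLab → k ≠ aPtr → k ≠ aCnt → k ≠ aStack → k ≠ aRoot → k ≠ aCov →
      k ≠ aNum → k ≠ aBig → σ'.A k = σ.A k) : Common w n X s hs caps Γ σ' := by
  refine ⟨hc.static.transfer h31 hN ?_ ?_ ?_, hNum.trans hc.regNum, ?_, ?_⟩
  iterate 3
    exact ha _ (by decide) (by decide) (by decide) (by decide) (by decide) (by decide) (by decide)
      (by decide) (by decide)
  · rw [ha aH (by decide) (by decide) (by decide) (by decide) (by decide) (by decide) (by decide)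
      (by decide) (by decide)]
    exact hc.radius
  · rw [ha aCap (by decide) (by decide) (by decide) (by decide) (by decide) (by decide) (by decide)
      (by decide) (by decide)]
    exact hc.depth

theorem PassFrame.common (hf : PassFrame n i σ σ') (hc : Common w n X s hs caps Γ σ) :
    Common w n X s hs caps Γ σ' :=
  hc.transfer (hf.regs _ (by omega) (by omega)) (hf.regs _ (by omega) (by omega))
    (hf.regs _ (by omega) (by omega)) hf.arrs

theorem ScaleFrame.passFrame (hf : ScaleFrame n i σ σ') : PassFrame n i σ σ' := by
  have hlt : ∀ i' ≠ i, i' < i ∨ i < i' := fun i' hi' => by omega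
  have hmul : ∀ a b c : ℕ, a < b → a * c + c ≤ b * c := fun a b c hab => by
    have := Nat.mul_le_mul_right c (Nat.succ_le_of_lt hab)
    rwa [Nat.succ_mul] at this
  have htree : ∀ i' ≠ i, ∀ j ≤ n, i' * (n + 1) + j < i * (n + 1) ∨
      i * (n + 1) + (n + 1) ≤ i' * (n + 1) + j := by
    intro i' hi' j hj
    rcases hlt i' hi' with h1 | h1
    · have := hmul _ _ (n + 1) h1; omega
    · have := hmul _ _ (n + 1) h1; omega
  have hblock : ∀ i' ≠ i, ∀ j ≤ n, ∀ x < n, (i' * (n + 1) + j) * n + x < i * (n + 1) * n ∨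
      (i * (n + 1) + (n + 1)) * n ≤ (i' * (n + 1) + j) * n + x := by
    intro i' hi' j hj x hx
    rcases htree i' hi' j hj with h1 | h1
    · have := hmul _ _ n h1; omega
    · have := Nat.mul_le_mul_right n h1; omega
  refine ⟨fun q h1 h2 => ?_, hf.arrs, fun i' hi' => ⟨hf.num i' hi', ?_, ?_, ?_, ?_⟩,
    fun i' hi' x hx => ?_⟩
  · exact hf.regs q (by omega) (by omega) (by omega) (by omega) (by omega) (by omega) (by omega)
      (by omega) (by omega) (by omega)
  · exact fun j hj => (hf.tree _ (htree i' hi' j hj)).1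
  · exact fun j hj => (hf.tree _ (htree i' hi' j hj)).2
  · exact fun j hj x hx => (hf.block _ (hblock i' hi' j hj x hx)).1
  · exact fun j hj x hx => (hf.block _ (hblock i' hi' j hj x hx)).2
  · refine hf.cov _ ?_
    rcases hlt i' hi' with h1 | h1
    · have := hmul _ _ n h1; omega
    · have := hmul _ _ n h1; omega

theorem PassFrame.invAt {i' : ℕ} (hf : PassFrame n i σ σ') (hi : i' ≠ i)
    (hst : Net n (σ.A aDeg) (fun x k => σ.A aAdj (x * n + k)) Γ) (H : InvAt n i' Γ h cap σ) :
    InvAt n i' Γ h cap σ' := by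
  rw [InvAt, hf.arrs aDeg (by decide) (by decide) (by decide) (by decide) (by decide) (by decide)
    (by decide) (by decide) (by decide), hf.arrs aAdj (by decide) (by decide) (by decide)
    (by decide) (by decide) (by decide) (by decide) (by decide) (by decide)]
  exact ScaleData.Inv.congr hst H (hf.other i' hi) (hf.other_cov i' hi)

theorem PassFrame.coveredAt {i' : ℕ} (hf : PassFrame n i σ σ') (hi : i' ≠ i)
    (hn : (scaleAt n i' σ).num ≤ n) (H : CoveredAt n i' Γ h σ) : CoveredAt n i' Γ h σ' := by
  intro x hx hlt
  obtain ⟨h1, h2⟩ := H x hx hlt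
  rw [ScaleData.Covered, hf.other_cov i' hi x hx, (hf.other i' hi).num,
    (hf.other i' hi).lab _ (by omega) x hx]
  exact ⟨h1, h2⟩

end

variable {w : ℕ} [hw : Fact (16 < 2 ^ w)] {n X s i : ℕ} {hs caps : ℕ → ℕ} {Γ : SimpleGraph ℕ}
  {σ : State} {Tm : ℕ}

theorem run_scalePass {u v : ℕ} (hp : Params n X s hs caps)
    (hc : Common w n X s hs caps (Γ.deleteEdges {s(u, v)}) σ) (hi : i < s) (hI : σ.reg rI = i)
    (hnet : Net n (σ.A aDeg) (fun x k => σ.A aAdj (x * n + k)) Γ)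
    (hbig : BigRep n (Γ.deleteEdges {s(u, v)}) (hs i) σ)
    (hu : u < n) (hv : v < n) (hU : σ.reg rU = u) (hV : σ.reg rV = v)
    (H : InvAt n i Γ (hs i) (caps i) σ) :
    Run w scalePass σ Tm fun σ' Tm' => PassFrame n i σ σ' ∧
      InvAt n i (Γ.deleteEdges {s(u, v)}) (hs i) (caps i) σ' ∧
      CoveredAt n i (Γ.deleteEdges {s(u, v)}) (hs i) σ' ∧
      BigRep n (Γ.deleteEdges {s(u, v)}) (hs (i + 1)) σ' ∧
      Tm' + (scaleAt n i σ').pot n (σ.A aDeg) (hs i) (caps i) ≤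
        Tm + (scaleAt n i σ).pot n (σ.A aDeg) (hs i) (caps i) + 3100 * n + 400 := by
  have h16 := hw.out
  have hw0 : w ≠ 0 := by rintro rfl; simp at h16
  have hst := hc.static
  have hX := hst.addr
  have hnX : n ≤ X := (Nat.le_mul_self n).trans hst.sq_le
  have hindex := hp.index_le i hi
  obtain ⟨b1, b2, b3, b4⟩ := tree_index_le hindex (by omega) le_rfl
  have hidx2 : i * (n + 1) + n + 1 ≤ (i * (n + 1) + (n + 1)) * n :=
    Nat.le_mul_of_pos_right _ (by omega)
  have hrad := hc.radius i hi.le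
  have hrad' := hc.radius (i + 1) hi
  have hdep := hc.depth i hi
  have hadd := hp.add_le i hi
  have hmono := hp.mono i hi
  rw [scalePass]
  generalize htail : (updateTrees ;; updateCover) = tail
  simp [hI, hst.regN, and_assoc]
  rw [hrad, hrad', hdep]
  repeat refine And.intro (by omega) ?_
  subst htail
  generalize hσ₁ : (((((σ.setReg rH (hs i)).setReg rCap (caps i)).setReg rTb
    (i * (n + 1))).setReg rCb (i * n)).setReg rHn (hs (i + 1))) = σ₁
  have hreg : ∀ q, q < 26 ∨ 30 < q → σ₁.reg q = σ.reg q := by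
    intro q hq
    simp [← hσ₁, show q ≠ 26 by omega, show q ≠ 27 by omega, show q ≠ 28 by omega,
      show q ≠ 29 by omega, show q ≠ 30 by omega]
  have hA : ∀ k, σ₁.A k = σ.A k := by intro k; simp [← hσ₁]
  have hsc₁ : ∀ i', scaleAt n i' σ₁ = scaleAt n i' σ := by
    intro i'; simp only [scaleAt, hA]
  have hat : AtScale n X i (hs i) (caps i) σ₁ :=
    ⟨hindex, hp.pot_le i hi, hp.cap_le i hi, by omega, by rw [hreg _ (by omega), hI],
      by simp [← hσ₁], by simp [← hσ₁], by simp [← hσ₁], by simp [← hσ₁]⟩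
  have hHn : σ₁.reg rHn = hs (i + 1) := by simp [← hσ₁]
  have hst₁ : Static w n X (Γ.deleteEdges {s(u, v)}) σ₁ :=
    hst.transfer (hreg _ (by omega)) (hreg _ (by omega)) (hA _) (hA _) (hA _)
  rw [run_seq]
  refine (run_updateTrees (w := w) (X := X) hst₁ hat (by rw [hA, hA]; exact hnet)
    ⟨by rw [hA]; exact hbig.big, by rw [hA]; exact hbig.none⟩ hu hv
    ((hreg _ (by omega)).trans hU) ((hreg _ (by omega)).trans hV)
    (by rw [hA, hA, hsc₁]; exact H)).mono ?_
  rw [hA, hA, hA, hsc₁]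
  rintro σ₂ T₂ ⟨g1, g2, g3, g4⟩
  have f0 := g1.arrs aAdj (by decide) (by decide) (by decide) (by decide) (by decide) (by decide)
    (by decide) (by decide) (by decide)
  have f1 := g1.arrs aDeg (by decide) (by decide) (by decide) (by decide) (by decide) (by decide)
    (by decide) (by decide) (by decide)
  rw [hA] at f0 f1
  have e1 := g1.regs rHn (by decide) (by decide) (by decide) (by decide) (by decide) (by decide)
    (by decide) (by decide) (by decide) (by decide)
  refine (run_updateCover (w := w) (X := X) (g1.static hst₁) (g1.atScale hat) (e1.trans hHn) hmono
    hadd (by rw [f0, f1]; exact g3) ⟨by rw [g2]; exact hbig.big, by rw [g2]; exact hbig.none⟩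
    (by omega)).mono ?_
  rw [f0, f1]
  rintro σ₃ T₃ ⟨k1, k2, k3, k4, k5⟩
  have hf := (g1.trans k1).passFrame
  refine ⟨⟨fun q h1 h2 => by rw [hf.regs q h1 h2, hreg q h2],
    fun k hk h1 h2 h3 h4 h5 h6 h7 h8 => by rw [hf.arrs k hk h1 h2 h3 h4 h5 h6 h7 h8, hA],
    fun i' hi' => hsc₁ i' ▸ hf.other i' hi', fun i' hi' => hsc₁ i' ▸ hf.other_cov i' hi'⟩, ?_, k3,
    k4, by omega⟩
  rw [InvAt, hf.arrs aDeg (by decide) (by decide) (by decide) (by decide) (by decide) (by decide)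
    (by decide) (by decide) (by decide), hf.arrs aAdj (by decide) (by decide) (by decide)
    (by decide) (by decide) (by decide) (by decide) (by decide) (by decide), hA, hA]
  exact k2

theorem csize_pos {x : ℕ} (hx : x < n) : 0 < csize n Γ x := by
  classical
  exact card_pos.2 ⟨x, by simp only [mem_filter, mem_range]; exact ⟨hx, .refl _⟩⟩

theorem run_setFlags (hN : σ.reg rN = n) (hX : σ.reg 31 + 16 * n + 16 ≤ 2 ^ w) :
    Run w setFlags σ Tm fun σ' Tm' => (∀ q ≠ rK, σ'.reg q = σ.reg q) ∧
      (∀ k < 16, k ≠ aBig → σ'.A k = σ.A k) ∧ (∀ x ≤ n, σ'.A aBig x = 1) ∧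
      Tm' ≤ Tm + 40 * n + 100 := by
  have h16 := hw.out
  have hw0 : w ≠ 0 := by rintro rfl; simp at h16
  simp only [setFlags, run_seq, run_assign]
  refine ⟨by simp, ?_⟩
  refine run_while (fun σ₁ T₁ => (∀ q ≠ rK, σ₁.reg q = σ.reg q) ∧
      (∀ k < 16, k ≠ aBig → σ₁.A k = σ.A k) ∧ σ₁.reg rK ≤ n + 1 ∧
      (∀ x < σ₁.reg rK, σ₁.A aBig x = 1) ∧ T₁ + 40 * (n + 1 - σ₁.reg rK) ≤ Tm + 40 * n + 50)
    (Tm + 40 * n + 50) (by intros; omega) ?_ ?_ ?_ ?_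
  · rintro σ₁ T₁ ⟨g1, -⟩
    have e1 := g1 rN (by decide)
    simp [e1, hN]
    omega
  · rintro σ₁ T₁ ⟨g1, g2, g3, g4, g5⟩ hc
    have e1 := g1 rN (by decide)
    have e2 := g1 31 (by decide)
    simp [e1, hN] at hc
    simp [e2, and_assoc]
    repeat refine And.intro (by omega) ?_
    refine ⟨fun q hq => by simp [hq, g1], fun k hk h1 => by simp [hk, h1, g2], by omega,
      fun x hx => ?_, by omega⟩
    rw [State.A_setA_same]
    split_ifs with h1
    · rfl
    · exact g4 x (by omega)
  · rintro σ₁ T₁ ⟨g1, g2, g3, g4, g5⟩ hc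
    have e1 := g1 rN (by decide)
    simp [e1, hN] at hc
    refine ⟨g1, g2, fun x hx => g4 x (by omega), ?_⟩
    simp
    omega
  · refine ⟨fun q hq => by simp [hq], fun k hk h1 => by simp, by simp, by simp, ?_⟩
    simp
    omega

/-- The pass restores the invariants of all scales. The flags for the scale `0`, where the radius is `0`,
are all set, and every scale provides the flags for the next one. -/
theorem run_pass {u v : ℕ} (hp : Params n X s hs caps)
    (hc : Common w n X s hs caps (Γ.deleteEdges {s(u, v)}) σ)
    (hnet : Net n (σ.A aDeg) (fun x k => σ.A aAdj (x * n + k)) Γ)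
    (hu : u < n) (hv : v < n) (hU : σ.reg rU = u) (hV : σ.reg rV = v)
    (H : ∀ i < s, InvAt n i Γ (hs i) (caps i) σ) :
    Run w pass σ Tm fun σ' Tm' => Common w n X s hs caps (Γ.deleteEdges {s(u, v)}) σ' ∧
      (∀ i < s, InvAt n i (Γ.deleteEdges {s(u, v)}) (hs i) (caps i) σ' ∧
        CoveredAt n i (Γ.deleteEdges {s(u, v)}) (hs i) σ') ∧ σ'.A aDeg = σ.A aDeg ∧
      Tm' + ∑ i ∈ range s, (scaleAt n i σ').pot n (σ.A aDeg) (hs i) (caps i) ≤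
        Tm + ∑ i ∈ range s, (scaleAt n i σ).pot n (σ.A aDeg) (hs i) (caps i) +
          4000 * ((s + 1) * n) := by
  have h16 := hw.out
  have hw0 : w ≠ 0 := by rintro rfl; simp at h16
  have hX := hc.static.addr
  have hnX : n ≤ X := (Nat.le_mul_self n).trans hc.static.sq_le
  have hsX := hp.num_le
  have hnum : ∀ i < s, ∀ Γ', Net n (σ.A aDeg) (fun x k => σ.A aAdj (x * n + k)) Γ' →
      ∀ σ' : State, σ'.A aDeg = σ.A aDeg → σ'.A aAdj = σ.A aAdj →
      InvAt n i Γ' (hs i) (caps i) σ' → (scaleAt n i σ').num ≤ n := by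
    intro i hi Γ' hnet' σ' h1 h2 h3
    rw [InvAt, h1, h2] at h3
    exact h3.num_le hnet'
  simp only [pass, run_seq, run_assign]
  refine (run_setFlags (w := w) hc.static.regN (by omega)).mono ?_
  rintro σ₀ T₀ ⟨r1, r2, r3, r4⟩
  have hsc₀ : ∀ i', scaleAt n i' (σ₀.setReg rI 0) = scaleAt n i' σ := by
    intro i'
    simp [scaleAt, r2 aNum (by decide) (by decide), r2 aRoot (by decide) (by decide),
      r2 aCnt (by decide) (by decide), r2 aLab (by decide) (by decide),
      r2 aPtr (by decide) (by decide), r2 aCov (by decide) (by decide)]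
  have hd₀ := r2 aDeg (by decide) (by decide)
  have ha₀ := r2 aAdj (by decide) (by decide)
  refine ⟨by simp, ?_⟩
  simp only [Expr.val_const]
  -- the scales below `rI` satisfy the invariant for the new graph, the others for the old one
  refine run_while (fun σ₁ T₁ => Common w n X s hs caps (Γ.deleteEdges {s(u, v)}) σ₁ ∧
      σ₁.A aDeg = σ.A aDeg ∧ σ₁.A aAdj = σ.A aAdj ∧ σ₁.reg rU = u ∧ σ₁.reg rV = v ∧
      σ₁.reg rI ≤ s ∧ BigRep n (Γ.deleteEdges {s(u, v)}) (hs (σ₁.reg rI)) σ₁ ∧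
      (∀ i < σ₁.reg rI, InvAt n i (Γ.deleteEdges {s(u, v)}) (hs i) (caps i) σ₁ ∧
        CoveredAt n i (Γ.deleteEdges {s(u, v)}) (hs i) σ₁) ∧
      (∀ i, σ₁.reg rI ≤ i → i < s → InvAt n i Γ (hs i) (caps i) σ₁) ∧
      T₁ + ∑ i ∈ range s, (scaleAt n i σ₁).pot n (σ.A aDeg) (hs i) (caps i) +
          (3100 * n + 500) * (s - σ₁.reg rI) ≤
        Tm + ∑ i ∈ range s, (scaleAt n i σ).pot n (σ.A aDeg) (hs i) (caps i) +
          (3100 * n + 500) * s + 40 * n + 200)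
    (Tm + ∑ i ∈ range s, (scaleAt n i σ).pot n (σ.A aDeg) (hs i) (caps i) +
          (3100 * n + 500) * s + 40 * n + 200) (by intros; omega) ?_ ?_ ?_ ?_
  · intros; simp
  · rintro σ₁ T₁ ⟨g1, g2, g3, g4, g5, g6, g7, g8, g9, g10⟩ hcond
    obtain ⟨i, hi⟩ : ∃ i, σ₁.reg rI = i := ⟨_, rfl⟩
    simp [g1.regNum, hi] at hcond
    rw [hi] at g6 g7 g8 g9 g10
    rw [run_seq]
    refine (run_scalePass (w := w) hp g1 hcond hi (by rw [g2, g3]; exact hnet) g7 hu hv g4 g5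
      (g9 i le_rfl hcond)).mono ?_
    rintro σ₂ T₂ ⟨k1, k2, k3, k4, k5⟩
    have e1 := k1.regs rI (by omega) (by omega)
    have m1 := k1.arrs aDeg (by decide) (by decide) (by decide) (by decide) (by decide) (by decide)
      (by decide) (by decide) (by decide)
    have m2 := k1.arrs aAdj (by decide) (by decide) (by decide) (by decide) (by decide) (by decide)
      (by decide) (by decide) (by decide)
    have hsc : ∀ i' v, scaleAt n i' (σ₂.setReg rI v) = scaleAt n i' σ₂ := by
      intro i' v; simp [scaleAt]
    have hinv : ∀ Γ' i' v h' c', InvAt n i' Γ' h' c' (σ₂.setReg rI v) ↔ InvAt n i' Γ' h' c' σ₂ := by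
      intro Γ' i' v h' c'; simp [InvAt, hsc]
    simp only [run_assign, Expr.val_add, Expr.val_reg, Expr.val_const, e1, hi, hsc, hinv,
      State.reg_setReg_same, CoveredAt]
    refine ⟨by simp [e1, hi]; omega, ?_, ?_, ?_, ?_, ?_, by omega, ?_, ?_, ?_, ?_⟩
    · refine (k1.common g1).transfer ?_ ?_ ?_ ?_
      all_goals simp
    · simp [m1, g2]
    · simp [m2, g3]
    · simp [k1.regs rU (by omega) (by omega), g4]
    · simp [k1.regs rV (by omega) (by omega), g5]
    · exact ⟨by simpa using k4.big, by simpa using k4.none⟩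
    · intro i' hi'
      rcases Nat.lt_succ_iff_lt_or_eq.1 hi' with h1 | rfl
      · obtain ⟨h2, h3⟩ := g8 i' h1
        exact ⟨k1.invAt h1.ne g1.static.net h2, k1.coveredAt h1.ne
          (hnum i' (by omega) _ (g2 ▸ g3 ▸ g1.static.net) _ g2 g3 h2) h3⟩
      · exact ⟨k2, k3⟩
    · intro i' h1 h2
      exact k1.invAt (by omega) (by rw [g2, g3]; exact hnet) (g9 i' (by omega) h2)
    · have hmem := mem_range.2 hcond
      have s1 := add_sum_erase (range s) (fun i => (scaleAt n i σ₂).pot n (σ.A aDeg) (hs i)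
        (caps i)) hmem
      have s2 := add_sum_erase (range s) (fun i => (scaleAt n i σ₁).pot n (σ.A aDeg) (hs i)
        (caps i)) hmem
      have s3 : ∑ i ∈ (range s).erase i, (scaleAt n i σ₂).pot n (σ.A aDeg) (hs i) (caps i) =
          ∑ i ∈ (range s).erase i, (scaleAt n i σ₁).pot n (σ.A aDeg) (hs i) (caps i) := by
        refine sum_congr rfl fun i' hi' => ?_
        rw [mem_erase, mem_range] at hi'
        refine ScaleData.pot_congr ?_ (k1.other i' hi'.1) (k1.other_cov i' hi'.1)
        rcases Nat.lt_or_ge i' i with h1 | h1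
        · exact hnum i' (by omega) _ (g2 ▸ g3 ▸ g1.static.net) _ g2 g3 (g8 i' h1).1
        · exact hnum i' (by omega) _ hnet _ g2 g3 (g9 i' h1 hi'.2)
      have s4 : (3100 * n + 500) * (s - i) = (3100 * n + 500) * (s - (i + 1)) + 3100 * n + 500 := by
        rw [show s - i = s - (i + 1) + 1 by omega]; ring
      rw [g2] at k5
      simp only [Expr.cost_lt, Expr.cost_reg, Expr.cost_add, Expr.cost_const] at k5 ⊢
      omega
  · rintro σ₁ T₁ ⟨g1, g2, g3, g4, g5, g6, g7, g8, g9, g10⟩ hcond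
    simp [g1.regNum] at hcond
    have hi : σ₁.reg rI = s := by omega
    rw [hi] at g8 g10
    refine ⟨g1, g8, g2, ?_⟩
    have s5 : (3100 * n + 500) * s + 40 * n + 204 ≤ 4000 * ((s + 1) * n) := by
      have : s ≤ s * n := Nat.le_mul_of_pos_right _ (by omega)
      have h1 : (3100 * n + 500) * s = 3100 * (s * n) + 500 * s := by ring
      have h2 : 4000 * ((s + 1) * n) = 4000 * (s * n) + 4000 * n := by ring
      omega
    simp only [Expr.cost_lt, Expr.cost_reg]
    omega
  · refine ⟨?_, ?_, ?_, ?_, ?_, by simp, ⟨?_, ?_⟩, by simp, ?_, ?_⟩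
    · refine hc.transfer ?_ ?_ ?_ ?_
      · simp [r1]
      · simp [r1]
      · simp [r1]
      · intro k hk h1 h2 h3 h4 h5 h6 h7 h8; simp [r2 k hk h8]
    · simp [hd₀]
    · simp [ha₀]
    · simp [r1, hU]
    · simp [r1, hV]
    · -- every component has more than `hs 0 = 0` vertices
      intro x hx
      left
      simp [hp.zero, r3 x hx.le, csize_pos hx]
    · simp [r3 n le_rfl]
    · intro i _ hi
      have := H i hi
      rw [InvAt] at this ⊢
      rw [hsc₀]
      simpa [hd₀, ha₀] using this
    · simp only [hsc₀, State.reg_setReg_same, Expr.cost_const, Nat.sub_zero]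
      omega

end DecrementalAPSP

namespace DecrementalAPSP
open WordRAM Finset Expr Cmd

/-! ### Deletions -/

/-- The program for the deletion of an edge. -/
def deleteEdge : Cmd :=
  rU ::= reg 0 ;;
  rV ::= reg 1 ;;
  setArr aAlive (reg rU * reg rN + reg rV) (const 0) ;;
  setArr aAlive (reg rV * reg rN + reg rU) (const 0) ;;
  pass

/-- The state of the data structure between two operations, when the current graph is `Γ`. -/
structure Good (w n X s : ℕ) (hs caps : ℕ → ℕ) (Γ : SimpleGraph ℕ) (σ : State) : Prop where
  common : Common w n X s hs caps Γ σ
  inv : ∀ i < s, InvAt n i Γ (hs i) (caps i) σ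
  covered : ∀ i < s, CoveredAt n i Γ (hs i) σ

/-- The sum of the potentials of all scales. -/
def totalPot (n s : ℕ) (hs caps : ℕ → ℕ) (σ : State) : ℕ :=
  ∑ i ∈ range s, (scaleAt n i σ).pot n (σ.A aDeg) (hs i) (caps i)

theorem Net.mono {n : ℕ} {deg : ℕ → ℕ} {adj : ℕ → ℕ → ℕ} {Γ Γ' : SimpleGraph ℕ}
    (h : Net n deg adj Γ) (hle : Γ' ≤ Γ) : Net n deg adj Γ' :=
  ⟨h.deg_le, h.adj_lt, fun x y hxy => h.mem_adj x y (hle hxy)⟩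

theorem mul_add_inj {n x y x' y' : ℕ} (hy : y < n) (hy' : y' < n) :
    x * n + y = x' * n + y' ↔ x = x' ∧ y = y' := by
  constructor
  · intro h
    have hx : x = x' := by
      rcases Nat.lt_trichotomy x x' with h1 | h1 | h1
      · nlinarith
      · exact h1
      · nlinarith
    subst hx
    exact ⟨rfl, by omega⟩
  · rintro ⟨rfl, rfl⟩; rfl

section
variable {w n X s : ℕ} {hs caps : ℕ → ℕ} {Γ : SimpleGraph ℕ} {σ σ' : State}

theorem scaleAt_congr (ha : σ'.A = σ.A) (i : ℕ) : scaleAt n i σ' = scaleAt n i σ := by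
  simp only [scaleAt, ha]

/-- The data structure is not affected by changes of the registers that are used for arguments,
results, and intermediate values. -/
theorem Good.transfer (h : Good w n X s hs caps Γ σ) (ha : σ'.A = σ.A)
    (hr : ∀ q, 14 < q → σ'.reg q = σ.reg q) : Good w n X s hs caps Γ σ' := by
  refine ⟨h.common.transfer (hr _ (by decide)) (hr _ (by decide)) (hr _ (by decide))
    (fun k _ _ _ _ _ _ _ _ _ => by rw [ha]), fun i hi => ?_, fun i hi => ?_⟩
  · have := h.inv i hi
    rw [InvAt] at this ⊢
    rwa [scaleAt_congr ha, ha]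
  · have := h.covered i hi
    rw [CoveredAt] at this ⊢
    rwa [scaleAt_congr ha]

theorem totalPot_congr (ha : σ'.A = σ.A) : totalPot n s hs caps σ' = totalPot n s hs caps σ := by
  simp only [totalPot, scaleAt_congr ha, ha]

end

variable {w : ℕ} [hw : Fact (16 < 2 ^ w)] {n X s : ℕ} {hs caps : ℕ → ℕ} {Γ : SimpleGraph ℕ}
  {σ : State} {Tm : ℕ}

/-- A deletion restores the state between operations. The time of all deletions together is bounded by
the initial potential and a term `O(n log n)` per deletion. -/
theorem run_deleteEdge {u v : ℕ} (hp : Params n X s hs caps) (hg : Good w n X s hs caps Γ σ)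
    (hu : u < n) (hv : v < n) (h0 : σ.reg 0 = u) (h1 : σ.reg 1 = v) :
    Run w deleteEdge σ Tm fun σ' Tm' => Good w n X s hs caps (Γ.deleteEdges {s(u, v)}) σ' ∧
      Tm' + totalPot n s hs caps σ' ≤ Tm + totalPot n s hs caps σ + 4000 * ((s + 1) * n) + 100 := by
  have h16 := hw.out
  have hw0 : w ≠ 0 := by rintro rfl; simp at h16
  have hst := hg.common.static
  have hX := hst.addr
  have hsq := hst.sq_le
  have huv := mul_add_lt hu hv
  have hvu := mul_add_lt hv hu
  have hnX : n ≤ X := (Nat.le_mul_self n).trans hsq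
  rw [deleteEdge]
  generalize hpass : pass = pass'
  simp [h0, h1, hst.regN, and_assoc]
  repeat refine And.intro (by omega) ?_
  subst hpass
  generalize hσ₁ : (((σ.setReg rU u).setReg rV v).setA aAlive (u * n + v) 0).setA aAlive
    (v * n + u) 0 = σ₁
  have hA : ∀ k < 16, k ≠ aAlive → σ₁.A k = σ.A k := by
    intro k hk hk'; simp [← hσ₁, hk, hk']
  have hreg : ∀ q, q ≠ rU → q ≠ rV → σ₁.reg q = σ.reg q := by
    intro q h1 h2; simp [← hσ₁, h1, h2]
  have hsc : ∀ i, scaleAt n i σ₁ = scaleAt n i σ := by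
    intro i
    simp [scaleAt, hA aNum (by decide) (by decide), hA aRoot (by decide) (by decide),
      hA aCnt (by decide) (by decide), hA aLab (by decide) (by decide),
      hA aPtr (by decide) (by decide), hA aCov (by decide) (by decide)]
  have f0 := hA aAdj (by decide) (by decide)
  have f1 := hA aDeg (by decide) (by decide)
  have hle : Γ.deleteEdges {s(u, v)} ≤ Γ := SimpleGraph.deleteEdges_le _
  have hc₁ : Common w n X s hs caps (Γ.deleteEdges {s(u, v)}) σ₁ := by
    refine ⟨⟨?_, hst.sq_le, ?_, ?_, ?_⟩, ?_, ?_, ?_⟩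
    · rw [hreg _ (by decide) (by decide)]; exact hst.addr
    · rw [hreg _ (by decide) (by decide)]; exact hst.regN
    · intro x hx y hy
      have key : σ₁.A aAlive (x * n + y) = if s(x, y) = s(u, v) then 0 else
          σ.A aAlive (x * n + y) := by
        simp only [← hσ₁, State.A_setA_same, mul_add_inj hy hu, mul_add_inj hy hv,
          State.A_setReg _ _ _ (show 31 ≠ rU by decide),
          State.A_setReg _ _ _ (show 31 ≠ rV by decide), Sym2.eq_iff]
        split_ifs <;> first | rfl | (exfalso; tauto)
      rw [key, SimpleGraph.deleteEdges_adj, Set.mem_singleton_iff]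
      have := hst.alive x hx y hy
      split_ifs with h2
      · exact .inr ⟨fun h3 => h3.2 h2, rfl⟩
      · simpa [h2] using this
    · rw [f0, f1]; exact hst.net.mono hle
    · rw [hreg _ (by decide) (by decide)]; exact hg.common.regNum
    · rw [hA aH (by decide) (by decide)]; exact hg.common.radius
    · rw [hA aCap (by decide) (by decide)]; exact hg.common.depth
  refine (run_pass (w := w) (Γ := Γ) (u := u) (v := v) hp hc₁ (by rw [f0, f1]; exact hst.net) hu hv
    (by simp [← hσ₁]) (by simp [← hσ₁]) fun i hi => ?_).mono ?_
  · rw [InvAt, hsc, f0, f1]; exact hg.inv i hi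
  rw [f1]
  simp only [hsc]
  rintro σ' T' ⟨k1, k2, k3, k4⟩
  refine ⟨⟨k1, fun i hi => (k2 i hi).1, fun i hi => (k2 i hi).2⟩, ?_⟩
  rw [totalPot, totalPot, k3]
  omega

/-! ### Initialization -/

/-- Insert the arc from the content of the register `a` to that of `b`. -/
def addArc (a b : ℕ) : Cmd :=
  setArr aAlive (reg a * reg rN + reg b) (const 1) ;;
  setArr aAdj (reg a * reg rN + arr aDeg (reg a)) (reg b) ;;
  setArr aDeg (reg a) (arr aDeg (reg a) + const 1)

/-- Build the adjacency lists. The list of the edges ends at the address in register `31`, where the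
arrays begin. -/
def buildLists : Cmd :=
  rK ::= const 0 ;;
  .while (lt (reg rK) (reg 31)) (
    rU ::= load (reg rK) ;;
    rV ::= load (reg rK + const 1) ;;
    addArc rU rV ;;
    addArc rV rU ;;
    rK ::= reg rK + const 2)

/-- Compute the number of scales, their radii and their depths. -/
def buildScales : Cmd :=
  .ite (lt (reg 3) (reg 2)) (2 ::= reg 3) .skip ;;
  rX ::= const 1 ;;
  rNum ::= const 0 ;;
  .while (lt (reg rX) (reg rN)) (
    setArr aH (reg rNum) (reg 2 * reg rX / (const 4 * reg 3)) ;;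
    setArr aCap (reg rNum) (const 4 * reg rX) ;;
    rX ::= reg rX + reg rX ;;
    rNum ::= reg rNum + const 1) ;;
  setArr aH (reg rNum) (reg 2 * reg rX / (const 4 * reg 3))

/-- The program for the initialization. The pass over the scales opens the first centres; it is
called with the vertex `0` in both registers for the ends of the deleted edge, which does not change
the graph, as it has no loops. -/
def setup : Cmd :=
  rN ::= reg 0 ;;
  31 ::= reg 1 + reg 1 ;;
  buildLists ;;
  buildScales ;;
  rU ::= const 0 ;;
  rV ::= const 0 ;;
  pass

/-- The adjacency lists and the adjacency matrix in the memory represent the relation `R`. -/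
structure ArcRep (n : ℕ) (R : ℕ → ℕ → Prop) (σ : State) : Prop where
  adj_lt : ∀ x < n, ∀ k < σ.A aDeg x, σ.A aAdj (x * n + k) < n
  inj : ∀ x < n, ∀ k < σ.A aDeg x, ∀ k' < σ.A aDeg x,
    σ.A aAdj (x * n + k) = σ.A aAdj (x * n + k') → k = k'
  mem : ∀ x < n, ∀ y, R x y ↔ ∃ k < σ.A aDeg x, σ.A aAdj (x * n + k) = y
  alive : ∀ x < n, ∀ y < n, R x y ∧ σ.A aAlive (x * n + y) = 1 ∨
    ¬ R x y ∧ σ.A aAlive (x * n + y) = 0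

theorem ArcRep.deg_le {R : ℕ → ℕ → Prop} (h : ArcRep n R σ) {x : ℕ} (hx : x < n) :
    σ.A aDeg x ≤ n := by
  have h1 : #(image (fun k => σ.A aAdj (x * n + k)) (range (σ.A aDeg x))) = σ.A aDeg x := by
    rw [card_image_of_injOn, card_range]
    intro k hk k' hk' he
    exact h.inj x hx k (by simpa using hk) k' (by simpa using hk') he
  rw [← h1]
  conv_rhs => rw [← card_range n]
  refine card_le_card fun y hy => ?_
  rw [mem_image] at hy
  obtain ⟨k, hk, rfl⟩ := hy
  exact mem_range.2 (h.adj_lt x hx k (mem_range.1 hk))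

/-- A list that lacks a vertex has room for one more entry. -/
theorem ArcRep.deg_lt {R : ℕ → ℕ → Prop} (h : ArcRep n R σ) {x y : ℕ} (hx : x < n) (hy : y < n)
    (hxy : ¬ R x y) : σ.A aDeg x < n := by
  have h1 : #(image (fun k => σ.A aAdj (x * n + k)) (range (σ.A aDeg x))) = σ.A aDeg x := by
    rw [card_image_of_injOn, card_range]
    intro k hk k' hk' he
    exact h.inj x hx k (by simpa using hk) k' (by simpa using hk') he
  rw [← h1]
  conv_rhs => rw [← card_range n]
  refine card_lt_card (ssubset_iff_of_subset (fun z hz => ?_) |>.2 ⟨y, mem_range.2 hy, fun hz => ?_⟩)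
  all_goals
    rw [mem_image] at hz
    obtain ⟨k, hk, rfl⟩ := hz
    rw [mem_range] at hk
  · exact mem_range.2 (h.adj_lt x hx k hk)
  · exact hxy ((h.mem x hx _).2 ⟨k, hk, rfl⟩)

theorem run_addArc {R : ℕ → ℕ → Prop} {a b x y : ℕ} (hN : σ.reg rN = n)
    (hX : σ.reg 31 + 16 * X + 16 ≤ 2 ^ w) (hsq : n * n ≤ X) (ha : σ.reg a = x) (hb : σ.reg b = y)
    (hx : x < n) (hy : y < n) (hxy : ¬ R x y) (h : ArcRep n R σ) :
    Run w (addArc a b) σ Tm fun σ' Tm' => ArcRep n (fun x' y' => R x' y' ∨ x' = x ∧ y' = y) σ' ∧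
      σ'.reg = σ.reg ∧ (∀ k < 16, 3 ≤ k → σ'.A k = σ.A k) ∧
      (∀ k < σ.reg 31, σ'.mem k = σ.mem k) ∧
      ∑ z ∈ range n, σ'.A aDeg z = ∑ z ∈ range n, σ.A aDeg z + 1 ∧ Tm' ≤ Tm + 60 := by
  have h16 := hw.out
  have hw0 : w ≠ 0 := by rintro rfl; simp at h16
  have hnX : n ≤ X := (Nat.le_mul_self n).trans hsq
  have hdeg := h.deg_lt hx hy hxy
  have i1 := mul_add_lt hx hy
  have i2 := mul_add_lt hx hdeg
  simp [addArc, ha, hb, hN, and_assoc]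
  repeat refine And.intro (by omega) ?_
  have hd : ∀ z, (((σ.setA aAlive (x * n + y) 1).setA aAdj (x * n + σ.A aDeg x) y).setA aDeg x
      (σ.A aDeg x + 1)).A aDeg z = if z = x then σ.A aDeg x + 1 else σ.A aDeg z := by
    intro z; simp [State.A_setA_same]
  have hadj : ∀ z, (((σ.setA aAlive (x * n + y) 1).setA aAdj (x * n + σ.A aDeg x) y).setA aDeg x
      (σ.A aDeg x + 1)).A aAdj z = if z = x * n + σ.A aDeg x then y else σ.A aAdj z := by
    intro z; simp [State.A_setA_same]
  have hal : ∀ z, (((σ.setA aAlive (x * n + y) 1).setA aAdj (x * n + σ.A aDeg x) y).setA aDeg x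
      (σ.A aDeg x + 1)).A aAlive z = if z = x * n + y then 1 else σ.A aAlive z := by
    intro z; simp [State.A_setA_same]
  have hmem : ∀ k < σ.reg 31, (((σ.setA aAlive (x * n + y) 1).setA aAdj (x * n + σ.A aDeg x)
      y).setA aDeg x (σ.A aDeg x + 1)).mem k = σ.mem k := by
    intro k hk
    exact (State.mem_setA _ (by exact hk)).trans
      ((State.mem_setA _ (by exact hk)).trans (State.mem_setA _ hk))
  have hother : ∀ k < 16, 3 ≤ k → (((σ.setA aAlive (x * n + y) 1).setA aAdj (x * n + σ.A aDeg x)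
      y).setA aDeg x (σ.A aDeg x + 1)).A k = σ.A k := by
    intro k hk hk'
    simp [hk, show k ≠ 0 by omega, show k ≠ 1 by omega, show k ≠ 2 by omega]
  generalize ((σ.setA aAlive (x * n + y) 1).setA aAdj (x * n + σ.A aDeg x) y).setA aDeg x
      (σ.A aDeg x + 1) = σ' at *
  have hold : ∀ z < n, ∀ k < σ.A aDeg z, σ'.A aAdj (z * n + k) = σ.A aAdj (z * n + k) := by
    intro z hz k hk
    have hk' : k < n := hk.trans_le (h.deg_le hz)
    rw [hadj, if_neg]
    rw [mul_add_inj hk' hdeg]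
    rintro ⟨rfl, rfl⟩
    omega
  have hnew : σ'.A aAdj (x * n + σ.A aDeg x) = y := by rw [hadj, if_pos rfl]
  have hcases : ∀ z < n, ∀ k < σ'.A aDeg z, k < σ.A aDeg z ∨ z = x ∧ k = σ.A aDeg x := by
    intro z _ k hk
    rw [hd] at hk
    split_ifs at hk with h1
    · subst h1; omega
    · exact .inl hk
  have hfresh : ∀ k < σ.A aDeg x, σ.A aAdj (x * n + k) ≠ y := fun k hk he =>
    hxy ((h.mem x hx y).2 ⟨k, hk, he⟩)
  refine ⟨⟨?_, ?_, ?_, ?_⟩, hother, hmem, ?_⟩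
  · intro z hz k hk
    rcases hcases z hz k hk with h1 | ⟨rfl, rfl⟩
    · rw [hold z hz k h1]; exact h.adj_lt z hz k h1
    · rw [hnew]; exact hy
  · intro z hz k hk k' hk' he
    rcases hcases z hz k hk with h1 | ⟨rfl, rfl⟩ <;> rcases hcases z hz k' hk' with h2 | ⟨h2, rfl⟩
    · rw [hold z hz k h1, hold z hz k' h2] at he
      exact h.inj z hz k h1 k' h2 he
    · subst h2
      rw [hold z hz k h1, hnew] at he
      exact absurd he (hfresh k h1)
    · rw [hold z hz k' h2, hnew] at he
      exact absurd he.symm (hfresh k' h2)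
    · rfl
  · intro z hz y'
    rw [h.mem z hz]
    constructor
    · rintro (⟨k, hk, rfl⟩ | ⟨rfl, rfl⟩)
      · refine ⟨k, ?_, hold z hz k hk⟩
        rw [hd]; split_ifs with h1
        · subst h1; omega
        · exact hk
      · exact ⟨σ.A aDeg z, by rw [hd, if_pos rfl]; omega, hnew⟩
    · rintro ⟨k, hk, rfl⟩
      rcases hcases z hz k hk with h1 | ⟨rfl, rfl⟩
      · exact .inl ⟨k, h1, (hold z hz k h1).symm⟩
      · exact .inr ⟨rfl, hnew⟩
  · intro z hz y' hy'
    simp only [hal, mul_add_inj hy' hy]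
    have := h.alive z hz y' hy'
    split_ifs with h1
    · exact .inl ⟨.inr h1, rfl⟩
    · simpa [h1] using this
  · rw [← add_sum_erase _ _ (mem_range.2 hx), ← add_sum_erase _ (σ.A aDeg) (mem_range.2 hx), hd,
      if_pos rfl]
    have : ∑ z ∈ (range n).erase x, σ'.A aDeg z = ∑ z ∈ (range n).erase x, σ.A aDeg z :=
      sum_congr rfl fun z hz => by rw [hd, if_neg (ne_of_mem_erase hz)]
    omega

end DecrementalAPSP

namespace DecrementalAPSP
open WordRAM Finset Expr Cmd

/-! ### Reading the edges and computing the parameters -/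

/-- The arcs of the first `t` edges in the list with the ends `ea` and `eb`. -/
def Arcs (ea eb : ℕ → ℕ) (t x y : ℕ) : Prop :=
  ∃ t' < t, x = ea t' ∧ y = eb t' ∨ x = eb t' ∧ y = ea t'

theorem arcs_succ (ea eb : ℕ → ℕ) (t : ℕ) : Arcs ea eb (t + 1) = fun x y =>
    (Arcs ea eb t x y ∨ x = ea t ∧ y = eb t) ∨ x = eb t ∧ y = ea t := by
  funext x y
  refine propext ⟨?_, ?_⟩
  · rintro ⟨t', h1, h2⟩
    rcases Nat.lt_succ_iff_lt_or_eq.1 h1 with h1 | rfl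
    · exact .inl (.inl ⟨t', h1, h2⟩)
    · tauto
  · rintro ((⟨t', h1, h2⟩ | h) | h)
    · exact ⟨t', by omega, h2⟩
    · exact ⟨t, by omega, .inl h⟩
    · exact ⟨t, by omega, .inr h⟩

/-- The memory contains a list of `m` edges, without repetitions. -/
structure EdgeInput (n m : ℕ) (ea eb : ℕ → ℕ) (σ : State) : Prop where
  fst : ∀ t < m, σ.mem (2 * t) = ea t
  snd : ∀ t < m, σ.mem (2 * t + 1) = eb t
  fst_lt : ∀ t < m, ea t < n
  snd_lt : ∀ t < m, eb t < n
  ne : ∀ t < m, ea t ≠ eb t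
  fresh : ∀ t < m, ¬ Arcs ea eb t (ea t) (eb t)

variable {w : ℕ} [hw : Fact (16 < 2 ^ w)] {n X s : ℕ} {hs caps : ℕ → ℕ} {Γ : SimpleGraph ℕ}
  {σ : State} {Tm : ℕ}

theorem run_buildLists {m : ℕ} {ea eb : ℕ → ℕ} (hN : σ.reg rN = n) (h31 : σ.reg 31 = 2 * m)
    (hX : σ.reg 31 + 16 * X + 16 ≤ 2 ^ w) (hsq : n * n ≤ X) (hin : EdgeInput n m ea eb σ)
    (hrep : ArcRep n (fun _ _ => False) σ) (hdeg : ∑ z ∈ range n, σ.A aDeg z = 0) :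
    Run w buildLists σ Tm fun σ' Tm' => ArcRep n (Arcs ea eb m) σ' ∧
      (∀ q, q ≠ rK → q ≠ rU → q ≠ rV → σ'.reg q = σ.reg q) ∧
      (∀ k < 16, 3 ≤ k → σ'.A k = σ.A k) ∧ ∑ z ∈ range n, σ'.A aDeg z = 2 * m ∧
      Tm' ≤ Tm + 200 * m + 20 := by
  have h16 := hw.out
  have hw0 : w ≠ 0 := by rintro rfl; simp at h16
  simp only [buildLists, run_seq, run_assign]
  refine ⟨by simp, ?_⟩
  refine run_while (fun σ₁ T₁ => ∃ t ≤ m, σ₁.reg rK = 2 * t ∧ ArcRep n (Arcs ea eb t) σ₁ ∧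
      (∀ q, q ≠ rK → q ≠ rU → q ≠ rV → σ₁.reg q = σ.reg q) ∧
      (∀ k < 16, 3 ≤ k → σ₁.A k = σ.A k) ∧ (∀ k < 2 * m, σ₁.mem k = σ.mem k) ∧
      ∑ z ∈ range n, σ₁.A aDeg z = 2 * t ∧ T₁ + 200 * (m - t) ≤ Tm + 200 * m + 10)
    (Tm + 200 * m + 10) ?_ ?_ ?_ ?_ ?_
  · rintro σ₁ T₁ ⟨t, h1, h2, h3, h4, h5, h6, h7, h8⟩; omega
  · intros; simp
  · rintro σ₁ T₁ ⟨t, h1, h2, h3, h4, h5, h6, h7, h8⟩ hc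
    have e1 := h4 31 (by decide) (by decide) (by decide)
    have e2 := h4 rN (by decide) (by decide) (by decide)
    simp [e1, h31, h2] at hc
    have ha := hin.fst_lt t hc
    have hb := hin.snd_lt t hc
    simp only [run_seq, run_assign]
    simp [h2, h6 (2 * t) (by omega), h6 (2 * t + 1) (by omega), hin.fst t hc, hin.snd t hc,
      and_assoc]
    repeat refine And.intro (by omega) ?_
    generalize hσ₂ : (σ₁.setReg rU (ea t)).setReg rV (eb t) = σ₂
    have hA : ∀ k, σ₂.A k = σ₁.A k := by intro k; simp [← hσ₂]
    have hreg : ∀ q, q ≠ rU → q ≠ rV → σ₂.reg q = σ₁.reg q := by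
      intro q g1 g2; simp [← hσ₂, g1, g2]
    have hmem : σ₂.mem = σ₁.mem := by simp [← hσ₂]
    have hU : σ₂.reg rU = ea t := by simp [← hσ₂]
    have hV : σ₂.reg rV = eb t := by simp [← hσ₂]
    have hrep₂ : ArcRep n (Arcs ea eb t) σ₂ := by
      obtain ⟨r1, r2, r3, r4⟩ := h3
      constructor <;> (simp only [hA]; assumption)
    have e31 : σ₂.reg 31 = σ.reg 31 := (hreg _ (by decide) (by decide)).trans e1
    have eN : σ₂.reg rN = n := (hreg _ (by decide) (by decide)).trans (e2.trans hN)
    refine (run_addArc (w := w) (X := X) eN (by omega) hsq hU hV ha hb (hin.fresh t hc)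
      hrep₂).mono ?_
    rintro σ₃ T₃ ⟨k1, k2, k3, k4, k5, k6⟩
    refine (run_addArc (w := w) (X := X) (x := eb t) (y := ea t) (by rw [k2]; exact eN)
      (by rw [k2]; omega) hsq (by rw [k2, hV]) (by rw [k2, hU]) hb ha ?_ k1).mono ?_
    · rintro (⟨t', g1, g2⟩ | g1)
      · exact hin.fresh t hc ⟨t', g1, by tauto⟩
      · exact hin.ne t hc g1.2
    rintro σ₄ T₄ ⟨l1, l2, l3, l4, l5, l6⟩
    have eK : σ₄.reg rK = 2 * t := by rw [l2, k2, hreg _ (by decide) (by decide), h2]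
    simp [eK]
    have hA₅ : ∀ k, (σ₄.setReg rK (2 * t + 2)).A k = σ₄.A k := by intro k; simp
    refine ⟨by omega, t + 1, by omega, by omega, ?_, ?_, ?_, ?_, ?_, by omega⟩
    · rw [arcs_succ]
      obtain ⟨r1, r2, r3, r4⟩ := l1
      constructor <;> (simp only [hA₅]; assumption)
    · intro q g1 g2 g3
      rw [State.reg_setReg_ne _ _ g1, l2, k2, hreg q g2 g3, h4 q g1 g2 g3]
    · intro k hk hk'
      rw [l3 k hk hk', k3 k hk hk', hA, h5 k hk hk']
    · intro k hk
      rw [l4 k (by rw [k2]; omega), k4 k (by omega), hmem, h6 k hk]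
    · simp only [hA] at k5
      omega
  · rintro σ₁ T₁ ⟨t, h1, h2, h3, h4, h5, h6, h7, h8⟩ hc
    have e1 := h4 31 (by decide) (by decide) (by decide)
    simp [e1, h31, h2] at hc
    obtain rfl : t = m := by omega
    refine ⟨h3, h4, h5, h7, ?_⟩
    simp
    omega
  · have hA : ∀ k, (σ.setReg rK 0).A k = σ.A k := by intro k; simp
    simp only [Expr.val_const]
    refine ⟨0, by omega, by simp, ?_, ?_, ?_, ?_, ?_, ?_⟩
    · have : Arcs ea eb 0 = fun _ _ => False := by
        funext x y; simp [Arcs]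
      rw [this]
      obtain ⟨r1, r2, r3, r4⟩ := hrep
      constructor <;> (simp only [hA]; assumption)
    · intro q g1 _ _; simp [g1]
    · intros; simp
    · intros; simp
    · simp only [hA, hdeg]
    · simp
      omega

theorem run_buildScales {p q : ℕ} (hN : σ.reg rN = n) (hn : 2 ≤ n) (h2 : σ.reg 2 = p)
    (h3 : σ.reg 3 = q) (hX : σ.reg 31 + 16 * X + 16 ≤ 2 ^ w) (hnX : 8 * n ≤ X)
    (hqX : 4 * q ≤ X) (hqnX : q * (2 * n) ≤ X) (hsX : Nat.clog 2 n ≤ X) :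
    Run w buildScales σ Tm fun σ' Tm' => σ'.reg rNum = Nat.clog 2 n ∧
      (∀ i ≤ Nat.clog 2 n, σ'.A aH i = min p q * 2 ^ i / (4 * q)) ∧
      (∀ i < Nat.clog 2 n, σ'.A aCap i = 4 * 2 ^ i) ∧
      (∀ r, r ≠ 2 → r ≠ rX → r ≠ rNum → σ'.reg r = σ.reg r) ∧
      (∀ k < 16, k ≠ aH → k ≠ aCap → σ'.A k = σ.A k) ∧
      Tm' ≤ Tm + 100 * (Nat.clog 2 n + 1) := by
  have h16 := hw.out
  have hw0 : w ≠ 0 := by rintro rfl; simp at h16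
  have hmul : ∀ D, D < 2 * n → min p q * D ≤ X := fun D hD =>
    (Nat.mul_le_mul (min_le_right p q) hD.le).trans hqnX
  have hdiv : ∀ D, min p q * D / (4 * q) ≤ min p q * D := fun D => Nat.div_le_self _ _
  generalize hs : Nat.clog 2 n = s at *
  rw [buildScales]
  generalize htail : (rX ::= const 1 ;; rNum ::= const 0 ;; _ : Cmd) = tail
  -- the first step replaces `p` by the minimum of `p` and `q`
  suffices key : ∀ σ₀ T₀, σ₀.reg 2 = min p q → (∀ r, r ≠ 2 → σ₀.reg r = σ.reg r) →
      (∀ k < 16, σ₀.A k = σ.A k) → T₀ ≤ Tm + 10 → Run w tail σ₀ T₀ fun σ' Tm' =>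
      σ'.reg rNum = s ∧ (∀ i ≤ s, σ'.A aH i = min p q * 2 ^ i / (4 * q)) ∧
      (∀ i < s, σ'.A aCap i = 4 * 2 ^ i) ∧
      (∀ r, r ≠ 2 → r ≠ rX → r ≠ rNum → σ'.reg r = σ.reg r) ∧
      (∀ k < 16, k ≠ aH → k ≠ aCap → σ'.A k = σ.A k) ∧ Tm' ≤ Tm + 100 * (s + 1) by
    simp only [run_seq, run_ite, run_assign, run_skip]
    refine ⟨by simp, fun hc => ⟨by simp, ?_⟩, fun hc => ?_⟩
    · simp [h2, h3] at hc
      refine key _ _ ?_ ?_ ?_ ?_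
      · simp [h3]; omega
      · intro r hr; simp [hr]
      · intros; simp
      · simp
    · simp [h2, h3] at hc
      refine key _ _ ?_ ?_ ?_ ?_
      · rw [h2]; omega
      · intro r hr; rfl
      · intros; rfl
      · simp
  intro σ₀ T₀ g2 gr gA hT₀
  subst htail
  have e3 := (gr 3 (by decide)).trans h3
  have e31 := gr 31 (by decide)
  have eN := (gr rN (by decide)).trans hN
  simp only [run_seq, run_assign]
  refine ⟨by simp, by simp, ?_⟩
  refine run_while (fun σ₁ T₁ => ∃ i ≤ s, σ₁.reg rNum = i ∧ σ₁.reg rX = 2 ^ i ∧ 2 ^ i < 2 * n ∧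
      (∀ r, r ≠ rX → r ≠ rNum → σ₁.reg r = σ₀.reg r) ∧
      (∀ j < i, σ₁.A aH j = min p q * 2 ^ j / (4 * q)) ∧ (∀ j < i, σ₁.A aCap j = 4 * 2 ^ j) ∧
      (∀ k < 16, k ≠ aH → k ≠ aCap → σ₁.A k = σ.A k) ∧ T₁ + 60 * (s - i) ≤ Tm + 60 * s + 30)
    (Tm + 60 * s + 30) ?_ ?_ ?_ ?_ ?_
  · rintro σ₁ T₁ ⟨i, h1, -, -, -, -, -, -, -, h5⟩; omega
  · intros; simp
  · rintro σ₁ T₁ ⟨i, k1, k2, k3, k4, k5, k6, k7, k8, k9⟩ hc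
    have m1 := k5 2 (by decide) (by decide)
    have m2 := k5 3 (by decide) (by decide)
    have m3 := k5 31 (by decide) (by decide)
    have m4 := k5 rN (by decide) (by decide)
    simp [k3, m4, eN] at hc
    have hi : i < s := by
      rw [← hs]
      exact (Nat.lt_clog_iff_pow_lt (by norm_num)).2 hc
    have l1 := hmul _ k4
    have l2 := hdiv (2 ^ i)
    have l3 : (2 : ℕ) ^ (i + 1) = 2 ^ i + 2 ^ i := by ring
    simp [m1, m2, m3, g2, e3, e31, k2, k3, and_assoc]
    repeat refine And.intro (by omega) ?_
    refine ⟨?_, ?_, ?_, ?_, by omega⟩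
    · intro r r1 r2; simp [r1, r2, k5 r r1 r2]
    · intro j hj
      rw [State.A_setA_same]
      split_ifs with h1
      · rw [h1]
      · exact k6 j (by omega)
    · intro j hj
      rw [State.A_setA_same]
      split_ifs with h1
      · rw [h1]
      · simp [k7 j (by omega)]
    · intro k hk h1 h2; simp [hk, h1, h2, k8 k hk h1 h2]
  · rintro σ₁ T₁ ⟨i, k1, k2, k3, k4, k5, k6, k7, k8, k9⟩ hc
    have m1 := k5 2 (by decide) (by decide)
    have m2 := k5 3 (by decide) (by decide)
    have m3 := k5 31 (by decide) (by decide)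
    have m4 := k5 rN (by decide) (by decide)
    simp [k3, m4, eN] at hc
    obtain rfl : i = s := by
      refine le_antisymm k1 ?_
      rw [← hs]
      exact (Nat.clog_le_iff_le_pow (by norm_num)).2 hc
    have l1 := hmul _ k4
    have l2 := hdiv (2 ^ i)
    simp [m1, m2, m3, g2, e3, e31, k2, k3, and_assoc]
    repeat refine And.intro (by omega) ?_
    refine ⟨?_, ?_, ?_, ?_, by omega⟩
    · intro j hj
      rw [State.A_setA_same]
      split_ifs with h1
      · rw [h1]
      · exact k6 j (by omega)
    · exact k7
    · intro r r1 r2 r3; rw [k5 r r2 r3, gr r r1]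
    · intro k hk h1 h2; simp [hk, h1, h2, k8 k hk h1 h2]
  · refine ⟨0, by omega, by simp, by simp, by omega, ?_, by simp, by simp, ?_, ?_⟩
    · intro r r1 r2; simp [r1, r2]
    · intro k hk h1 h2; simp [gA k hk]
    · simp; omega

end DecrementalAPSP

namespace DecrementalAPSP
open WordRAM Finset Expr Cmd

/-- The radius `h` of the scale `i`, about `ε / 4` times the distances `2 ^ i` of this scale. The
precision `p / q` is replaced by `1` if it is larger. -/
def radius (p q i : ℕ) : ℕ := min p q * 2 ^ i / (4 * q)

theorem radius_mul_le (p q i : ℕ) : radius p q i * (4 * q) ≤ min p q * 2 ^ i :=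
  Nat.div_mul_le_self _ _

theorem radius_mul_four_le {q : ℕ} (hq : 0 < q) (p i : ℕ) : radius p q i * 4 ≤ 2 ^ i := by
  refine Nat.le_of_mul_le_mul_right ?_ hq
  calc radius p q i * 4 * q = radius p q i * (4 * q) := by ring
    _ ≤ min p q * 2 ^ i := radius_mul_le p q i
    _ ≤ q * 2 ^ i := Nat.mul_le_mul_right _ (min_le_right _ _)
    _ = 2 ^ i * q := mul_comm _ _

/-- The depth of the trees of the scale `i`. It suffices for distances below `2 ^ (i + 1)` from a vertex
that is covered, that is, whose label is at most `2 * radius p q i`. -/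
def depth (i : ℕ) : ℕ := 4 * 2 ^ i

theorem treePot_zero {n : ℕ} {deg : ℕ → ℕ} {cap D : ℕ} (hD : ∑ x ∈ range n, deg x = D) :
    treePot n deg cap (fun _ => 0) (fun _ => 0) = 600 * ((cap + 1) * (D + n)) + 250 * D := by
  subst hD
  simp only [treePot, labelPot, ptrPot, Nat.sub_zero, ← mul_sum, sum_add_distrib, sum_const,
    card_range, smul_eq_mul, mul_one]

/-- A bound for the initial potential of a scale with the radius `h` and the depth `cap`: one tree with
all labels `0` for each of the `n / (h + 1)` centres that may be opened. -/
def startPot (n m h cap : ℕ) : ℕ :=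
  n / (h + 1) * (600 * ((cap + 1) * (2 * m + n)) + 500 * m + 300 * n + 2000)

variable {w : ℕ} [hw : Fact (16 < 2 ^ w)] {n X : ℕ} {Γ : SimpleGraph ℕ} {σ : State} {Tm : ℕ}

/-- The initialization. Before the pass, there are no centres, so that the potential of a scale is that
of `n / (h + 1)` unopened centres. -/
theorem run_setup {m p q : ℕ} {ea eb : ℕ → ℕ} (hn : 2 ≤ n)
    (h0 : σ.reg 0 = n) (h1 : σ.reg 1 = m) (h2 : σ.reg 2 = p) (h3 : σ.reg 3 = q)
    (hmem : ∀ k, 2 * m ≤ k → σ.mem k = 0) (hin : EdgeInput n m ea eb σ)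
    (hΓ : ∀ x y, Γ.Adj x y ↔ Arcs ea eb m x y)
    (hp : Params n X (Nat.clog 2 n) (radius p q) depth)
    (hX : 2 * m + 16 * X + 16 ≤ 2 ^ w) (hsq : n * n ≤ X) (hnX : 8 * n ≤ X)
    (hqX : 4 * q ≤ X) (hqnX : q * (2 * n) ≤ X) :
    Run w setup σ Tm fun σ' Tm' => Good w n X (Nat.clog 2 n) (radius p q) depth Γ σ' ∧
      Tm' + totalPot n (Nat.clog 2 n) (radius p q) depth σ' ≤
        Tm + ∑ i ∈ range (Nat.clog 2 n), startPot n m (radius p q i) (depth i) + 200 * m +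
          5000 * ((Nat.clog 2 n + 1) * n) := by
  have h16 := hw.out
  have hw0 : w ≠ 0 := by rintro rfl; simp at h16
  rw [setup]
  generalize hlists : buildLists = lists
  generalize hscales : buildScales = scales
  generalize hpass : pass = pass'
  simp only [run_seq, run_assign]
  subst hlists hscales hpass
  refine ⟨by simp, by simp [h1]; omega, ?_⟩
  generalize hσ₁ : (σ.setReg rN _).setReg 31 _ = σ₁
  have e31 : σ₁.reg 31 = 2 * m := by simp [← hσ₁, h1]; omega
  have eN : σ₁.reg rN = n := by simp [← hσ₁, h0]
  have e2 : σ₁.reg 2 = p := by simp [← hσ₁, h2]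
  have e3 : σ₁.reg 3 = q := by simp [← hσ₁, h3]
  have hA₁ : ∀ k x, σ₁.A k x = 0 := by
    intro k x
    rw [State.A, e31, ← hσ₁]
    exact hmem _ (by omega)
  have hin₁ : EdgeInput n m ea eb σ₁ := by
    rw [← hσ₁]
    exact ⟨hin.fst, hin.snd, hin.fst_lt, hin.snd_lt, hin.ne, hin.fresh⟩
  have hΓlt : ∀ x y, Γ.Adj x y → x < n := by
    intro x y hxy
    obtain ⟨t, h4, ⟨rfl, -⟩ | ⟨rfl, -⟩⟩ := (hΓ x y).1 hxy
    · exact hin.fst_lt t h4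
    · exact hin.snd_lt t h4
  refine (run_buildLists (w := w) (X := X) eN e31 (by omega) hsq hin₁ ?_ ?_).mono ?_
  · refine ⟨?_, ?_, ?_, ?_⟩
    all_goals simp [hA₁]
  · simp [hA₁]
  rintro σ₂ T₂ ⟨g1, g2, g3, g4, g5⟩
  have f31 := g2 31 (by decide) (by decide) (by decide)
  refine (run_buildScales (w := w) (X := X) ((g2 _ (by decide) (by decide) (by decide)).trans eN) hn
    ((g2 _ (by decide) (by decide) (by decide)).trans e2)
    ((g2 _ (by decide) (by decide) (by decide)).trans e3) (by omega) hnX hqX hqnX hp.num_le).mono ?_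
  rintro σ₃ T₃ ⟨k1, k2, k3, k4, k5, k6⟩
  generalize hs : Nat.clog 2 n = s at *
  refine ⟨by simp, by simp, ?_⟩
  generalize hσ₄ : (σ₃.setReg rU _).setReg rV _ = σ₄
  have hA₄ : ∀ k, σ₄.A k = σ₃.A k := by intro k; simp [← hσ₄]
  have hreg₄ : ∀ r, r ≠ rU → r ≠ rV → σ₄.reg r = σ₃.reg r := by
    intro r r1 r2; simp [← hσ₄, r1, r2]
  have hzero : ∀ k < 16, 3 ≤ k → k ≠ aH → k ≠ aCap → ∀ x, σ₄.A k x = 0 := by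
    intro k hk r1 r2 r3 x
    rw [hA₄, k5 k hk r2 r3, g3 k hk r1, hA₁]
  have f0 : σ₄.A aAdj = σ₂.A aAdj := by rw [hA₄, k5 _ (by decide) (by decide) (by decide)]
  have f1 : σ₄.A aDeg = σ₂.A aDeg := by rw [hA₄, k5 _ (by decide) (by decide) (by decide)]
  have f2 : σ₄.A aAlive = σ₂.A aAlive := by rw [hA₄, k5 _ (by decide) (by decide) (by decide)]
  have hdel : Γ.deleteEdges {s(0, 0)} = Γ := by
    ext x y
    rw [SimpleGraph.deleteEdges_adj, and_iff_left_iff_imp]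
    intro hxy h4
    rw [Set.mem_singleton_iff, Sym2.eq_iff] at h4
    rcases h4 with ⟨rfl, rfl⟩ | ⟨rfl, rfl⟩ <;> exact hxy.ne rfl
  have hnet : Net n (σ₄.A aDeg) (fun x k => σ₄.A aAdj (x * n + k)) Γ := by
    rw [f0, f1]
    exact ⟨fun x hx => g1.deg_le hx, g1.adj_lt, fun x y hxy =>
      ⟨hΓlt x y hxy, (g1.mem x (hΓlt x y hxy) y).1 ((hΓ x y).1 hxy)⟩⟩
  have hc₄ : Common w n X s (radius p q) depth (Γ.deleteEdges {s(0, 0)}) σ₄ := by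
    rw [hdel]
    refine ⟨⟨?_, hsq, ?_, ?_, hnet⟩, ?_, ?_, ?_⟩
    · rw [hreg₄ _ (by decide) (by decide), k4 _ (by decide) (by decide) (by decide)]; omega
    · rw [hreg₄ _ (by decide) (by decide), k4 _ (by decide) (by decide) (by decide),
        g2 _ (by decide) (by decide) (by decide)]; exact eN
    · intro x hx y hy
      rw [f2, hΓ]
      exact g1.alive x hx y hy
    · rw [hreg₄ _ (by decide) (by decide)]; exact k1
    · intro i hi; rw [hA₄]; exact k2 i hi
    · intro i hi; rw [hA₄]; exact k3 i hi
  have hnum : ∀ i, (scaleAt n i σ₄).num = 0 := fun i =>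
    hzero _ (by decide) (by decide) (by decide) (by decide) _
  have hcov : ∀ i x, (scaleAt n i σ₄).cov x = 0 := fun i x =>
    hzero _ (by decide) (by decide) (by decide) (by decide) _
  refine (run_pass (w := w) (Γ := Γ) (u := 0) (v := 0) hp hc₄ hnet (by omega) (by omega)
    (by simp [← hσ₄]) (by simp [← hσ₄]) fun i hi => ?_).mono ?_
  · refine ⟨?_, ?_, ?_, ?_, ?_, ?_, ?_⟩
    · rw [hnum]; omega
    · rw [hnum]; omega
    · rw [hnum]; omega
    · rw [hnum]; omega
    · rw [hnum]; simp
    · intro x _; rw [hcov]; exact ⟨Nat.zero_le _, by omega⟩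
    · intro j _ _ x _
      exact ⟨hzero _ (by decide) (by decide) (by decide) (by decide) _,
        hzero _ (by decide) (by decide) (by decide) (by decide) _⟩
  rw [hdel]
  rintro σ₅ T₅ ⟨l1, l2, l3, l4⟩
  refine ⟨⟨l1, fun i hi => (l2 i hi).1, fun i hi => (l2 i hi).2⟩, ?_⟩
  have g4' : ∑ z ∈ range n, σ₄.A aDeg z = 2 * m := by rw [f1]; exact g4
  have hstart : ∑ i ∈ range s, (scaleAt n i σ₄).pot n (σ₄.A aDeg) (radius p q i) (depth i) =
      ∑ i ∈ range s, startPot n m (radius p q i) (depth i) := by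
    refine sum_congr rfl fun i _ => ?_
    rw [ScaleData.pot, hnum, startPot, treePot_zero g4']
    simp only [hcov, range_zero, sum_empty, Nat.sub_zero, sum_const, card_range, smul_eq_mul]
    ring
  rw [totalPot, l3]
  have hn1 : s + 1 ≤ (s + 1) * n := Nat.le_mul_of_pos_right _ (by omega)
  simp only [Expr.cost_reg, Expr.cost_add, Expr.cost_const] at *
  omega

end DecrementalAPSP

namespace DecrementalAPSP
open WordRAM Finset Expr Cmd

/-! ### Queries -/

/-- At the scale `rX`, find the centre to which the first argument points, the position of the data
of its tree, and the flag that tells whether it covers the first argument. -/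
def look : Cmd :=
  rC ::= arr aCov (reg rX * reg rN + reg 0) ;;
  rT ::= (reg rX * (reg rN + const 1) + reg rC) * reg rN ;;
  rY ::= lt (reg rC) (arr aNum (reg rX)) *
    lt (arr aLab (reg rT + reg 0)) (arr aH (reg rX) + arr aH (reg rX) + const 1)

/-- Binary search for a scale at which the second argument is in the tree of the centre that covers
the first one, or no centre covers the first one, while neither holds at the scale before. -/
def search : Cmd :=
  rJ ::= const 0 ;;
  rK ::= reg rNum ;;
  .while (lt (reg rJ) (reg rK)) (
    rX ::= (reg rJ + reg rK) / const 2 ;;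
    look ;;
    .ite (reg rY * lt (arr aCap (reg rX)) (arr aLab (reg rT + reg 1)))
      (rJ ::= reg rX + const 1) (rK ::= reg rX))

/-- The program for a query: the sum of the two labels at the scale that was found. -/
def query : Cmd :=
  search ;;
  .ite (lt (reg rJ) (reg rNum))
    (rX ::= reg rJ ;;
      look ;;
      .ite (reg rY)
        (1 ::= arr aLab (reg rT + reg 0) + arr aLab (reg rT + reg 1) ;; 0 ::= const 1)
        (0 ::= const 0))
    (0 ::= const 0)

/-- The label of `v` in the tree of the centre to which `u` points at the scale `i`. -/
def labVia (n i : ℕ) (σ : State) (u v : ℕ) : ℕ :=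
  (scaleAt n i σ).lab ((scaleAt n i σ).cov u) v

/-- The scale `i` is fine for the pair `u`, `v` unless `u` is covered by a centre whose tree does not
reach `v`. -/
def Fine (n i h cap : ℕ) (σ : State) (u v : ℕ) : Prop :=
  (scaleAt n i σ).Covered h u → labVia n i σ u v ≤ cap

variable {w n X s i : ℕ} {hs caps : ℕ → ℕ} {Γ : SimpleGraph ℕ} {σ : State} {Tm : ℕ} {u v : ℕ}

/-- `σ'` arises from `σ` by changes of auxiliary registers. -/
def Aux (σ σ' : State) : Prop :=
  σ'.A = σ.A ∧ ∀ q, q < 5 ∨ 14 < q → σ'.reg q = σ.reg q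

theorem Aux.good {σ' : State} (h : Aux σ σ') (hg : Good w n X s hs caps Γ σ) :
    Good w n X s hs caps Γ σ' :=
  hg.transfer h.1 fun q hq => h.2 q (.inr hq)

theorem Aux.setReg {σ' : State} (h : Aux σ σ') {q x : ℕ} (h1 : 5 ≤ q) (h2 : q ≤ 14) :
    Aux σ (σ'.setReg q x) := by
  refine ⟨?_, fun q' hq' => ?_⟩
  · funext k
    rw [State.A_setReg _ _ _ (by omega), h.1]
  · rw [State.reg_setReg_ne _ _ (by omega), h.2 q' hq']

theorem Good.cov_le (hg : Good w n X s hs caps Γ σ) (hi : i < s) (hu : u < n) :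
    (scaleAt n i σ).cov u ≤ n :=
  ((hg.inv i hi).cov u hu).1.trans ((hg.inv i hi).num_le hg.common.static.net)

variable [hw : Fact (16 < 2 ^ w)]

theorem run_look (hp : Params n X s hs caps) (hc : Common w n X s hs caps Γ σ) (hi : i < s)
    (hX : σ.reg rX = i) (h0 : σ.reg 0 = u) (hu : u < n) (hcov : (scaleAt n i σ).cov u ≤ n) :
    Run w look σ Tm fun σ' Tm' => σ'.A = σ.A ∧ (∀ q, q ≠ rC → q ≠ rT → q ≠ rY →
      σ'.reg q = σ.reg q) ∧ (∀ x, σ'.A aLab (σ'.reg rT + x) = labVia n i σ u x) ∧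
      (∀ x < n, σ'.reg rT + x < X) ∧
      ((scaleAt n i σ).Covered (hs i) u ∧ σ'.reg rY = 1 ∨
        ¬ (scaleAt n i σ).Covered (hs i) u ∧ σ'.reg rY = 0) ∧ Tm' ≤ Tm + 100 := by
  have h16 := hw.out
  have hw0 : w ≠ 0 := by rintro rfl; simp at h16
  have haddr := hc.static.addr
  have hnX : n ≤ X := (Nat.le_mul_self n).trans hc.static.sq_le
  have hcap := hp.cap_le i hi
  have hadd := hp.add_le i hi
  have hmono := hp.mono i hi
  have hrad := hc.radius i hi.le
  obtain ⟨c, hc'⟩ : ∃ c, (scaleAt n i σ).cov u = c := ⟨_, rfl⟩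
  have hc'' : σ.A aCov (i * n + u) = c := hc'
  rw [hc'] at hcov
  obtain ⟨b1, b2, b3, b4⟩ := tree_index_le (hp.index_le i hi) (by omega) hcov
  have b5 : (i * (n + 1) + c) ≤ (i * (n + 1) + c) * n := Nat.le_mul_of_pos_right _ (by omega)
  have b6 : i * n ≤ i * (n + 1) := Nat.mul_le_mul_left _ (by omega)
  simp only [labVia, ScaleData.Covered, hc', scaleAt_lab, scaleAt_num]
  simp [look, hX, h0, hc.static.regN, hc'', hrad, and_assoc]
  repeat (refine And.intro ?_ ?_; focus (first | omega | (split_ifs <;> omega)))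
  refine ⟨by funext k; simp, fun q h1 h2 h3 => by simp [h1, h2, h3], fun x hx => by omega, ?_⟩
  by_cases h1 : c < σ.A aNum i <;>
    by_cases h2 : σ.A aLab ((i * (n + 1) + c) * n + u) ≤ hs i + hs i
  · left
    rw [if_pos h2, if_pos h1]
    exact ⟨h1, by omega, rfl⟩
  all_goals
    right
    constructor <;> intros <;> omega

/-- The difference of the bounds of the search is halved in every round, hence the bound for the time in
terms of the logarithm of the number `s` of scales. The predicate `Fine` need not be monotone in the
scale. -/
theorem run_search (hp : Params n X s hs caps) (hg : Good w n X s hs caps Γ σ)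
    (h0 : σ.reg 0 = u) (h1 : σ.reg 1 = v) (hu : u < n) (hv : v < n) :
    Run w search σ Tm fun σ' Tm' => Aux σ σ' ∧ σ'.reg rJ ≤ s ∧
      (σ'.reg rJ < s → Fine n (σ'.reg rJ) (hs (σ'.reg rJ)) (caps (σ'.reg rJ)) σ u v) ∧
      (∀ i, i + 1 = σ'.reg rJ → ¬ Fine n i (hs i) (caps i) σ u v) ∧
      Tm' ≤ Tm + 200 * Nat.log 2 s + 300 := by
  have h16 := hw.out
  have hw0 : w ≠ 0 := by rintro rfl; simp at h16
  have haddr := hg.common.static.addr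
  have hnX : n ≤ X := (Nat.le_mul_self n).trans hg.common.static.sq_le
  have hsX := hp.num_le
  have hs2 : s < 2 ^ (Nat.log 2 s + 1) := Nat.lt_pow_succ_log_self (by norm_num) s
  generalize Nat.log 2 s = l at *
  simp only [search, run_seq, run_assign]
  refine ⟨by simp, by simp, ?_⟩
  -- `k` bounds the number of rounds that remain
  refine run_while (fun σ₁ T₁ => ∃ lo hi k, σ₁.reg rJ = lo ∧ σ₁.reg rK = hi ∧ lo ≤ hi ∧ hi ≤ s ∧
      Aux σ σ₁ ∧ (hi < s → Fine n hi (hs hi) (caps hi) σ u v) ∧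
      (∀ i, i + 1 = lo → ¬ Fine n i (hs i) (caps i) σ u v) ∧ hi - lo < 2 ^ k ∧
      T₁ + 200 * k ≤ Tm + 200 * (l + 1) + 20)
    (Tm + 200 * (l + 1) + 20) ?_ ?_ ?_ ?_ ?_
  · rintro σ₁ T₁ ⟨lo, hi, k, g1, g2, g3, g4, g5, g6, g7, g8, g9⟩; omega
  · intros; simp
  · rintro σ₁ T₁ ⟨lo, hi, k, g1, g2, g3, g4, g5, g6, g7, g8, g9⟩ hcond
    simp [g1, g2] at hcond
    obtain ⟨k, rfl⟩ : ∃ k', k = k' + 1 := by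
      rcases k with _ | k
      · simp at g8; omega
      · exact ⟨k, rfl⟩
    rw [pow_succ] at g8
    simp only [run_assign, run_seq]
    refine ⟨by simp [g1, g2]; omega, ?_⟩
    obtain ⟨mid, hmid⟩ : ∃ mid, (lo + hi) / 2 = mid := ⟨_, rfl⟩
    simp only [Expr.val_add, Expr.val_div, Expr.val_reg, Expr.val_const, g1, g2, hmid]
    have hms : mid < s := by omega
    have g5' := g5.setReg (q := rX) (x := mid) (by decide) (by decide)
    have hA' := g5'.1
    refine (run_look (w := w) (i := mid) (u := u) hp (g5'.good hg).common hms (by simp)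
      ((g5'.2 0 (by decide)).trans h0) hu ?_).mono ?_
    · rw [scaleAt_congr hA']; exact hg.cov_le hms hu
    rintro σ₂ T₂ ⟨k1, k2, k3, k4, k5, k6⟩
    have a1 : σ₂.A = σ.A := k1.trans hA'
    have hlabvia : labVia n mid (σ₁.setReg rX mid) u v = labVia n mid σ u v := by
      rw [labVia, labVia, scaleAt_congr hA']
    rw [scaleAt_congr hA'] at k5
    have k3v := k3 v
    rw [hlabvia] at k3v
    have eX : σ₂.reg rX = mid := by rw [k2 _ (by decide) (by decide) (by decide)]; simp
    have e1 : σ₂.reg 1 = v := by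
      rw [k2 _ (by decide) (by decide) (by decide), g5'.2 1 (by decide), h1]
    have e31 : σ₂.reg 31 = σ.reg 31 := by
      rw [k2 _ (by decide) (by decide) (by decide), g5'.2 31 (by decide)]
    have eJ : σ₂.reg rJ = lo := by
      rw [k2 _ (by decide) (by decide) (by decide)]; simp [g1]
    have eK : σ₂.reg rK = hi := by
      rw [k2 _ (by decide) (by decide) (by decide)]; simp [g2]
    have hdep : σ₂.A aCap mid = caps mid := by rw [a1]; exact hg.common.depth mid hms
    have haux : Aux σ σ₂ := ⟨a1, fun q hq => by
      rw [k2 q (by omega) (by omega) (by omega), g5'.2 q hq]⟩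
    have hidx := k4 v hv
    have hfine : Fine n mid (hs mid) (caps mid) σ u v ↔
        ¬ (σ₂.reg rY ≠ 0 ∧ caps mid < labVia n mid σ u v) := by
      rw [Fine]
      rcases k5 with ⟨c1, c2⟩ | ⟨c1, c2⟩
      · simp [c1, c2]
      · simp [c1, c2]
    have hy1 : σ₂.reg rY ≤ 1 := by rcases k5 with ⟨c1, c2⟩ | ⟨c1, c2⟩ <;> omega
    simp only [Expr.cost_lt, Expr.cost_reg, Expr.cost_add, Expr.cost_const, Expr.cost_div] at k6
    simp [eX, e1, e31, hdep, k3v, and_assoc]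
    repeat (refine And.intro ?_ ?_; focus (first | omega | (split_ifs <;> omega)))
    constructor
    · intro c1 c2
      rw [eK, hfine]
      exact ⟨by omega, by omega, g4, haux.setReg (by decide) (by decide), g6,
        not_not.2 ⟨c2, c1⟩, k, by omega, by omega⟩
    · intro c1
      rw [eJ]
      refine ⟨by omega, hms.le, haux.setReg (by decide) (by decide), ?_, g7, k, by omega, by omega⟩
      rintro -
      rw [hfine]
      rintro ⟨c2, c3⟩
      exact c2 (c1 c3)
  · rintro σ₁ T₁ ⟨lo, hi, k, g1, g2, g3, g4, g5, g6, g7, g8, g9⟩ hcond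
    simp [g1, g2] at hcond
    obtain rfl : lo = hi := by omega
    rw [g1]
    refine ⟨g5, g4, g6, g7, ?_⟩
    simp
    omega
  · refine ⟨0, s, l + 1, by simp, by simp [hg.common.regNum], by omega, le_rfl, ?_, by omega,
      by omega, by omega, ?_⟩
    · exact (Aux.setReg ⟨rfl, fun _ _ => rfl⟩ (by decide) (by decide)).setReg (by decide) (by decide)
    · simp; omega

end DecrementalAPSP

namespace DecrementalAPSP
open WordRAM Finset Expr Cmd

/-! ### Correctness of queries -/

/-- The scan pointers lead from a vertex of the tree to the root. -/
theorem TreeInv.exists_walk {n : ℕ} {deg : ℕ → ℕ} {adj : ℕ → ℕ → ℕ} {Γ : SimpleGraph ℕ}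
    {cap r : ℕ} {lab ptr : ℕ → ℕ} (hnet : Net n deg adj Γ)
    (h : TreeInv n deg adj Γ cap r lab ptr fun _ => False) {x : ℕ} (hx : x < n)
    (hl : lab x ≤ cap) : ∃ p : Γ.Walk r x, p.length + lab r ≤ lab x := by
  induction hk : lab x using Nat.strong_induction_on generalizing x with
  | _ k ih =>
    subst hk
    by_cases hxr : x = r
    · subst hxr; exact ⟨.nil, by simp⟩
    · obtain ⟨h1, h2, h3⟩ := h.settled x hx hxr hl not_false
      obtain ⟨p, hp⟩ := ih _ h3 (hnet.adj_lt x hx _ h1) (by omega) rfl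
      exact ⟨p.concat h2.symm, by rw [SimpleGraph.Walk.length_concat]; omega⟩

section
variable {Γ : SimpleGraph ℕ} {f : ℕ → ℕ}

theorem le_add_length (hf : ∀ x y, Γ.Adj x y → f x ≤ f y + 1) {a b : ℕ} (p : Γ.Walk a b) :
    f b ≤ f a + p.length := by
  induction p with
  | nil => simp
  | cons h p ih =>
    have := hf _ _ h.symm
    rw [SimpleGraph.Walk.length_cons]
    omega

theorem le_add_dist (hf : ∀ x y, Γ.Adj x y → f x ≤ f y + 1) {a b : ℕ} (h : Γ.Reachable a b) :
    f b ≤ f a + Γ.dist a b := by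
  obtain ⟨p, hp⟩ := h.exists_walk_length_eq_dist
  rw [← hp]
  exact le_add_length hf p

theorem dist_le_succ {u x y : ℕ} (h : Γ.Adj x y) : Γ.dist u x ≤ Γ.dist u y + 1 := by
  by_cases hr : Γ.Reachable u y
  · obtain ⟨p, hp⟩ := hr.exists_walk_length_eq_dist
    rw [← hp, ← SimpleGraph.Walk.length_concat p h.symm]
    exact SimpleGraph.dist_le _
  · have : ¬ Γ.Reachable u x := fun h' => hr (h'.trans h.reachable)
    rw [SimpleGraph.dist_eq_zero_of_not_reachable this]
    omega

theorem csize_le {n : ℕ} (x : ℕ) : csize n Γ x ≤ n := by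
  classical
  exact (card_filter_le _ _).trans (card_range n).le

/-- A component contains at least one more vertex than the distance of any two of its vertices. -/
theorem dist_lt_csize {n : ℕ} (hΓ : ∀ x y, Γ.Adj x y → x < n) {u v : ℕ} (hu : u < n)
    (h : Γ.Reachable u v) : Γ.dist u v < csize n Γ u := by
  classical
  have := sub_le_card_of_levels (s := {y ∈ range n | Γ.Reachable u y}) (f := Γ.dist u) (a := 0)
    (b := Γ.dist u v + 1) fun l _ hl => by
      obtain ⟨z, hz, hz'⟩ := exists_level (fun x y hxy => dist_le_succ (u := u) hxy) h
        (l := l) (by simp) (by omega)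
      exact ⟨z, by simp only [mem_filter, mem_range]; exact ⟨reachable_lt hΓ hu hz, hz⟩, hz'⟩
  rw [csize]
  omega

end

variable {w n X s i : ℕ} {hs caps : ℕ → ℕ} {Γ : SimpleGraph ℕ} {σ : State} {Tm : ℕ} {u v : ℕ}

theorem Good.adj_lt (hg : Good w n X s hs caps Γ σ) (x y : ℕ) (h : Γ.Adj x y) : x < n :=
  (hg.common.static.net.mem_adj x y h).1

/-- The sum of the labels is an upper bound for the distance. -/
theorem Good.dist_le (hp : Params n X s hs caps) (hg : Good w n X s hs caps Γ σ) (hi : i < s)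
    (hu : u < n) (hv : v < n) (hc : (scaleAt n i σ).Covered (hs i) u)
    (hl : labVia n i σ u v ≤ caps i) :
    Γ.Reachable u v ∧ Γ.dist u v ≤ labVia n i σ u u + labVia n i σ u v := by
  have h1 := (hg.inv i hi).tree _ hc.1
  have h2 := hp.add_le i hi
  have h3 := hp.mono i hi
  obtain ⟨a, ha⟩ := h1.exists_walk hg.common.static.net hu (hc.2.trans (by omega))
  obtain ⟨b, hb⟩ := h1.exists_walk hg.common.static.net hv hl
  refine ⟨⟨a.reverse.append b⟩, (SimpleGraph.dist_le (a.reverse.append b)).trans ?_⟩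
  rw [SimpleGraph.Walk.length_append, SimpleGraph.Walk.length_reverse, labVia, labVia]
  omega

/-- Labels change by at most one along the edges of a shortest path. -/
theorem Good.labVia_le (hg : Good w n X s hs caps Γ σ) (hi : i < s)
    (hc : (scaleAt n i σ).Covered (hs i) u) (h : Γ.Reachable u v) :
    labVia n i σ u v ≤ labVia n i σ u u + Γ.dist u v :=
  le_add_dist ((hg.inv i hi).tree _ hc.1).lip h

/-- Correctness of the scale `f` that is found by the binary search. If `2 ^ i` is the largest power
of two that is at most the distance, then all scales from `i` on are fine, and `u` is covered at all
scales up to `i`. -/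
theorem Good.found {p q f : ℕ} (hq : 0 < q) (hp : Params n X s (radius p q) depth)
    (hg : Good w n X s (radius p q) depth Γ σ) (hn : 2 ≤ n) (hs : n ≤ 2 ^ s) (hu : u < n)
    (hv : v < n) (hf : f ≤ s) (hf1 : f < s → Fine n f (radius p q f) (depth f) σ u v)
    (hf2 : ∀ i, i + 1 = f → ¬ Fine n i (radius p q i) (depth i) σ u v) :
    (f < s ∧ (scaleAt n f σ).Covered (radius p q f) u ∧ Γ.Reachable u v ∧
      Γ.dist u v ≤ labVia n f σ u u + labVia n f σ u v ∧
      q * (labVia n f σ u u + labVia n f σ u v) ≤ (q + p) * Γ.dist u v) ∨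
    ¬ (f < s ∧ (scaleAt n f σ).Covered (radius p q f) u) ∧ ¬ Γ.Reachable u v := by
  by_cases hr : Γ.Reachable u v
  swap
  · refine .inr ⟨fun h => hr ?_, hr⟩
    exact (hg.dist_le hp h.1 hu hv h.2 (hf1 h.1 h.2)).1
  left
  have hd := dist_lt_csize hg.adj_lt hu hr
  have hdn : Γ.dist u v < n := hd.trans_le (csize_le u)
  obtain ⟨d, hdd⟩ : ∃ d, Γ.dist u v = d := ⟨_, rfl⟩
  -- from the scale of the distance on, the trees are deep enough to contain `v`
  have hfine : ∀ i < s, d < 2 * 2 ^ i → Fine n i (radius p q i) (depth i) σ u v := by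
    intro i hi hlt hc
    have h1 := hg.labVia_le hi hc hr
    have h2 : labVia n i σ u u ≤ 2 * radius p q i := hc.2
    have := radius_mul_four_le hq p i
    rw [depth]
    omega
  have hs0 : 0 < s := by
    rcases Nat.eq_zero_or_pos s with rfl | h
    · simp at hs; omega
    · exact h
  -- the scale that was found is not larger than the distance
  have hfd : f < s ∧ (f = 0 ∨ 2 ^ f ≤ d) := by
    rcases f with _ | i
    · exact ⟨hs0, .inl rfl⟩
    · have h1 : 2 * 2 ^ i ≤ d := by
        by_contra h1
        exact hf2 i rfl (hfine i (by omega) (by omega))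
      have h2 : (2 : ℕ) ^ (i + 1) = 2 * 2 ^ i := by ring
      refine ⟨(Nat.pow_lt_pow_iff_right (a := 2) (by norm_num)).1 ?_, .inr (by omega)⟩
      omega
  -- at the scale `0`, where `d` may be `0`, this holds because the radius is `0`
  have hbound : radius p q f * (4 * q) ≤ p * d ∧ radius p q f ≤ d := by
    rcases hfd.2 with rfl | h
    · rw [hp.zero]; simp
    · refine ⟨(radius_mul_le p q f).trans (Nat.mul_le_mul (min_le_left _ _) h), ?_⟩
      have := radius_mul_four_le hq p f
      omega
  have hc : (scaleAt n f σ).Covered (radius p q f) u := hg.covered f hfd.1 u hu (by omega)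
  obtain ⟨-, h1⟩ := hg.dist_le hp hfd.1 hu hv hc (hf1 hfd.1 hc)
  refine ⟨hfd.1, hc, hr, h1, ?_⟩
  have h2 := hg.labVia_le hfd.1 hc hr
  have h3 : labVia n f σ u u ≤ 2 * radius p q f := hc.2
  rw [hdd] at h2 ⊢
  calc q * (labVia n f σ u u + labVia n f σ u v)
      ≤ q * (4 * radius p q f + d) := Nat.mul_le_mul_left _ (by omega)
    _ = radius p q f * (4 * q) + q * d := by ring
    _ ≤ p * d + q * d := Nat.add_le_add_right hbound.1 _
    _ = (q + p) * d := by ring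

/-- A query leaves the arrays unchanged and answers with precision `p / q` in time `O(log s)`. -/
theorem run_query [hw : Fact (16 < 2 ^ w)] {p q : ℕ} (hq : 0 < q)
    (hp : Params n X s (radius p q) depth) (hg : Good w n X s (radius p q) depth Γ σ)
    (hn : 2 ≤ n) (hs : n ≤ 2 ^ s) (h0 : σ.reg 0 = u) (h1 : σ.reg 1 = v) (hu : u < n) (hv : v < n) :
    Run w query σ Tm fun σ' Tm' => σ'.A = σ.A ∧ (∀ r, 14 < r → σ'.reg r = σ.reg r) ∧
      ((Γ.Reachable u v ∧ σ'.reg 0 ≠ 0 ∧ Γ.dist u v ≤ σ'.reg 1 ∧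
        q * σ'.reg 1 ≤ (q + p) * Γ.dist u v) ∨ ¬ Γ.Reachable u v ∧ σ'.reg 0 = 0) ∧
      Tm' ≤ Tm + 200 * Nat.log 2 s + 1000 := by
  have h16 := hw.out
  have hw0 : w ≠ 0 := by rintro rfl; simp at h16
  have haddr := hg.common.static.addr
  simp only [query, run_seq]
  refine (run_search (w := w) hp hg h0 h1 hu hv).mono ?_
  rintro σ₁ T₁ ⟨g1, g2, g3, g4, g5⟩
  have hfound := hg.found hq hp hn hs hu hv g2 g3 g4
  obtain ⟨f, hf⟩ : ∃ f, σ₁.reg rJ = f := ⟨_, rfl⟩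
  rw [hf] at g2 hfound
  have eNum : σ₁.reg rNum = s := (g1.2 _ (by decide)).trans hg.common.regNum
  have hno : ¬ (f < s ∧ (scaleAt n f σ).Covered (radius p q f) u) → ¬ Γ.Reachable u v := by
    intro h
    rcases hfound with h' | h'
    · exact absurd ⟨h'.1, h'.2.1⟩ h
    · exact h'.2
  have hregs : ∀ r, 14 < r → σ₁.reg r = σ.reg r := fun r hr => g1.2 r (.inr hr)
  rw [run_ite]
  refine ⟨by simp, fun hc => ?_, fun hc => ?_⟩
  swap
  · simp [hf, eNum] at hc
    simp
    refine ⟨?_, ?_, hno (by omega), by omega⟩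
    · funext k; simp [g1.1]
    · intro r hr
      rw [State.reg_setReg_ne _ _ (by omega), hregs r hr]
  simp [hf, eNum] at hc
  rw [run_seq, run_assign]
  refine ⟨by simp, ?_⟩
  rw [run_seq]
  have g5' := g1.setReg (q := rX) (x := f) (by decide) (by decide)
  simp only [Expr.val_reg, hf]
  have hA' := g5'.1
  refine (run_look (w := w) (i := f) (u := u) hp (g5'.good hg).common hc (by simp)
    ((g5'.2 0 (by decide)).trans h0) hu ?_).mono ?_
  · rw [scaleAt_congr hA']; exact hg.cov_le hc hu
  rintro σ₂ T₂ ⟨k1, k2, k3, k4, k5, k6⟩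
  have a1 : σ₂.A = σ.A := k1.trans hA'
  have hlabvia : ∀ x, labVia n f (σ₁.setReg rX f) u x = labVia n f σ u x := fun x => by
    rw [labVia, labVia, scaleAt_congr hA']
  rw [scaleAt_congr hA'] at k5
  have k3u := k3 u
  have k3v := k3 v
  rw [hlabvia] at k3u k3v
  have e0 : σ₂.reg 0 = u := by
    rw [k2 _ (by decide) (by decide) (by decide), g5'.2 0 (by decide), h0]
  have e1 : σ₂.reg 1 = v := by
    rw [k2 _ (by decide) (by decide) (by decide), g5'.2 1 (by decide), h1]
  have e31 : σ₂.reg 31 = σ.reg 31 := by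
    rw [k2 _ (by decide) (by decide) (by decide), g5'.2 31 (by decide)]
  have hregs₂ : ∀ r, 14 < r → σ₂.reg r = σ.reg r := fun r hr => by
    rw [k2 r (by omega) (by omega) (by omega), g5'.2 r (.inr hr)]
  have hidu := k4 u hu
  have hidv := k4 v hv
  simp only [Expr.cost_lt, Expr.cost_reg] at k6
  rcases k5 with ⟨c1, c2⟩ | ⟨c1, c2⟩
  · have htree := (hg.inv f hc).tree _ c1.1
    have l1 : labVia n f σ u u ≤ depth f + 1 := htree.lab_le u hu
    have l2 : labVia n f σ u v ≤ depth f + 1 := htree.lab_le v hv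
    have l3 := hp.cap_le f hc
    obtain ⟨-, -, r1, r2, r3⟩ := hfound.resolve_right fun h => h.1 ⟨hc, c1⟩
    simp [c2, e0, e1, e31, k3u, k3v, and_assoc]
    repeat refine And.intro (by omega) ?_
    refine ⟨?_, ?_, r1, r2, r3, by omega⟩
    · funext k; simp [a1]
    · intro r hr
      rw [State.reg_setReg_ne _ _ (by omega), State.reg_setReg_ne _ _ (by omega), hregs₂ r hr]
  · simp [c2]
    refine ⟨?_, ?_, hno fun h => c1 h.2, by omega⟩
    · funext k; simp [a1]
    · intro r hr
      rw [State.reg_setReg_ne _ _ (by omega), hregs₂ r hr]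

end DecrementalAPSP

namespace DecrementalAPSP
open WordRAM Finset Expr Cmd

/-! ### Graphs on `Fin n` as graphs on the natural numbers -/

/-- The graph on the natural numbers with the edges of `G`. -/
def natGraph {n : ℕ} (G : SimpleGraph (Fin n)) : SimpleGraph ℕ := G.map Fin.valEmbedding

section
variable {n : ℕ} {G : SimpleGraph (Fin n)} {u v : Fin n}

theorem natGraph_adj {x y : ℕ} :
    (natGraph G).Adj x y ↔ ∃ a b : Fin n, G.Adj a b ∧ (a : ℕ) = x ∧ (b : ℕ) = y := by
  rw [natGraph, SimpleGraph.map_adj]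
  rfl

theorem natGraph_adj_coe : (natGraph G).Adj u v ↔ G.Adj u v := by
  rw [natGraph_adj]
  constructor
  · rintro ⟨a, b, h, h1, h2⟩
    rwa [Fin.ext h1, Fin.ext h2] at h
  · exact fun h => ⟨u, v, h, rfl, rfl⟩

theorem natGraph_deleteEdges :
    natGraph (G.deleteEdges {s(u, v)}) = (natGraph G).deleteEdges {s((u : ℕ), (v : ℕ))} := by
  ext x y
  rw [natGraph_adj, SimpleGraph.deleteEdges_adj, natGraph_adj]
  simp only [SimpleGraph.deleteEdges_adj, Set.mem_singleton_iff, Sym2.eq_iff]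
  constructor
  · rintro ⟨a, b, ⟨h, h'⟩, rfl, rfl⟩
    refine ⟨⟨a, b, h, rfl, rfl⟩, ?_⟩
    simpa only [Fin.val_inj] using h'
  · rintro ⟨⟨a, b, h, rfl, rfl⟩, h'⟩
    refine ⟨a, b, ⟨h, ?_⟩, rfl, rfl⟩
    simpa only [Fin.val_inj] using h'

theorem exists_walk_of_natGraph {x y : ℕ} (p : (natGraph G).Walk x y) (a : Fin n)
    (ha : (a : ℕ) = x) : ∃ b : Fin n, (b : ℕ) = y ∧ ∃ q : G.Walk a b, q.length = p.length := by
  induction p generalizing a with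
  | nil => exact ⟨a, ha, .nil, rfl⟩
  | cons h p ih =>
    obtain ⟨a', c, h1, h2, h3⟩ := natGraph_adj.1 h
    obtain ⟨b, hb, q, hq⟩ := ih c h3
    obtain rfl : a' = a := Fin.ext (h2.trans ha.symm)
    exact ⟨b, hb, .cons h1 q, by simp [hq]⟩

theorem exists_natGraph_walk (p : G.Walk u v) :
    ∃ q : (natGraph G).Walk u v, q.length = p.length := by
  induction p with
  | nil => exact ⟨.nil, rfl⟩
  | cons h p ih =>
    obtain ⟨q, hq⟩ := ih
    exact ⟨.cons (natGraph_adj_coe.2 h) q, by simp [hq]⟩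

/-- The embedding of `Fin n` preserves distances, since paths do not leave its range. -/
theorem natGraph_edist : (natGraph G).edist u v = G.edist u v := by
  refine le_antisymm (le_iInf fun p => ?_) (le_iInf fun p => ?_)
  · obtain ⟨q, hq⟩ := exists_natGraph_walk p
    rw [← hq]
    exact SimpleGraph.edist_le q
  · obtain ⟨b, hb, q, hq⟩ := exists_walk_of_natGraph p u rfl
    obtain rfl : b = v := Fin.ext hb
    rw [← hq]
    exact SimpleGraph.edist_le q

/-- The answer of a query is correct if the precision is at least `p / q`. -/
theorem isApproxDist_of {σ : State} {p q : ℕ} {ε : ℝ} (hq : 0 < q) (hε : (p : ℝ) / q ≤ ε)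
    (h : (natGraph G).Reachable u v ∧ σ.reg 0 ≠ 0 ∧ (natGraph G).dist u v ≤ σ.reg 1 ∧
        q * σ.reg 1 ≤ (q + p) * (natGraph G).dist u v ∨
      ¬ (natGraph G).Reachable u v ∧ σ.reg 0 = 0) :
    IsApproxDist G ε u v (answer σ) := by
  have hε0 : 0 ≤ ε := le_trans (by positivity) hε
  rw [IsApproxDist, answer, ← natGraph_edist]
  rcases h with ⟨h1, h2, h3, h4⟩ | ⟨h1, h2⟩
  · rw [if_neg h2, ← h1.coe_dist_eq_edist]
    generalize (natGraph G).dist u v = d at h3 h4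
    refine ⟨by exact_mod_cast h3, ?_⟩
    rw [ENat.toENNReal_coe, ENat.toENNReal_coe, ← ENNReal.ofReal_natCast, ← ENNReal.ofReal_natCast,
      ← ENNReal.ofReal_mul (by linarith)]
    refine ENNReal.ofReal_le_ofReal ?_
    have hq' : (0 : ℝ) < q := by exact_mod_cast hq
    have h5 : (q : ℝ) * σ.reg 1 ≤ (q + p) * d := by exact_mod_cast h4
    have h6 : (p : ℝ) ≤ ε * q := (div_le_iff₀ hq').1 hε
    refine le_of_mul_le_mul_left (h5.trans ?_) hq'
    have : (p : ℝ) * d ≤ ε * q * d := mul_le_mul_of_nonneg_right h6 (by positivity)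
    linarith
  · rw [if_pos h2, SimpleGraph.edist_eq_top_of_not_reachable h1]
    refine ⟨le_rfl, ?_⟩
    rw [ENat.toENNReal_top, ENNReal.mul_top]
    rw [Ne, ENNReal.ofReal_eq_zero]
    linarith

end

/-! ### The input -/

section
variable {α : Type*} (f g : α → ℕ)

theorem getD_flatMap_pair (L : List α) (t : ℕ) :
    (L.flatMap fun e => [f e, g e]).getD (2 * t) 0 = (L.map f).getD t 0 ∧
      (L.flatMap fun e => [f e, g e]).getD (2 * t + 1) 0 = (L.map g).getD t 0 := by
  induction L generalizing t with
  | nil => simp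
  | cons e L ih =>
    rcases t with _ | t
    · simp
    · have := ih t
      simpa [show 2 * (t + 1) = 2 * t + 1 + 1 by ring] using this

theorem length_flatMap_pair (L : List α) : (L.flatMap fun e => [f e, g e]).length = 2 * L.length := by
  induction L with
  | nil => rfl
  | cons e L ih => simp only [List.flatMap_cons, List.length_append, ih]; simp; omega

end

section
variable {n : ℕ} {G : SimpleGraph (Fin n)} {L : List (Fin n × Fin n)}

/-- The first end of the edge with the index `t`. -/
def fstEnd (L : List (Fin n × Fin n)) (t : ℕ) : ℕ := (L.map fun e => (e.1 : ℕ)).getD t 0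

/-- The second end of the edge with the index `t`. -/
def sndEnd (L : List (Fin n × Fin n)) (t : ℕ) : ℕ := (L.map fun e => (e.2 : ℕ)).getD t 0

theorem fstEnd_eq {t : ℕ} (ht : t < L.length) : fstEnd L t = (L[t].1 : ℕ) := by
  simp [fstEnd, ht]

theorem sndEnd_eq {t : ℕ} (ht : t < L.length) : sndEnd L t = (L[t].2 : ℕ) := by
  simp [sndEnd, ht]

theorem arcs_iff {t x y : ℕ} (ht : t ≤ L.length) : Arcs (fstEnd L) (sndEnd L) t x y ↔
    ∃ (t' : ℕ) (h : t' < L.length), t' < t ∧ ∃ a b : Fin n, s(L[t'].1, L[t'].2) = s(a, b) ∧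
      (a : ℕ) = x ∧ (b : ℕ) = y := by
  constructor
  · rintro ⟨t', h, h1⟩
    have h2 : t' < L.length := by omega
    rw [fstEnd_eq h2, sndEnd_eq h2] at h1
    refine ⟨t', h2, h, ?_⟩
    rcases h1 with ⟨rfl, rfl⟩ | ⟨rfl, rfl⟩
    · exact ⟨_, _, rfl, rfl, rfl⟩
    · exact ⟨_, _, Sym2.eq_swap, rfl, rfl⟩
  · rintro ⟨t', h2, h, a, b, h1, rfl, rfl⟩
    refine ⟨t', h, ?_⟩
    rw [fstEnd_eq h2, sndEnd_eq h2]
    rcases Sym2.eq_iff.1 h1 with ⟨h3, h4⟩ | ⟨h3, h4⟩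
    · exact .inl ⟨by rw [h3], by rw [h4]⟩
    · exact .inr ⟨by rw [h4], by rw [h3]⟩

theorem natGraph_adj_iff_arcs (hL : IsEdgeList L G) (x y : ℕ) :
    (natGraph G).Adj x y ↔ Arcs (fstEnd L) (sndEnd L) L.length x y := by
  rw [natGraph_adj, arcs_iff le_rfl]
  constructor
  · rintro ⟨a, b, h, rfl, rfl⟩
    obtain ⟨t, ht, h1⟩ := List.getElem_of_mem ((hL.2 s(a, b)).2 h)
    rw [List.length_map] at ht
    rw [List.getElem_map] at h1
    exact ⟨t, ht, ht, a, b, h1, rfl, rfl⟩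
  · rintro ⟨t, ht, -, a, b, h, rfl, rfl⟩
    refine ⟨a, b, ?_, rfl, rfl⟩
    rw [← SimpleGraph.mem_edgeSet, ← hL.2, ← h]
    exact List.mem_map.2 ⟨L[t], List.getElem_mem ht, rfl⟩

/-- The initial memory contains the edges as the initialization expects them. -/
theorem edgeInput (hL : IsEdgeList L G) (p q : ℕ) :
    EdgeInput n L.length (fstEnd L) (sndEnd L) (inputState L p q) := by
  refine ⟨fun t _ => (getD_flatMap_pair _ _ L t).1, fun t _ => (getD_flatMap_pair _ _ L t).2,
    fun t ht => ?_, fun t ht => ?_, fun t ht => ?_, fun t ht h => ?_⟩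
  · rw [fstEnd_eq ht]; exact Fin.isLt _
  · rw [sndEnd_eq ht]; exact Fin.isLt _
  · have : (natGraph G).Adj (fstEnd L t) (sndEnd L t) :=
      (natGraph_adj_iff_arcs hL _ _).2 ⟨t, ht, .inl ⟨rfl, rfl⟩⟩
    exact this.ne
  · obtain ⟨t', h1, h2, a, b, h3, h4, h5⟩ := (arcs_iff ht.le).1 h
    rw [fstEnd_eq ht] at h4
    rw [sndEnd_eq ht] at h5
    rw [Fin.ext h4, Fin.ext h5] at h3
    have h6 := (List.nodup_iff_injective_getElem.1 hL.1)
      (a₁ := ⟨t', by simpa using h1⟩) (a₂ := ⟨t, by simpa using ht⟩) (by simpa using h3)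
    simp at h6
    omega

theorem length_eq_ncard (hL : IsEdgeList L G) : L.length = G.edgeSet.ncard := by
  classical
  have h : G.edgeSet = ((L.map fun e => s(e.1, e.2)).toFinset : Set (Sym2 (Fin n))) := by
    ext e
    rw [← hL.2, List.coe_toFinset]
    rfl
  rw [h, Set.ncard_coe_finset, List.toFinset_card_of_nodup hL.1, List.length_map]

theorem length_le_sq (hL : IsEdgeList L G) : L.length ≤ n * n := by
  have := (hL.1.of_map _).length_le_card
  simpa using this

end

/-! ### The choice of the parameters -/

/-- With `B = n + p + q`, every number that the programs handle is `O(B ^ 6)`. -/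
theorem params_of {n p q : ℕ} (hn : 2 ≤ n) (hp : 0 < p) (hq : 0 < q) :
    Params n ((n + p + q) ^ 6) (Nat.clog 2 n) (radius p q) depth := by
  have hs : Nat.clog 2 n ≤ n := Nat.clog_le_of_le_pow Nat.lt_two_pow_self.le
  obtain ⟨B, hB⟩ : ∃ B, n + p + q = B := ⟨_, rfl⟩
  rw [hB]
  have h4 : 4 ≤ B := by omega
  have hX : 64 * B ^ 3 ≤ B ^ 6 := by
    calc 64 * B ^ 3 = 4 ^ 3 * B ^ 3 := by norm_num
      _ ≤ B ^ 3 * B ^ 3 := Nat.mul_le_mul_right _ (Nat.pow_le_pow_left h4 3)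
      _ = B ^ 6 := by ring
  have h3 : n * n * n ≤ B ^ 3 := by
    calc n * n * n = n ^ 3 := by ring
      _ ≤ B ^ 3 := Nat.pow_le_pow_left (by omega) 3
  have h2 : n * n ≤ n * n * n := Nat.le_mul_of_pos_right _ (by omega)
  have h1 : n ≤ n * n := Nat.le_mul_self n
  have hcap : ∀ i < Nat.clog 2 n, depth i + 1 ≤ 4 * n := fun i hi => by
    have := Nat.pow_lt_of_lt_clog hi
    simp only [depth]
    omega
  refine ⟨fun i hi => ?_, fun i hi => ?_, fun i hi => ?_, by omega, ?_, fun i hi => ?_,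
    fun i hi => ?_⟩
  · have : (i * (n + 1) + (n + 1)) * n ≤ n * (n + 1) * n := by
      refine Nat.mul_le_mul_right _ ?_
      rw [← Nat.succ_mul]
      exact Nat.mul_le_mul_right _ (by omega)
    have : n * (n + 1) * n = n * n * n + n * n := by ring
    omega
  · have := Nat.mul_le_mul_right (n * (n + 1)) (hcap i hi)
    have : 4 * n * (n * (n + 1)) = 4 * (n * n * n) + 4 * (n * n) := by ring
    omega
  · have := hcap i hi
    omega
  · have := radius_mul_four_le hq p 0
    simp only [pow_zero] at this
    omega
  · exact Nat.div_le_div_right (Nat.mul_le_mul_left _ (Nat.pow_le_pow_right (by omega) (by omega)))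
  · have h5 := radius_mul_four_le hq p i
    have h6 := radius_mul_four_le hq p (i + 1)
    rw [pow_succ] at h6
    simp only [depth]
    omega

end DecrementalAPSP

namespace DecrementalAPSP
open WordRAM Finset Expr Cmd

/-! ### Sequences of operations -/

/-- All operations are served in time: each deletion adds at most `4000 * ((s + 1) * n) + 100` to the sum
of time and potential and removes an edge, so the total stays below the bound `M`. -/
theorem serves_of_good {w n X s p q : ℕ} [hw : Fact (16 < 2 ^ w)] {ε U Q : ℝ} {M : ℕ}
    (hn : 2 ≤ n) (hs : n ≤ 2 ^ s) (hq : 0 < q) (hε : (p : ℝ) / q ≤ ε)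
    (hp : Params n X s (radius p q) depth) (hU : (M : ℝ) ≤ U)
    (hQ : ((200 * Nat.log 2 s + 1000 : ℕ) : ℝ) ≤ Q) (ops : List (Op n)) :
    ∀ (G : SimpleGraph (Fin n)) (σ : State) (T : ℕ),
      Good w n X s (radius p q) depth (natGraph G) σ →
      T + totalPot n s (radius p q) depth σ + (4000 * ((s + 1) * n) + 100) * G.edgeSet.ncard ≤ M →
      Serves ⟨setup, deleteEdge, query⟩ w ε U Q ops G σ T := by
  have hA : ∀ (σ : State) (u v : Fin n), (withArgs σ u v).A = σ.A := fun σ u v => by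
    funext k x
    simp [withArgs, State.A, State.setReg]
  have hreg : ∀ (σ : State) (u v : Fin n) (r : ℕ), 14 < r → (withArgs σ u v).reg r = σ.reg r :=
    fun σ u v r hr => by
      simp [withArgs, State.setReg, Function.update_of_ne (show r ≠ 0 by omega),
        Function.update_of_ne (show r ≠ 1 by omega)]
  have h0 : ∀ (σ : State) (u v : Fin n), (withArgs σ u v).reg 0 = u := fun σ u v => by
    simp [withArgs, State.setReg]
  have h1 : ∀ (σ : State) (u v : Fin n), (withArgs σ u v).reg 1 = v := fun σ u v => by
    simp [withArgs, State.setReg]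
  induction ops with
  | nil =>
    intro G σ T _ hT
    exact le_trans (by exact_mod_cast (show T ≤ M by omega)) hU
  | cons op ops ih =>
    intro G σ T hg hT
    have hg' : ∀ u v, Good w n X s (radius p q) depth (natGraph G) (withArgs σ u v) :=
      fun u v => hg.transfer (hA σ u v) (hreg σ u v)
    cases op with
    | delete u v =>
      intro huv
      obtain ⟨t, σ', he, hgood, ht⟩ := run_deleteEdge (w := w) (Tm := T) hp (hg' u v) u.isLt v.isLt
        (h0 σ u v) (h1 σ u v)
      refine ⟨t, σ', he, ih _ _ _ (by rwa [natGraph_deleteEdges]) ?_⟩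
      rw [totalPot_congr (hA σ u v)] at ht
      have hmem : s(u, v) ∈ G.edgeSet := huv
      have hcard : (G.deleteEdges {s(u, v)}).edgeSet.ncard + 1 = G.edgeSet.ncard := by
        rw [SimpleGraph.edgeSet_deleteEdges]
        exact Set.ncard_sdiff_singleton_add_one hmem
      rw [← hcard, mul_add, mul_one] at hT
      omega
    | query u v =>
      obtain ⟨t, σ', he, ha, hr, hans, ht⟩ := run_query (w := w) (Tm := 0) hq hp (hg' u v) hn hs
        (h0 σ u v) (h1 σ u v) u.isLt v.isLt
      refine ⟨t, σ', he, ?_, isApproxDist_of hq hε hans, ih _ _ _ ((hg' u v).transfer ha hr) ?_⟩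
      · exact le_trans (by exact_mod_cast (show t ≤ 200 * Nat.log 2 s + 1000 by omega)) hQ
      · rwa [totalPot_congr ha, totalPot_congr (hA σ u v)]

/-! ### The bounds in terms of `n`, `m` and `ε` -/

/-- The number of scales is `O(log n)`. -/
theorem clog_le_log {n : ℕ} (hn : 2 ≤ n) : (Nat.clog 2 n : ℝ) ≤ 3 * Real.log n := by
  have hl2 := Real.log_two_gt_d9
  have hn' : (2 : ℝ) ≤ n := by exact_mod_cast hn
  have hln : Real.log 2 ≤ Real.log n := Real.log_le_log (by norm_num) hn'
  have hpos : 0 < Nat.clog 2 n := Nat.clog_pos (by norm_num) hn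
  have h1 := Nat.pow_pred_clog_lt_self (b := 2) (by norm_num) (x := n) (by omega)
  obtain ⟨k, hk⟩ : ∃ k, Nat.clog 2 n = k + 1 := ⟨_, (Nat.succ_pred_eq_of_pos hpos).symm⟩
  rw [hk, Nat.pred_succ] at h1
  have h2 : (2 : ℝ) ^ k ≤ n := by exact_mod_cast h1.le
  have h3 := Real.log_le_log (by positivity) h2
  rw [Real.log_pow] at h3
  have hk0 : (0 : ℝ) ≤ k := by positivity
  rw [hk]
  push_cast
  nlinarith

theorem query_time_le {n : ℕ} (hn : 2 ≤ n) :
    ((200 * Nat.log 2 (Nat.clog 2 n) + 1000 : ℕ) : ℝ) ≤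
      1000000 * (1 + Real.log (Real.log n)) := by
  have hl2 := Real.log_two_gt_d9
  have hn' : (2 : ℝ) ≤ n := by exact_mod_cast hn
  have hln : Real.log 2 ≤ Real.log n := Real.log_le_log (by norm_num) hn'
  have hpos : 0 < Nat.clog 2 n := Nat.clog_pos (by norm_num) hn
  have hL : 0 < Real.log n := by linarith
  have hll : -(1 / 2 : ℝ) ≤ Real.log (Real.log n) := by
    refine le_trans ?_ (Real.one_sub_inv_le_log_of_pos hL)
    have : (Real.log n)⁻¹ ≤ (2 / 3 : ℝ)⁻¹ := inv_anti₀ (by norm_num) (by linarith)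
    norm_num at this ⊢
    linarith
  have h1 : (2 : ℝ) ^ Nat.log 2 (Nat.clog 2 n) ≤ 3 * Real.log n :=
    le_trans (by exact_mod_cast Nat.pow_log_le_self 2 hpos.ne') (clog_le_log hn)
  have h2 := Real.log_le_log (by positivity) h1
  have h3 : Real.log 3 ≤ 2 := by
    have := Real.log_le_sub_one_of_pos (show (0 : ℝ) < 3 by norm_num)
    linarith
  rw [Real.log_pow, Real.log_mul (by norm_num) hL.ne'] at h2
  have hk : (0 : ℝ) ≤ (Nat.log 2 (Nat.clog 2 n) : ℕ) := by positivity
  push_cast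
  nlinarith

/-- The number of trees of a scale times their depth is `O(n / min ε 1)`. -/
theorem trees_mul_depth_le {n p q i : ℕ} {ε : ℝ} (hp : 0 < p) (hq : 0 < q)
    (hε : 0 < ε) (hpq : ε ≤ 2 * ((p : ℝ) / q)) :
    ((n / (radius p q i + 1) * (depth i + 1) : ℕ) : ℝ) ≤ 40 * n / min ε 1 := by
  obtain ⟨r, hr⟩ : ∃ r, min p q = r := ⟨_, rfl⟩
  have hr0 : 0 < r := hr ▸ lt_min hp hq
  have h1 : min p q * 2 ^ i < 4 * q * (radius p q i + 1) :=
    Nat.lt_mul_div_succ _ (by omega)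
  rw [hr] at h1
  have h2 := Nat.div_mul_le_self n (radius p q i + 1)
  obtain ⟨M, hM⟩ : ∃ M, n / (radius p q i + 1) = M := ⟨_, rfl⟩
  rw [hM] at h2 ⊢
  have h3 : M * (depth i + 1) * r ≤ 20 * q * n := by
    have h4 : depth i + 1 ≤ 5 * 2 ^ i := by
      have : 1 ≤ 2 ^ i := Nat.one_le_two_pow
      simp only [depth]
      omega
    calc M * (depth i + 1) * r ≤ M * (5 * 2 ^ i) * r := by gcongr
      _ = 5 * M * (r * 2 ^ i) := by ring
      _ ≤ 5 * M * (4 * q * (radius p q i + 1)) := by gcongr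
      _ = 20 * q * (M * (radius p q i + 1)) := by ring
      _ ≤ 20 * q * n := by gcongr
  have hq' : (0 : ℝ) < q := by exact_mod_cast hq
  have h5 : min ε 1 * q ≤ 2 * r := by
    rw [← hr]
    push_cast
    rcases le_total (p : ℝ) q with h | h
    · rw [min_eq_left h]
      calc min ε 1 * q ≤ 2 * ((p : ℝ) / q) * q := by gcongr; exact (min_le_left _ _).trans hpq
        _ = 2 * p := by field_simp
    · rw [min_eq_right h]
      have := min_le_right ε 1
      nlinarith
  have h6 : ((M * (depth i + 1) : ℕ) : ℝ) * r ≤ 20 * q * n := by exact_mod_cast h3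
  have hmin : 0 < min ε 1 := lt_min hε one_pos
  have hr' : (0 : ℝ) < r := by exact_mod_cast hr0
  rw [le_div_iff₀ hmin]
  refine le_of_mul_le_mul_right ?_ hr'
  calc ((M * (depth i + 1) : ℕ) : ℝ) * min ε 1 * r
      = ((M * (depth i + 1) : ℕ) : ℝ) * r * min ε 1 := by ring
    _ ≤ 20 * q * n * min ε 1 := by gcongr
    _ = 20 * n * (min ε 1 * q) := by ring
    _ ≤ 20 * n * (2 * r) := by gcongr
    _ = 40 * n * r := by ring

theorem startPot_le {n m h cap : ℕ} (hm : 1 ≤ m) (hnm : n ≤ 2 * m) :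
    startPot n m h cap ≤ n / (h + 1) * (cap + 1) * (5500 * m) := by
  rw [startPot, mul_assoc]
  refine Nat.mul_le_mul_left _ ?_
  calc 600 * ((cap + 1) * (2 * m + n)) + 500 * m + 300 * n + 2000
      ≤ 600 * ((cap + 1) * (4 * m)) + (cap + 1) * (3100 * m) := by
        have : (cap + 1) * (2 * m + n) ≤ (cap + 1) * (4 * m) := by gcongr; omega
        have : 1 * (3100 * m) ≤ (cap + 1) * (3100 * m) := by gcongr; omega
        omega
    _ = (cap + 1) * (5500 * m) := by ring

theorem update_time_le {n m p q : ℕ} {ε : ℝ} (hn : 2 ≤ n) (hnm : n ≤ m + 1) (hp : 0 < p)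
    (hq : 0 < q) (hε : 0 < ε) (hpq : ε ≤ 2 * ((p : ℝ) / q)) :
    ((∑ i ∈ range (Nat.clog 2 n), startPot n m (radius p q i) (depth i) + 200 * m +
        5000 * ((Nat.clog 2 n + 1) * n) +
        (4000 * ((Nat.clog 2 n + 1) * n) + 100) * m : ℕ) : ℝ) ≤
      1000000 * ((m : ℝ) * n * Real.log n / min ε 1) := by
  have hs := clog_le_log hn
  have hl2 := Real.log_two_gt_d9
  have hn' : (2 : ℝ) ≤ n := by exact_mod_cast hn
  have hln : Real.log 2 ≤ Real.log n := Real.log_le_log (by norm_num) hn'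
  obtain ⟨l, hl⟩ : ∃ l, Real.log n = l := ⟨_, rfl⟩
  have hm : (1 : ℝ) ≤ m := by exact_mod_cast (show 1 ≤ m by omega)
  have hmin : 0 < min ε 1 := lt_min hε one_pos
  obtain ⟨a, ha⟩ : ∃ a, (min ε 1)⁻¹ = a := ⟨_, rfl⟩
  have ha1 : 1 ≤ a := ha ▸ (one_le_inv₀ hmin).2 (min_le_right _ _)
  rw [hl] at hs hln
  have hsum : ((∑ i ∈ range (Nat.clog 2 n), startPot n m (radius p q i) (depth i) : ℕ) : ℝ) ≤
      (Nat.clog 2 n : ℝ) * (40 * n * a * (5500 * m)) := by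
    push_cast
    calc ∑ i ∈ range (Nat.clog 2 n), (startPot n m (radius p q i) (depth i) : ℝ)
        ≤ ∑ i ∈ range (Nat.clog 2 n), 40 * n * a * (5500 * m) := by
          refine sum_le_sum fun i _ => ?_
          have h1 : (startPot n m (radius p q i) (depth i) : ℝ) ≤
              ((n / (radius p q i + 1) * (depth i + 1) : ℕ) : ℝ) * (5500 * m) := by
            exact_mod_cast startPot_le (by omega) (by omega)
          refine h1.trans ?_
          gcongr
          rw [← ha, ← div_eq_mul_inv]
          exact trees_mul_depth_le hp hq hε hpq
      _ = _ := by simp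
  have hs1 : (Nat.clog 2 n : ℝ) + 1 ≤ 5 * l := by linarith
  push_cast at hsum ⊢
  rw [hl, div_eq_mul_inv, ha]
  have hl0 : 0 ≤ l := by linarith
  have hm0 : (0 : ℝ) ≤ m := by linarith
  have ha0 : (0 : ℝ) ≤ a := by linarith
  have hnl : 1 ≤ n * l := by nlinarith
  have e1 : (Nat.clog 2 n : ℝ) * (40 * n * a * (5500 * m)) ≤ 660000 * (m * n * l * a) := by
    calc (Nat.clog 2 n : ℝ) * (40 * n * a * (5500 * m)) ≤ 3 * l * (40 * n * a * (5500 * m)) := by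
          gcongr
      _ = _ := by ring
  have e2 : (m : ℝ) ≤ m * n * l * a := by
    calc (m : ℝ) = m * 1 * 1 := by ring
      _ ≤ m * (n * l) * a := by gcongr
      _ = _ := by ring
  have e3 : ((Nat.clog 2 n : ℝ) + 1) * n * m ≤ 5 * (m * n * l * a) := by
    calc ((Nat.clog 2 n : ℝ) + 1) * n * m ≤ 5 * l * n * m := by gcongr
      _ = 5 * (m * n * l) * 1 := by ring
      _ ≤ 5 * (m * n * l) * a := by gcongr
      _ = _ := by ring
  have e4 : ((Nat.clog 2 n : ℝ) + 1) * n ≤ ((Nat.clog 2 n : ℝ) + 1) * n * m :=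
    le_mul_of_one_le_right (by positivity) hm
  have e5 : (0 : ℝ) ≤ m * n * l * a := by positivity
  nlinarith

/-- Words of `9 * log (n + p + q)` bits can address the arrays. -/
theorem word_bounds {n m p q w : ℕ} (hn : 2 ≤ n) (hp : 0 < p) (hq : 0 < q) (hm : m ≤ n * n)
    (hw : (n + p + q) ^ 9 ≤ 2 ^ w) :
    16 < 2 ^ w ∧ 2 * m + 16 * (n + p + q) ^ 6 + 16 ≤ 2 ^ w ∧ n * n ≤ (n + p + q) ^ 6 ∧
      8 * n ≤ (n + p + q) ^ 6 ∧ 4 * q ≤ (n + p + q) ^ 6 ∧ q * (2 * n) ≤ (n + p + q) ^ 6 := by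
  obtain ⟨B, hB⟩ : ∃ B, n + p + q = B := ⟨_, rfl⟩
  rw [hB] at hw ⊢
  have h4 : 4 ≤ B := by omega
  have h1 : n * n ≤ B * B := Nat.mul_le_mul (by omega) (by omega)
  have h2 : q * n ≤ B * B := Nat.mul_le_mul (by omega) (by omega)
  have h3 : B ≤ B * B := Nat.le_mul_self B
  have h6 : 64 * (B * B) ≤ B ^ 6 := by
    calc 64 * (B * B) ≤ 4 ^ 4 * (B * B) := by gcongr; norm_num
      _ ≤ B ^ 4 * (B * B) := by gcongr
      _ = B ^ 6 := by ring
  have h9 : 64 * B ^ 6 ≤ B ^ 9 := by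
    calc 64 * B ^ 6 = 4 ^ 3 * B ^ 6 := by norm_num
      _ ≤ B ^ 3 * B ^ 6 := by gcongr
      _ = B ^ 9 := by ring
  have h5 : q * (2 * n) = 2 * (q * n) := by ring
  refine ⟨?_, ?_, ?_, ?_, ?_, ?_⟩ <;> omega

end DecrementalAPSP

open DecrementalAPSP

/-- There are programs and absolute constants such that, for every initially connected graph `G`
on `n ≥ 2` vertices, every real `ε > 0`, handed to the machine as a fraction `p / q` (equal to `ε`,
or a lower approximation up to a factor `2`), and every word size of at least `K * log (n + p + q)`
bits, any sequence of edge deletions and distance queries is served, with total update time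
`O(m n log n / ε)` (for `ε ≤ 1`) and worst-case query time `O(log log n)`. -/
theorem theorem2 :
    ∃ (D : DecrementalAPSP.DataStructure) (K : ℕ) (C : ℝ),
      ∀ (n : ℕ), 2 ≤ n →
      ∀ (G : SimpleGraph (Fin n)), G.Connected →
      ∀ (L : List (Fin n × Fin n)), DecrementalAPSP.IsEdgeList L G →
      ∀ (ε : ℝ), 0 < ε →
      ∀ (p q : ℕ), 0 < p → 0 < q → (p : ℝ) / q ≤ ε → ε ≤ 2 * ((p : ℝ) / q) →
      ∀ (w : ℕ), (n + p + q) ^ K ≤ 2 ^ w →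
        ∃ (t₀ : ℕ) (σ₀ : WordRAM.State),
          WordRAM.Exec w D.init (DecrementalAPSP.inputState L p q) t₀ σ₀ ∧
          ∀ (ops : List (DecrementalAPSP.Op n)),
            DecrementalAPSP.Serves D w ε
              (C * ((G.edgeSet.ncard : ℝ) * n * Real.log n / min ε 1))
              (C * (1 + Real.log (Real.log n)))
              ops G σ₀ t₀ := by
  refine ⟨⟨setup, deleteEdge, query⟩, 9, 1000000, ?_⟩
  intro n hn G hG L hL ε hε p q hp hq hpε hεp w hw
  have hlen := length_eq_ncard hL
  obtain ⟨hw16, hX, hsq, hnX, hqX, hqnX⟩ := word_bounds hn hp hq (length_le_sq hL) hw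
  have : Fact (16 < 2 ^ w) := ⟨hw16⟩
  have hpar := params_of hn hp hq
  have hnm : n ≤ G.edgeSet.ncard + 1 := by
    simpa using hG.card_vert_le_card_edgeSet_add_one
  obtain ⟨t₀, σ₀, he, hgood, ht⟩ := run_setup (w := w) (σ := inputState L p q) (Tm := 0)
    (m := L.length) (p := p) (q := q) hn rfl rfl rfl rfl
    (fun k hk => List.getD_eq_default _ _ (by rwa [length_flatMap_pair]))
    (edgeInput hL p q) (natGraph_adj_iff_arcs hL) hpar hX hsq hnX hqX hqnX
  refine ⟨t₀, σ₀, he, fun ops => ?_⟩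
  refine serves_of_good hn (Nat.le_pow_clog (by norm_num) n) hq hpε hpar
    (update_time_le hn hnm hp hq hε hεp) (query_time_le hn) ops G σ₀ t₀ hgood ?_
  rw [zero_add, zero_add, hlen] at ht
  omega
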